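/- All algebras are over $\mathbb C$. For an associative algebra $R$ put $R_1=R$ and let $R_{i+1}$ be the span of all $[a,b]=ab-ba$ with $a\in R$, $b\in R_i$. Let $F^dR$ be the two-sided ideal $\sum_m\sum_{i_1+\dots+i_m-m=d}R\,R_{i_1}R\cdots R\,R_{i_m}R$, and let $R_{[[ab]]}=\varprojlim R/F^dR$. If $\pi:R\to P$ is the abelianization of $R$, let $\mathcal O^{(d)}$ be the sheaf on $\mathrm{Spec}\,P$ whose stalk at $p$ is the Ore localization of $R/F^{d+1}R$ at the elements with image outside $p$, and whose sections are the families of germs which locally are given by one fraction $t^{-1}a$. The formal spectrum $\mathrm{Spf}(R)$ is $\mathrm{Spec}\,P$ with the sheaf of topological algebras $\varprojlim_d\mathcal O^{(d)}$. The NC-affine space is $A^n_{NC}=\mathrm{Spf}(\mathbb C\langle x_1,\dots,x_n\rangle_{[[ab]]})$, with structure sheaf $\mathcal O^{NC}$. For every $d\ge2$ let $B_d$ be an ordered basis of the degree $d$ part of the free Lie algebra on $x_1,\dots,x_n$, and order $B=\coprod_{d\ge 2}B_d$ lexicographically, as $\beta_1,\beta_2,\dots$. Let $\Lambda$ be the set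 of finitely supported functions $\lambda:B\to\mathbb Z_{\ge0}$, put $M_\lambda=\beta_1^{\lambda(\beta_1)}\beta_2^{\lambda(\beta_2)}\cdots\in\mathbb C\langle x_1,\dots,x_n\rangle$ and $\mathrm{ord}(\lambda)=\sum_{d}\sum_{\beta\in B_d}(d-1)\lambda(\beta)$. For a polynomial $f$ let $[[f]]\in\mathbb C\langle x_1,\dots,x_n\rangle$ be obtained by replacing every monomial $x_1^{a_1}\cdots x_n^{a_n}$ by the noncommutative monomial with the factors in this order. Theorem. The natural homomorphism $\mathbb C\langle x_1,\dots,x_n\rangle_{[[ab]]}\to\mathbb C[x_1,\dots,x_n]$ is the abelianization (it is surjective with kernel $F^1$), so that $\mathcal O^{NC}$ is a sheaf on the affine space $A^n=\mathrm{Spec}\,\mathbb C[x_1,\dots,x_n]$. There is a unique family of bilinear differential operators $C^\nu_{\lambda\mu}$ ($\lambda,\mu,\nu\in\Lambda$) with polynomial coefficients such that for all polynomials $f,g$ one has the finite sum $$[[f]]M_\lambda\cdot[[g]]M_\mu=\sum_\nu[[C^\nu_{\lambda\mu}(f,g)]]M_\nu\quad\text{in }\mathbb C\langle x_1,\dots,x_n\rangle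 ,$$ and for every $\nu$ only finitely many $C^\nu_{\lambda\mu}$ are nonzero. For a nonempty Zariski open $U\subset A^n$ let $\mathcal O(U)$ be the algebra of rational functions regular in $U$, and let $\mathcal A(U)$ be the space of possibly infinite formal sums $\sum_{\lambda\in\Lambda}[[f_\lambda]]M_\lambda$, $f_\lambda\in\mathcal O(U)$, with the multiplication $$\Big(\sum_\lambda[[f_\lambda]]M_\lambda\Big)\Big(\sum_\mu[[g_\mu]]M_\mu\Big)=\sum_\nu\Big[\Big[\sum_{\lambda,\mu}C^\nu_{\lambda\mu}(f_\lambda,g_\mu)\Big]\Big]M_\nu .$$ Then there are isomorphisms of algebras $\Phi_U:\mathcal A(U)\to\Gamma(U,\mathcal O^{NC})$ for all nonempty open $U$, such that: they commute with the restriction to smaller nonempty open sets; for a polynomial $f$, $\Phi_U$ sends $[[f]]M_\lambda$ to the section defined by the element $[[f]]M_\lambda$ of $\mathbb C\langle x_1,\dots,x_n\rangle$; and for every $d\geq 0$, $\Phi_U(\sum[[f_\lambda]]M_\lambda)$ has image $0$ in $\Gamma(U,\mathcal O^{(d)})$ if and only if $f_\lambda=0$ for all $\lambda$ with $\mathrm{ord}(\lambda)\le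 d$. -/

import Mathlib

/-! ## The NC-filtration and the NC-completion of an associative algebra -/

noncomputable section

namespace NCGeom

/-- The lower central series of the commutator Lie algebra of `R`, numbered from `0`:
`lieCentral R k` is spanned by the iterated commutators with `k` brackets. -/
def lieCentral (R : Type*) [Ring R] [Algebra ℂ R] : ℕ → Submodule ℂ R
  | 0 => ⊤
  | k + 1 => Submodule.span ℂ {x | ∃ a : R, ∃ b ∈ lieCentral R k, x = a * b - b * a}

/-- The products `r₁ l₁ r₂ l₂ ⋯ rₘ lₘ r` (for all `m`) where `lⱼ` lies in the term of the lower
central series with `kⱼ` brackets and `k₁ + ⋯ + kₘ = d`. -/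
def ncProducts (R : Type*) [Ring R] [Algebra ℂ R] (d : ℕ) : Set R :=
  {x | ∃ (w : List (ℕ × R × R)) (r : R), (∀ e ∈ w, e.2.2 ∈ lieCentral R e.1) ∧
    (w.map fun e => e.1).sum = d ∧ x = (w.map fun e => e.2.1 * e.2.2).prod * r}

/-- The `d`-th layer `F^d R` of the NC-filtration: all sums of products containing `d` instances
of commutator brackets. -/
def ncFiltration (R : Type*) [Ring R] [Algebra ℂ R] (d : ℕ) : Ideal R :=
  Ideal.span (ncProducts R d)

instance ncFiltration_isTwoSided (R : Type*) [Ring R] [Algebra ℂ R] (d : ℕ) :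
    (ncFiltration R d).IsTwoSided where
  mul_mem_of_left {a} b ha := by
    unfold ncFiltration at ha ⊢
    induction ha using Submodule.span_induction with
    | mem x hx =>
      obtain ⟨w, r, hw, hs, rfl⟩ := hx
      exact Ideal.subset_span ⟨w, r * b, hw, hs, by rw [mul_assoc]⟩
    | zero => simp
    | add x y _ _ hx hy => rw [add_mul]; exact Ideal.add_mem _ hx hy
    | smul c x _ hx => rw [smul_eq_mul, mul_assoc]; exact Ideal.mul_mem_left _ _ hx

theorem lieCentral_succ_le (R : Type*) [Ring R] [Algebra ℂ R] (k : ℕ) :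
    lieCentral R (k + 1) ≤ lieCentral R k := by
  induction k with
  | zero => simp [lieCentral]
  | succ k ih =>
    rw [lieCentral, lieCentral]
    refine Submodule.span_mono ?_
    rintro x ⟨a, b, hb, rfl⟩
    exact ⟨a, b, ih hb, rfl⟩

theorem ncProducts_succ_subset (R : Type*) [Ring R] [Algebra ℂ R] (d : ℕ) :
    ncProducts R (d + 1) ⊆ ncProducts R d := by
  rintro x ⟨w, r, hw, hs, rfl⟩
  suffices h : ∃ w' : List (ℕ × R × R), (∀ e ∈ w', e.2.2 ∈ lieCentral R e.1) ∧
      (w'.map fun e => e.1).sum = d ∧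
      (w'.map fun e => e.2.1 * e.2.2).prod = (w.map fun e => e.2.1 * e.2.2).prod by
    obtain ⟨w', h1, h2, h3⟩ := h
    exact ⟨w', r, h1, h2, by rw [h3]⟩
  induction w generalizing d with
  | nil => simp at hs
  | cons e w ih =>
    rcases e with ⟨k, a, l⟩
    rcases k with _ | k
    · have hs' : (w.map fun e => e.1).sum = d + 1 := by simpa using hs
      obtain ⟨w', h1, h2, h3⟩ := ih d (fun e he => hw e (List.mem_cons_of_mem _ he)) hs'
      refine ⟨(0, a, l) :: w', ?_, by simpa using h2, by simp [h3]⟩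
      intro e he
      rcases List.mem_cons.1 he with rfl | he
      · exact hw _ (by simp)
      · exact h1 e he
    · refine ⟨(k, a, l) :: w, ?_, ?_, by simp⟩
      · intro e he
        rcases List.mem_cons.1 he with rfl | he
        · exact lieCentral_succ_le R k (hw (k + 1, a, l) (by simp))
        · exact hw e (List.mem_cons_of_mem _ he)
      · simp only [List.map_cons, List.sum_cons] at hs ⊢
        omega

theorem ncFiltration_succ_le (R : Type*) [Ring R] [Algebra ℂ R] (d : ℕ) :
    ncFiltration R (d + 1) ≤ ncFiltration R d :=
  Ideal.span_mono (ncProducts_succ_subset R d)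

theorem lieCentral_succ_map_eq_zero {R P : Type*} [Ring R] [Algebra ℂ R] [CommRing P] [Algebra ℂ P]
    (π : R →ₐ[ℂ] P) (k : ℕ) (x : R) (hx : x ∈ lieCentral R (k + 1)) : π x = 0 := by
  rw [lieCentral] at hx
  induction hx using Submodule.span_induction with
  | mem x hx =>
    obtain ⟨a, b, _, rfl⟩ := hx
    simp [mul_comm]
  | zero => simp
  | add x y _ _ hx hy => simp [hx, hy]
  | smul c x _ hx => simp [hx]

/-- A homomorphism to a commutative algebra kills `F^d` for `d ≥ 1`. -/
theorem ncFiltration_succ_map_eq_zero {R P : Type*} [Ring R] [Algebra ℂ R] [CommRing P]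
    [Algebra ℂ P] (π : R →ₐ[ℂ] P) (d : ℕ) (x : R) (hx : x ∈ ncFiltration R (d + 1)) : π x = 0 := by
  have h : ncFiltration R (d + 1) ≤ RingHom.ker π := by
    refine Ideal.span_le.2 ?_
    rintro x ⟨w, r, hw, hs, rfl⟩
    have h0 : ∃ e ∈ w, e.1 ≠ 0 := by
      by_contra! hcon
      have : (w.map fun e => e.1).sum = 0 := List.sum_eq_zero (by simpa using hcon)
      omega
    obtain ⟨e, he, hk⟩ := h0
    obtain ⟨k, hk⟩ := Nat.exists_eq_succ_of_ne_zero hk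
    have h2 : π e.2.2 = 0 := lieCentral_succ_map_eq_zero π k _ (by
      have := hw e he
      rwa [hk] at this)
    have h3 : π ((w.map fun e => e.2.1 * e.2.2).prod) = 0 := by
      rw [map_list_prod, List.map_map]
      exact List.prod_eq_zero (List.mem_map.2 ⟨e, he, by simp [h2]⟩)
    change π _ = 0
    rw [map_mul, h3, zero_mul]
  exact h hx

/-- The NC-completion `lim R / F^d R`, as an algebra of compatible families. -/
def ncCompletion (R : Type*) [Ring R] [Algebra ℂ R] :
    Subalgebra ℂ (∀ d : ℕ, R ⧸ ncFiltration R d) where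
  carrier := {x | ∀ d, Ideal.Quotient.factorₐ ℂ (ncFiltration_succ_le R d) (x (d + 1)) = x d}
  mul_mem' {x y} hx hy d := by
    rw [Pi.mul_apply, Pi.mul_apply, map_mul, hx d, hy d]
  add_mem' {x y} hx hy d := by
    rw [Pi.add_apply, Pi.add_apply, map_add, hx d, hy d]
  algebraMap_mem' r d := by
    rw [Pi.algebraMap_apply, Pi.algebraMap_apply, AlgHom.commutes]

/-- The canonical homomorphism from `R` to its NC-completion. -/
def toNCCompletion (R : Type*) [Ring R] [Algebra ℂ R] : R →ₐ[ℂ] ncCompletion R :=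
  AlgHom.codRestrict (AlgHom.pi fun d => Ideal.Quotient.mkₐ ℂ (ncFiltration R d)) _
    fun _ _ => rfl

/-! ### Rings of fractions -/

section Frac

variable {R : Type*} [Ring R] (S : Submonoid R) [OreLocalization.OreSet S]

/-- The ring of left fractions `s⁻¹ r` with respect to an Ore set `S`. -/
def FracRing : Type _ := OreLocalization S R

instance : Ring (FracRing S) := inferInstanceAs (Ring (OreLocalization S R))

instance [Algebra ℂ R] : Algebra ℂ (FracRing S) :=
  inferInstanceAs (Algebra ℂ (OreLocalization S R))

variable {S}

/-- The fraction `s⁻¹ r`. -/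
def FracRing.frac (r : R) (s : S) : FracRing S := OreLocalization.oreDiv r s

theorem FracRing.frac_mul_frac (r₁ r₂ : R) (s₁ s₂ : S) (r' : R) (s' : S)
    (h : (s' : R) * r₁ = r' * s₂) :
    FracRing.frac r₁ s₁ * FracRing.frac r₂ s₂ = FracRing.frac (r' * r₂) (s' * s₁) :=
  OreLocalization.oreDiv_mul_char r₁ r₂ s₁ s₂ r' s' h

theorem FracRing.frac_add_frac (r₁ r₂ : R) (s₁ s₂ : S) (r' : R) (s' : S)
    (h : (s' : R) * s₁ = r' * s₂) :
    FracRing.frac r₁ s₁ + FracRing.frac r₂ s₂ = FracRing.frac (s' * r₁ + r' * r₂) (s' * s₁) :=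
  OreLocalization.oreDiv_add_char s₁ s₂ r' s' h

variable (S)

/-- The canonical homomorphism from a ring to its ring of fractions. -/
def FracRing.of : R →+* FracRing S := OreLocalization.numeratorRingHom

theorem FracRing.of_apply (r : R) : FracRing.of S r = FracRing.frac r 1 := rfl

theorem FracRing.algebraMap_apply [Algebra ℂ R] (c : ℂ) :
    algebraMap ℂ (FracRing S) c = FracRing.frac (algebraMap ℂ R c) 1 := rfl

/-- The homomorphism of rings of fractions induced by a ring homomorphism `f` that maps the
denominators to denominators, sending `s⁻¹ r` to `f(s)⁻¹ f(r)`. -/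
def FracRing.map {R' : Type*} [Ring R'] (S' : Submonoid R') [OreLocalization.OreSet S']
    (f : R →+* R') (hf : ∀ s ∈ S, f s ∈ S') : FracRing S →+* FracRing S' :=
  OreLocalization.universalHom ((FracRing.of S').comp f)
    (Units.liftRight (((FracRing.of S').comp f).toMonoidHom.comp S.subtype)
      (fun s => OreLocalization.numeratorUnit (⟨f s, hf s s.2⟩ : S'))
      (fun _ => rfl))
    (fun _ => rfl)

theorem FracRing.map_of {R' : Type*} [Ring R'] (S' : Submonoid R') [OreLocalization.OreSet S']
    (f : R →+* R') (hf : ∀ s ∈ S, f s ∈ S') (r : R) :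
    FracRing.map S S' f hf (FracRing.of S r) = FracRing.of S' (f r) :=
  OreLocalization.universalHom_commutes _ _ _

end Frac

/-! ## The formal spectrum

Throughout, `π : A → P` is a homomorphism to a commutative algebra; the construction is applied
when `π` is the abelianization of `A`, so that `Spec P` is the underlying space. -/

/-- The truncation `A / F^{d+1} A`, an NC-nilpotent algebra of degree `d`. -/
def Trunc (A : Type*) [Ring A] [Algebra ℂ A] (d : ℕ) : Type _ := A ⧸ ncFiltration A (d + 1)

instance (A : Type*) [Ring A] [Algebra ℂ A] (d : ℕ) : Ring (Trunc A d) :=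
  inferInstanceAs (Ring (A ⧸ ncFiltration A (d + 1)))

instance (A : Type*) [Ring A] [Algebra ℂ A] (d : ℕ) : Algebra ℂ (Trunc A d) :=
  inferInstanceAs (Algebra ℂ (A ⧸ ncFiltration A (d + 1)))

/-- The projection `A → A / F^{d+1} A`. -/
def Trunc.mk (A : Type*) [Ring A] [Algebra ℂ A] (d : ℕ) : A →ₐ[ℂ] Trunc A d :=
  Ideal.Quotient.mkₐ ℂ (ncFiltration A (d + 1))

theorem Trunc.mk_surjective (A : Type*) [Ring A] [Algebra ℂ A] (d : ℕ) :
    Function.Surjective (Trunc.mk A d) :=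
  Ideal.Quotient.mk_surjective

/-- The projection `A / F^{d+2} A → A / F^{d+1} A`. -/
def Trunc.proj (A : Type*) [Ring A] [Algebra ℂ A] (d : ℕ) : Trunc A (d + 1) →ₐ[ℂ] Trunc A d :=
  Ideal.Quotient.factorₐ ℂ (ncFiltration_succ_le A (d + 1))

theorem Trunc.proj_mk (A : Type*) [Ring A] [Algebra ℂ A] (d : ℕ) (a : A) :
    Trunc.proj A d (Trunc.mk A (d + 1) a) = Trunc.mk A d a := rfl

section Spf

variable {A P : Type*} [Ring A] [Algebra ℂ A] [CommRing P] [Algebra ℂ P] (π : A →ₐ[ℂ] P)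

/-- The homomorphism `A / F^{d+1} A → P` induced by `π`. -/
def truncMap (d : ℕ) : Trunc A d →ₐ[ℂ] P :=
  Ideal.Quotient.liftₐ (ncFiltration A (d + 1)) π (ncFiltration_succ_map_eq_zero π d)

theorem truncMap_mk (d : ℕ) (a : A) : truncMap π d (Trunc.mk A d a) = π a := rfl

/-- The elements of `A / F^{d+1} A` whose image in `P` does not lie in the prime `p`. -/
def denoms (d : ℕ) (p : PrimeSpectrum P) : Submonoid (Trunc A d) :=
  p.asIdeal.primeCompl.comap (truncMap π d)

theorem mem_denoms_iff (d : ℕ) (p : PrimeSpectrum P) (s : Trunc A d) :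
    s ∈ denoms π d p ↔ truncMap π d s ∉ p.asIdeal := Iff.rfl

/-- The iterated commutator `[s, [s, ⋯ [s, a]]]` with `k` brackets. -/
def adIter {R : Type*} [Ring R] (s a : R) : ℕ → R
  | 0 => a
  | k + 1 => s * adIter s a k - adIter s a k * s

theorem adIter_mem {R : Type*} [Ring R] [Algebra ℂ R] (s a : R) (k : ℕ) :
    adIter s a k ∈ lieCentral R k := by
  induction k with
  | zero => simp [lieCentral]
  | succ k ih => exact Submodule.subset_span ⟨s, _, ih, rfl⟩

theorem adIter_map {R R' : Type*} [Ring R] [Ring R'] (f : R →+* R') (s a : R) (k : ℕ) :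
    f (adIter s a k) = adIter (f s) (f a) k := by
  induction k with
  | zero => rfl
  | succ k ih => simp [adIter, ih]

theorem adIter_trunc (d : ℕ) (s a : Trunc A d) : adIter s a (d + 1) = 0 := by
  obtain ⟨s, rfl⟩ := Trunc.mk_surjective A d s
  obtain ⟨a, rfl⟩ := Trunc.mk_surjective A d a
  refine (adIter_map (Trunc.mk A d).toRingHom s a (d + 1)).symm.trans
    (Ideal.Quotient.eq_zero_iff_mem.2 ?_)
  exact Ideal.subset_span ⟨[(d + 1, 1, adIter s a (d + 1))], 1,
    by simpa using adIter_mem s a (d + 1), by simp, by simp⟩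

theorem exists_pow_mul_eq {R : Type*} [Ring R] (s a : R) (k : ℕ) :
    ∃ b : R, s ^ k * a = b * s + adIter s a k := by
  induction k with
  | zero => exact ⟨0, by simp [adIter]⟩
  | succ k ih =>
    obtain ⟨b, hb⟩ := ih
    refine ⟨s * b + adIter s a k, ?_⟩
    rw [pow_succ', mul_assoc, hb, adIter]
    noncomm_ring

/-- The left Ore condition in `A / F^{d+1} A`, with a denominator that is a power of `s`. -/
theorem exists_ore (d : ℕ) (s a : Trunc A d) : ∃ b : Trunc A d, s ^ (d + 1) * a = b * s := by
  obtain ⟨b, hb⟩ := exists_pow_mul_eq s a (d + 1)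
  exact ⟨b, by rw [hb, adIter_trunc, add_zero]⟩

theorem pow_mul_eq_adIter {R : Type*} [Ring R] (s a : R) (h : a * s = 0) (k : ℕ) :
    s ^ k * a = adIter s a k ∧ adIter s a k * s = 0 := by
  induction k with
  | zero => exact ⟨by simp [adIter], by simpa [adIter] using h⟩
  | succ k ih =>
    have h1 : adIter s a (k + 1) = s * adIter s a k := by rw [adIter, ih.2, sub_zero]
    refine ⟨by rw [h1, pow_succ', mul_assoc, ih.1], by rw [h1, mul_assoc, ih.2, mul_zero]⟩

instance denomsOreSet (d : ℕ) (p : PrimeSpectrum P) : OreLocalization.OreSet (denoms π d p) where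
  ore_right_cancel r₁ r₂ s h := by
    refine ⟨s ^ (d + 1), ?_⟩
    have h0 : (r₁ - r₂) * (s : Trunc A d) = 0 := by rw [sub_mul, h, sub_self]
    have h1 := (pow_mul_eq_adIter (s : Trunc A d) (r₁ - r₂) h0 (d + 1)).1
    rw [adIter_trunc, mul_sub, sub_eq_zero] at h1
    simpa using h1
  oreNum r s := (exists_ore d (s : Trunc A d) r).choose
  oreDenom _ s := s ^ (d + 1)
  ore_eq r s := by
    simpa using (exists_ore d (s : Trunc A d) r).choose_spec

/-- The stalk at `p` of the structure sheaf of `Spec (A / F^{d+1} A)`: the Ore localization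
inverting every element whose image in `P` does not lie in `p`. -/
abbrev Stalk (d : ℕ) (p : PrimeSpectrum P) : Type _ := FracRing (denoms π d p)

theorem proj_mem_denoms (d : ℕ) (p : PrimeSpectrum P) (s : Trunc A (d + 1))
    (hs : s ∈ denoms π (d + 1) p) : Trunc.proj A d s ∈ denoms π d p := by
  obtain ⟨s, rfl⟩ := Trunc.mk_surjective A (d + 1) s
  rw [mem_denoms_iff, truncMap_mk] at hs
  rwa [Trunc.proj_mk, mem_denoms_iff, truncMap_mk]

/-- The transition homomorphism between the stalks for `d + 1` and for `d`. -/
def stalkProj (d : ℕ) (p : PrimeSpectrum P) : Stalk π (d + 1) p →+* Stalk π d p :=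
  FracRing.map _ _ (Trunc.proj A d).toRingHom (proj_mem_denoms π d p)

open TopologicalSpace (Opens)

/-- A family of germs is a section of the structure sheaf of `Spec (A / F^{d+1} A)` if locally it
is given by one fraction `t⁻¹ a`. -/
def IsLocallyFraction (d : ℕ) (U : Opens (PrimeSpectrum P)) (s : ∀ p : U, Stalk π d p.1) : Prop :=
  ∀ p : U, ∃ V : Opens (PrimeSpectrum P), p.1 ∈ V ∧ ∃ hV : V ≤ U, ∃ a t : Trunc A d,
    ∀ (q : PrimeSpectrum P) (hq : q ∈ V), ∃ ht : t ∈ denoms π d q,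
      s ⟨q, hV hq⟩ = FracRing.frac a ⟨t, ht⟩

/-- The sections over `U` of the structure sheaf of `Spec (A / F^{d+1} A)`. -/
def specSections (d : ℕ) (U : Opens (PrimeSpectrum P)) :
    Subalgebra ℂ (∀ p : U, Stalk π d p.1) where
  carrier := {s | IsLocallyFraction π d U s}
  mul_mem' {x y} hx hy p := by
    obtain ⟨V, hpV, hV, a, t, h⟩ := hx p
    obtain ⟨W, hpW, hW, b, u, k⟩ := hy p
    obtain ⟨c, hc⟩ := exists_ore d u a
    refine ⟨V ⊓ W, ⟨hpV, hpW⟩, inf_le_left.trans hV, c * b, u ^ (d + 1) * t, fun q hq => ?_⟩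
    obtain ⟨ht, h⟩ := h q hq.1
    obtain ⟨hu, k⟩ := k q hq.2
    refine ⟨mul_mem (pow_mem hu _) ht, ?_⟩
    rw [Pi.mul_apply, h, k]
    exact FracRing.frac_mul_frac a b ⟨t, ht⟩ ⟨u, hu⟩ c ⟨u ^ (d + 1), pow_mem hu _⟩ hc
  add_mem' {x y} hx hy p := by
    obtain ⟨V, hpV, hV, a, t, h⟩ := hx p
    obtain ⟨W, hpW, hW, b, u, k⟩ := hy p
    obtain ⟨c, hc⟩ := exists_ore d u t
    refine ⟨V ⊓ W, ⟨hpV, hpW⟩, inf_le_left.trans hV, u ^ (d + 1) * a + c * b, u ^ (d + 1) * t,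
      fun q hq => ?_⟩
    obtain ⟨ht, h⟩ := h q hq.1
    obtain ⟨hu, k⟩ := k q hq.2
    refine ⟨mul_mem (pow_mem hu _) ht, ?_⟩
    rw [Pi.add_apply, h, k]
    exact FracRing.frac_add_frac a b ⟨t, ht⟩ ⟨u, hu⟩ c ⟨u ^ (d + 1), pow_mem hu _⟩ hc
  algebraMap_mem' r p :=
    ⟨U, p.2, le_rfl, algebraMap ℂ (Trunc A d) r, 1, fun q _ =>
      ⟨one_mem _, FracRing.algebraMap_apply (denoms π d q) r⟩⟩

/-- The sections over `U` of the structure sheaf of `Spf A`, the inverse limit of the structure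
sheaves of the `Spec (A / F^{d+1} A)`. -/
def spfSections (U : Opens (PrimeSpectrum P)) :
    Subalgebra ℂ (∀ (d : ℕ) (p : U), Stalk π d p.1) where
  carrier := {s | (∀ d, s d ∈ specSections π d U) ∧
    ∀ (d : ℕ) (p : U), stalkProj π d p.1 (s (d + 1) p) = s d p}
  mul_mem' {x y} hx hy := ⟨fun d => mul_mem (hx.1 d) (hy.1 d), fun d p => by
    rw [Pi.mul_apply, Pi.mul_apply, map_mul, hx.2 d p, hy.2 d p]; rfl⟩
  add_mem' {x y} hx hy := ⟨fun d => add_mem (hx.1 d) (hy.1 d), fun d p => by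
    rw [Pi.add_apply, Pi.add_apply, map_add, hx.2 d p, hy.2 d p]; rfl⟩
  algebraMap_mem' r := ⟨fun d => algebraMap_mem (specSections π d U) r, fun d p => by
    exact FracRing.map_of _ _ _ _ _⟩

/-- Restriction of sections of the structure sheaf of `Spf A`. -/
def spfRestrict {U V : Opens (PrimeSpectrum P)} (h : V ≤ U) :
    spfSections π U →ₐ[ℂ] spfSections π V where
  toFun s := ⟨fun d p => s.1 d ⟨p.1, h p.2⟩, fun d p => by
    obtain ⟨W, hpW, hW, a, t, k⟩ := s.2.1 d ⟨p.1, h p.2⟩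
    exact ⟨W ⊓ V, ⟨hpW, p.2⟩, inf_le_right, a, t, fun q hq => k q hq.1⟩,
    fun d p => s.2.2 d ⟨p.1, h p.2⟩⟩
  map_one' := rfl
  map_mul' _ _ := rfl
  map_zero' := rfl
  map_add' _ _ := rfl
  commutes' _ := rfl

/-- The canonical homomorphism from `A` to the sections of the structure sheaf of `Spf A`. -/
def toSpfSections (U : Opens (PrimeSpectrum P)) : A →+* spfSections π U where
  toFun a := ⟨fun d p => FracRing.of (denoms π d p.1) (Trunc.mk A d a),
    fun d p => ⟨U, p.2, le_rfl, Trunc.mk A d a, 1, fun _ _ => ⟨one_mem _, rfl⟩⟩,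
    fun d p => FracRing.map_of _ _ _ _ _⟩
  map_one' := Subtype.ext (funext fun d => funext fun p => by simp)
  map_mul' _ _ := Subtype.ext (funext fun d => funext fun p => by simp)
  map_zero' := Subtype.ext (funext fun d => funext fun p => by simp)
  map_add' _ _ := Subtype.ext (funext fun d => funext fun p => by simp)

end Spf

/-! ## The noncommutative affine space -/

open TopologicalSpace (Opens)

/-- The NC-completion of the free associative algebra `ℂ⟨x₁, …, xₙ⟩`. -/
def FreeNC (n : ℕ) : Type := ncCompletion (FreeAlgebra ℂ (Fin n))

instance (n : ℕ) : Ring (FreeNC n) :=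
  inferInstanceAs (Ring (ncCompletion (FreeAlgebra ℂ (Fin n))))

instance (n : ℕ) : Algebra ℂ (FreeNC n) :=
  inferInstanceAs (Algebra ℂ (ncCompletion (FreeAlgebra ℂ (Fin n))))

/-- The canonical homomorphism from `ℂ⟨x₁, …, xₙ⟩` to its NC-completion. -/
def toFreeNC (n : ℕ) : FreeAlgebra ℂ (Fin n) →ₐ[ℂ] FreeNC n :=
  toNCCompletion (FreeAlgebra ℂ (Fin n))

/-- The abelianization homomorphism from the NC-completion of `ℂ⟨x₁, …, xₙ⟩` to
`ℂ[x₁, …, xₙ]`. -/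
def abMap (n : ℕ) : FreeNC n →ₐ[ℂ] MvPolynomial (Fin n) ℂ :=
  (Ideal.Quotient.liftₐ (ncFiltration (FreeAlgebra ℂ (Fin n)) 1)
      (FreeAlgebra.lift ℂ (MvPolynomial.X : Fin n → MvPolynomial (Fin n) ℂ))
      (ncFiltration_succ_map_eq_zero _ 0)).comp
    ((Pi.evalAlgHom ℂ (fun d : ℕ => FreeAlgebra ℂ (Fin n) ⧸ ncFiltration (FreeAlgebra ℂ (Fin n)) d)
      1).comp (ncCompletion (FreeAlgebra ℂ (Fin n))).val)

/-- Affine `n`-space over `ℂ`, as the prime spectrum of `ℂ[x₁, …, xₙ]`. -/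
abbrev AffSpace (n : ℕ) : Type := PrimeSpectrum (MvPolynomial (Fin n) ℂ)

/-- The sections over `U` of the structure sheaf of the NC-affine space, the formal spectrum of the
NC-completion of `ℂ⟨x₁, …, xₙ⟩`. -/
abbrev ncAffineSections (n : ℕ) (U : Opens (AffSpace n)) :
    Subalgebra ℂ (∀ (d : ℕ) (p : U), Stalk (abMap n) d p.1) :=
  spfSections (abMap n) U

/-! ## Regular functions and differential operators -/

/-- The field of rational functions in `n` variables. -/
abbrev RatFun (n : ℕ) : Type := FractionRing (MvPolynomial (Fin n) ℂ)

/-- The algebra `𝒪(U)` of the rational functions which are regular in `U`. -/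
def regularFunctions {n : ℕ} (U : Opens (AffSpace n)) : Subalgebra ℂ (RatFun n) where
  carrier := {f | ∀ p ∈ U, ∃ a s : MvPolynomial (Fin n) ℂ, s ∉ p.asIdeal ∧
    f * algebraMap _ (RatFun n) s = algebraMap _ (RatFun n) a}
  mul_mem' {f g} hf hg p hp := by
    obtain ⟨a, s, hs, h⟩ := hf p hp
    obtain ⟨b, t, ht, k⟩ := hg p hp
    refine ⟨a * b, s * t, fun hst => (p.isPrime.mem_or_mem hst).elim hs ht, ?_⟩
    rw [map_mul, map_mul, ← h, ← k]
    ring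
  add_mem' {f g} hf hg p hp := by
    obtain ⟨a, s, hs, h⟩ := hf p hp
    obtain ⟨b, t, ht, k⟩ := hg p hp
    refine ⟨a * t + b * s, s * t, fun hst => (p.isPrime.mem_or_mem hst).elim hs ht, ?_⟩
    rw [map_mul, map_add, map_mul, map_mul, ← h, ← k]
    ring
  algebraMap_mem' r p _ :=
    ⟨algebraMap ℂ _ r, 1, fun h => p.isPrime.ne_top ((Ideal.eq_top_iff_one _).2 h), by
      rw [map_one, mul_one, ← IsScalarTower.algebraMap_apply]⟩

theorem regularFunctions_anti {n : ℕ} {U V : Opens (AffSpace n)} (h : V ≤ U) :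
    regularFunctions U ≤ regularFunctions V := fun _ hf p hp => hf p (h hp)

/-- Polynomials are regular functions. -/
def polyToRegular {n : ℕ} (U : Opens (AffSpace n)) :
    MvPolynomial (Fin n) ℂ →ₐ[ℂ] regularFunctions U :=
  AlgHom.codRestrict (IsScalarTower.toAlgHom ℂ (MvPolynomial (Fin n) ℂ) (RatFun n)) _
    fun f p _ => ⟨f, 1, fun h => p.isPrime.ne_top ((Ideal.eq_top_iff_one _).2 h), by simp⟩

/-- The quotient rule for the partial derivative `∂/∂xᵢ` of a rational function. -/
def ratDerivFun {n : ℕ} (i : Fin n) (f : RatFun n) : RatFun n :=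
  let a := (IsLocalization.sec (nonZeroDivisors (MvPolynomial (Fin n) ℂ)) f).1
  let s : MvPolynomial (Fin n) ℂ :=
    (IsLocalization.sec (nonZeroDivisors (MvPolynomial (Fin n) ℂ)) f).2.1
  algebraMap _ (RatFun n) (s * MvPolynomial.pderiv i a - a * MvPolynomial.pderiv i s) /
    algebraMap _ (RatFun n) s ^ 2

theorem quotientRule_aux {P : Type*} [CommRing P] [Algebra ℂ P] (D : Derivation ℂ P P)
    (a b s t : P) (e : a * t = b * s) :
    (t * D b - b * D t) * s ^ 2 = (s * D a - a * D s) * t ^ 2 := by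
  have e' := congrArg D e
  rw [Derivation.leibniz, Derivation.leibniz] at e'
  simp only [smul_eq_mul] at e'
  linear_combination (-(s * t)) * e' + (s * D t + t * D s) * e

theorem ratDerivFun_eq {n : ℕ} (i : Fin n) (f : RatFun n) (a s : MvPolynomial (Fin n) ℂ)
    (hs : s ≠ 0) (h : f * algebraMap _ (RatFun n) s = algebraMap _ (RatFun n) a) :
    ratDerivFun i f =
      algebraMap _ (RatFun n) (s * MvPolynomial.pderiv i a - a * MvPolynomial.pderiv i s) /
        algebraMap _ (RatFun n) s ^ 2 := by
  set b := (IsLocalization.sec (nonZeroDivisors (MvPolynomial (Fin n) ℂ)) f).1 with hb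
  set t : MvPolynomial (Fin n) ℂ :=
    (IsLocalization.sec (nonZeroDivisors (MvPolynomial (Fin n) ℂ)) f).2.1 with ht
  have hk : f * algebraMap _ (RatFun n) t = algebraMap _ (RatFun n) b :=
    IsLocalization.sec_spec (nonZeroDivisors (MvPolynomial (Fin n) ℂ)) f
  have ht0 : t ≠ 0 := nonZeroDivisors.coe_ne_zero _
  have inj := IsFractionRing.injective (MvPolynomial (Fin n) ℂ) (RatFun n)
  have hs' : algebraMap _ (RatFun n) s ≠ 0 := by simpa using hs
  have ht' : algebraMap _ (RatFun n) t ≠ 0 := by simpa using ht0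
  have e : a * t = b * s := by
    apply inj
    rw [map_mul, map_mul, ← h, ← hk]
    ring
  have hD : ratDerivFun i f =
      algebraMap _ (RatFun n) (t * MvPolynomial.pderiv i b - b * MvPolynomial.pderiv i t) /
        algebraMap _ (RatFun n) t ^ 2 := rfl
  rw [hD, div_eq_div_iff (pow_ne_zero 2 ht') (pow_ne_zero 2 hs'), ← map_pow, ← map_pow, ← map_mul,
    ← map_mul, quotientRule_aux (MvPolynomial.pderiv i) a b s t e]

theorem exists_ratio {n : ℕ} (f : RatFun n) : ∃ a s : MvPolynomial (Fin n) ℂ, s ≠ 0 ∧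
    f * algebraMap _ (RatFun n) s = algebraMap _ (RatFun n) a :=
  ⟨_, _, nonZeroDivisors.coe_ne_zero _,
    IsLocalization.sec_spec (nonZeroDivisors (MvPolynomial (Fin n) ℂ)) f⟩

theorem ratDerivFun_add {n : ℕ} (i : Fin n) (f g : RatFun n) :
    ratDerivFun i (f + g) = ratDerivFun i f + ratDerivFun i g := by
  obtain ⟨a, s, hs, h⟩ := exists_ratio f
  obtain ⟨b, t, ht, k⟩ := exists_ratio g
  have hs' : algebraMap _ (RatFun n) s ≠ 0 := by simpa using hs
  have ht' : algebraMap _ (RatFun n) t ≠ 0 := by simpa using ht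
  rw [ratDerivFun_eq i f a s hs h, ratDerivFun_eq i g b t ht k,
    ratDerivFun_eq i (f + g) (a * t + b * s) (s * t) (mul_ne_zero hs ht) (by
      simp only [map_mul, map_add, ← h, ← k]; ring)]
  simp only [map_add, map_sub, map_mul, Derivation.leibniz, smul_eq_mul]
  generalize algebraMap (MvPolynomial (Fin n) ℂ) (RatFun n) s = S at *
  generalize algebraMap (MvPolynomial (Fin n) ℂ) (RatFun n) t = T at *
  rw [div_add_div _ _ (pow_ne_zero 2 hs') (pow_ne_zero 2 ht'),
    div_eq_div_iff (pow_ne_zero 2 (mul_ne_zero hs' ht'))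
      (mul_ne_zero (pow_ne_zero 2 hs') (pow_ne_zero 2 ht'))]
  ring

theorem ratDerivFun_mul {n : ℕ} (i : Fin n) (f g : RatFun n) :
    ratDerivFun i (f * g) = f * ratDerivFun i g + g * ratDerivFun i f := by
  obtain ⟨a, s, hs, h⟩ := exists_ratio f
  obtain ⟨b, t, ht, k⟩ := exists_ratio g
  have hs' : algebraMap _ (RatFun n) s ≠ 0 := by simpa using hs
  have ht' : algebraMap _ (RatFun n) t ≠ 0 := by simpa using ht
  rw [ratDerivFun_eq i f a s hs h, ratDerivFun_eq i g b t ht k,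
    ratDerivFun_eq i (f * g) (a * b) (s * t) (mul_ne_zero hs ht) (by
      simp only [map_mul, ← h, ← k]; ring)]
  simp only [map_sub, map_mul, Derivation.leibniz, smul_eq_mul, map_add, ← h, ← k]
  generalize algebraMap (MvPolynomial (Fin n) ℂ) (RatFun n) s = S at *
  generalize algebraMap (MvPolynomial (Fin n) ℂ) (RatFun n) t = T at *
  rw [← mul_div_assoc, ← mul_div_assoc, div_add_div _ _ (pow_ne_zero 2 ht') (pow_ne_zero 2 hs'),
    div_eq_div_iff (pow_ne_zero 2 (mul_ne_zero hs' ht'))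
      (mul_ne_zero (pow_ne_zero 2 ht') (pow_ne_zero 2 hs'))]
  ring

theorem ratDerivFun_algebraMap {n : ℕ} (i : Fin n) (a : MvPolynomial (Fin n) ℂ) :
    ratDerivFun i (algebraMap _ (RatFun n) a) =
      algebraMap _ (RatFun n) (MvPolynomial.pderiv i a) := by
  rw [ratDerivFun_eq i _ a 1 one_ne_zero (by simp)]
  simp

theorem ratDerivFun_smul {n : ℕ} (i : Fin n) (c : ℂ) (f : RatFun n) :
    ratDerivFun i (c • f) = c • ratDerivFun i f := by
  rw [Algebra.smul_def, Algebra.smul_def,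
    IsScalarTower.algebraMap_apply ℂ (MvPolynomial (Fin n) ℂ) (RatFun n), ratDerivFun_mul,
    ratDerivFun_algebraMap]
  simp [MvPolynomial.algebraMap_eq]

/-- The partial derivative `∂/∂xᵢ` on rational functions. -/
def ratDeriv {n : ℕ} (i : Fin n) : Derivation ℂ (RatFun n) (RatFun n) :=
  Derivation.mk'
    { toFun := ratDerivFun i
      map_add' := ratDerivFun_add i
      map_smul' := ratDerivFun_smul i }
    (ratDerivFun_mul i)

theorem ratDeriv_mem {n : ℕ} (U : Opens (AffSpace n)) (i : Fin n) (f : RatFun n)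
    (hf : f ∈ regularFunctions U) : ratDeriv i f ∈ regularFunctions U := by
  intro p hp
  obtain ⟨a, s, hs, h⟩ := hf p hp
  have hs0 : s ≠ 0 := fun h0 => hs (h0 ▸ p.asIdeal.zero_mem)
  have hs' : algebraMap _ (RatFun n) s ≠ 0 := by simpa using hs0
  refine ⟨s * MvPolynomial.pderiv i a - a * MvPolynomial.pderiv i s, s ^ 2,
    fun h2 => hs (p.isPrime.mem_of_pow_mem 2 h2), ?_⟩
  change ratDerivFun i f * _ = _
  rw [ratDerivFun_eq i f a s hs0 h, map_pow, div_mul_cancel₀ _ (pow_ne_zero 2 hs')]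

/-- The partial derivative `∂/∂xᵢ` on the regular functions in `U`. -/
def regularDeriv {n : ℕ} (U : Opens (AffSpace n)) (i : Fin n) :
    Derivation ℂ (regularFunctions U) (regularFunctions U) :=
  Derivation.mk'
    { toFun := fun f => ⟨ratDeriv i f.1, ratDeriv_mem U i f.1 f.2⟩
      map_add' := fun f g => Subtype.ext (map_add (ratDeriv i) f.1 g.1)
      map_smul' := fun c f => Subtype.ext ((ratDeriv i).map_smul c f.1) }
    (fun f g => Subtype.ext ((ratDeriv i).leibniz f.1 g.1))

/-- A bilinear differential operator with polynomial coefficients in `n` variables: the finitely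
supported family `c` stands for the formal expression `∑ c (α, β) · ∂^α ⊗ ∂^β`. -/
abbrev BiDiffOp (n : ℕ) : Type :=
  ((Fin n →₀ ℕ) × (Fin n →₀ ℕ)) →₀ MvPolynomial (Fin n) ℂ

/-- The iterated derivation `D₁^{α₁} ⋯ Dₙ^{αₙ}`. -/
def iterDeriv {n : ℕ} {A : Type*} [CommRing A] [Algebra ℂ A] (D : Fin n → Derivation ℂ A A)
    (α : Fin n →₀ ℕ) : Module.End ℂ A :=
  (List.ofFn fun i => ((D i : A →ₗ[ℂ] A) : Module.End ℂ A) ^ α i).prod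

/-- The value of a bilinear differential operator on two elements of a commutative algebra `A` on
which `xᵢ` acts through `e : ℂ[x₁, …, xₙ] → A` and `∂/∂xᵢ` acts as the derivation `D i`. -/
def BiDiffOp.eval {n : ℕ} {A : Type*} [CommRing A] [Algebra ℂ A]
    (e : MvPolynomial (Fin n) ℂ →ₐ[ℂ] A) (D : Fin n → Derivation ℂ A A) (C : BiDiffOp n)
    (f g : A) : A :=
  C.sum fun αβ c => e c * (iterDeriv D αβ.1 f * iterDeriv D αβ.2 g)

/-- The value of a bilinear differential operator on polynomials. -/
def BiDiffOp.evalPoly {n : ℕ} (C : BiDiffOp n) (f g : MvPolynomial (Fin n) ℂ) :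
    MvPolynomial (Fin n) ℂ :=
  C.eval (AlgHom.id ℂ _) MvPolynomial.pderiv f g

/-- The value of a bilinear differential operator on regular functions in `U`. -/
def BiDiffOp.evalRegular {n : ℕ} (U : Opens (AffSpace n)) (C : BiDiffOp n)
    (f g : regularFunctions U) : regularFunctions U :=
  C.eval (polyToRegular U) (regularDeriv U) f g

/-! ## The free Lie algebra and the normal form -/

/-- Lie monomials in `x₁, …, xₙ` of a given degree. -/
inductive IsLieMonomial {n : ℕ} : ℕ → FreeLieAlgebra ℂ (Fin n) → Prop
  | of (i : Fin n) : IsLieMonomial 1 (FreeLieAlgebra.of ℂ i)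
  | bracket {d e : ℕ} {u v : FreeLieAlgebra ℂ (Fin n)} (hu : IsLieMonomial d u)
      (hv : IsLieMonomial e v) : IsLieMonomial (d + e) ⁅u, v⁆

/-- The degree `d` part of the free Lie algebra on `x₁, …, xₙ`. -/
def lieDegree (n d : ℕ) : Submodule ℂ (FreeLieAlgebra ℂ (Fin n)) :=
  Submodule.span ℂ {u | IsLieMonomial d u}

section

attribute [local instance] LieRing.ofAssociativeRing

/-- The embedding of the free Lie algebra into the free associative algebra, where the bracket is
the commutator. -/
def lieToFree (n : ℕ) : FreeLieAlgebra ℂ (Fin n) →ₗ[ℂ] FreeAlgebra ℂ (Fin n) :=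
  (FreeLieAlgebra.lift ℂ (FreeAlgebra.ι ℂ : Fin n → FreeAlgebra ℂ (Fin n)) :
    FreeLieAlgebra ℂ (Fin n) →ₗ[ℂ] FreeAlgebra ℂ (Fin n))

end

/-- The index set of the disjoint union of ordered sets `B₂, B₃, …`, where `B_{d+2}` has `m d`
elements, with the lexicographic order (`B_d` precedes `B_{d'}` if `d < d'`). -/
abbrev LieIndex (m : ℕ → ℕ) : Type := Σₗ d : ℕ, Fin (m d)

/-- The finitely supported functions from the union of the `B_d` to the natural numbers. -/
abbrev MultiIndex (m : ℕ → ℕ) : Type := LieIndex m →₀ ℕ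

/-- `ord(λ) = ∑ λ(β) ord(β)`, where `ord(β)` is the number of brackets in `β`, that is, its degree
minus one. -/
def MultiIndex.ord {m : ℕ → ℕ} (l : MultiIndex m) : ℕ :=
  l.sum fun β k => k * ((ofLex β).1 + 1)

/-- The ordered product `M_λ = β₁^{λ(β₁)} β₂^{λ(β₂)} ⋯` of basic Lie elements. -/
def orderedMonomial {n : ℕ} {m : ℕ → ℕ}
    (B : ∀ d, Module.Basis (Fin (m d)) ℂ (lieDegree n (d + 2))) (l : MultiIndex m) :
    FreeAlgebra ℂ (Fin n) :=
  (l.support.sort.map fun β =>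
    lieToFree n (B (ofLex β).1 (ofLex β).2 : FreeLieAlgebra ℂ (Fin n)) ^ l β).prod

/-- The normal ordering `⟦f⟧` of a polynomial: each monomial `x₁^{a₁} ⋯ xₙ^{aₙ}` is replaced by the
noncommutative monomial with the variables in this order. -/
def normalOrder (n : ℕ) : MvPolynomial (Fin n) ℂ →ₗ[ℂ] FreeAlgebra ℂ (Fin n) :=
  (MvPolynomial.basisMonomials (Fin n) ℂ).constr ℂ fun a =>
    (List.ofFn fun i => FreeAlgebra.ι ℂ i ^ a i).prod

/-- The bilinear differential operators `C λ μ ν` bring products to the normal form: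
`⟦f⟧ M_λ · ⟦g⟧ M_μ = ∑_ν ⟦C λ μ ν (f, g)⟧ M_ν` in `ℂ⟨x₁, …, xₙ⟩`, the sum being finite. -/
def IsNormalFormOperators {n : ℕ} {m : ℕ → ℕ}
    (B : ∀ d, Module.Basis (Fin (m d)) ℂ (lieDegree n (d + 2)))
    (C : MultiIndex m → MultiIndex m → MultiIndex m → BiDiffOp n) : Prop :=
  ∀ (l k : MultiIndex m) (f g : MvPolynomial (Fin n) ℂ),
    {v | (C l k v).evalPoly f g ≠ 0}.Finite ∧
    normalOrder n f * orderedMonomial B l * (normalOrder n g * orderedMonomial B k) =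
      ∑ᶠ v, normalOrder n ((C l k v).evalPoly f g) * orderedMonomial B v

/-- The space `𝒜(U)` of possibly infinite formal sums `∑_λ ⟦f_λ⟧ M_λ` with `f_λ ∈ 𝒪(U)`. -/
abbrev NormalSeries {n : ℕ} (m : ℕ → ℕ) (U : Opens (AffSpace n)) : Type :=
  MultiIndex m → regularFunctions U

/-- The formal sum with the single term `⟦f⟧ M_λ`. -/
def NormalSeries.term {n : ℕ} {m : ℕ → ℕ} {U : Opens (AffSpace n)} (f : regularFunctions U)
    (l : MultiIndex m) : NormalSeries m U :=
  open Classical in Pi.single l f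

/-- The multiplication of formal sums determined by
`⟦f⟧ M_λ · ⟦g⟧ M_μ = ∑_ν ⟦C λ μ ν (f, g)⟧ M_ν`. -/
def NormalSeries.mul {n : ℕ} {m : ℕ → ℕ} {U : Opens (AffSpace n)}
    (C : MultiIndex m → MultiIndex m → MultiIndex m → BiDiffOp n) (s t : NormalSeries m U) :
    NormalSeries m U :=
  fun v => ∑ᶠ lk : MultiIndex m × MultiIndex m,
    (C lk.1 lk.2 v).evalRegular U (s lk.1) (t lk.2)

/-- Restriction of formal sums to a smaller open set. -/
def NormalSeries.restrict {n : ℕ} {m : ℕ → ℕ} {U V : Opens (AffSpace n)} (h : V ≤ U)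
    (s : NormalSeries m U) : NormalSeries m V :=
  fun l => Subalgebra.inclusion (regularFunctions_anti h) (s l)

end NCGeom

end

noncomputable section

namespace NCGeom
/-! ## Derivations of the free algebra -/

/-! The theorem rests on a Poincaré–Birkhoff–Witt basis adapted to the NC-filtration. Give a Lie
generator the number of its brackets as weight. A commutator of two generators is a combination of
single generators whose weight is one more than the sum, so sorting a product costs only shorter
products of larger weight (`prod_sub_prod_mem_of_perm`). Hence the ordered products `⟦x^a⟧ M_λ`
span, and those with `ord λ ≥ e` span exactly `F^e` (`mem_ncFiltration_iff`). They are independent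
because the generators are linearly independent primitive elements for the coproduct
(`linearIndependent_sortedProd`); the generators themselves are independent by Dynkin's operator
within a degree and by the eigenspaces of the Euler derivation across degrees.

The coefficient of `M_ν` in `⟦f⟧ M_λ ⟦g⟧ M_μ` is bilinear in `f` and `g`. The derivation of the free
algebra lifting `∂/∂xᵢ` kills Lie elements of degree at least two, so this bilinear map is
translation invariant and is determined by its constant terms on pairs of monomials. Homogeneity
leaves finitely many nonzero ones: the map is a bidifferential operator with constant coefficients
(`evalPoly_normalOp`). Since `F^d F^e ⊆ F^{d+e}`, it vanishes unless `ord λ + ord μ ≤ ord ν`, so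
infinite formal sums can be multiplied.

All open sets are treated inside one ring `RatSeries` of formal sums with rational coefficients. It
is associative because a differential operator on the fraction field that vanishes on polynomials is
zero. On lowest order terms the product is the product of functions (`coeff_mul_top`), so a series
with nonzero coefficient at `λ = 0` is invertible modulo any order (`isUnit_mk`).

The truncations of the completion agree with those of the free algebra: an element of `F^{e+1}` is a
sum of a fixed number of commutator terms with entries in `F^e`, a form that survives infinite
summation, so the NC-filtration of the completion is closed
(`mem_ncFiltration_freeNC_of_proj_eq_zero`). Every stalk therefore embeds into truncated series
(`ofStalk_injective`). A series regular in `U` is locally one fraction, by clearing denominators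
order by order (`exists_fraction`). Conversely, a section has the same series at all points, because
every nonempty open set contains the generic point, and its coefficients are regular because
denominators have inverses with regular coefficients nearby (`coeff_mem_regularFunctions`). These
series stabilise as `d` grows and give the formal sum. -/

/-- The derivation of the free associative algebra with prescribed values on the generators. -/
def freeDeriv {n : ℕ} (δ : Fin n → FreeAlgebra ℂ (Fin n)) :
    FreeAlgebra ℂ (Fin n) →ₗ[ℂ] FreeAlgebra ℂ (Fin n) :=
  (TrivSqZeroExt.sndHom (FreeAlgebra ℂ (Fin n)) (FreeAlgebra ℂ (Fin n))).restrictScalars ℂ ∘ₗ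
    (FreeAlgebra.lift ℂ (fun i => (TrivSqZeroExt.inl (FreeAlgebra.ι ℂ i) +
      TrivSqZeroExt.inr (δ i) : TrivSqZeroExt (FreeAlgebra ℂ (Fin n)) (FreeAlgebra ℂ (Fin n))))
      ).toLinearMap

theorem freeDeriv_ι {n : ℕ} (δ : Fin n → FreeAlgebra ℂ (Fin n)) (i : Fin n) :
    freeDeriv δ (FreeAlgebra.ι ℂ i) = δ i := by
  simp [freeDeriv]

theorem freeDeriv_mul {n : ℕ} (δ : Fin n → FreeAlgebra ℂ (Fin n)) (a b : FreeAlgebra ℂ (Fin n)) :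
    freeDeriv δ (a * b) = a * freeDeriv δ b + freeDeriv δ a * b := by
  -- The first component of the lift to the square-zero extension is the identity, so the product
  -- rule there reads as the Leibniz rule for the second component.
  have h : (TrivSqZeroExt.fstHom ℂ (FreeAlgebra ℂ (Fin n)) (FreeAlgebra ℂ (Fin n))).comp
      (FreeAlgebra.lift ℂ (fun i => (TrivSqZeroExt.inl (FreeAlgebra.ι ℂ i) +
      TrivSqZeroExt.inr (δ i) : TrivSqZeroExt (FreeAlgebra ℂ (Fin n)) (FreeAlgebra ℂ (Fin n)))))
      = AlgHom.id ℂ _ := by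
    apply FreeAlgebra.hom_ext
    funext i
    simp
  have h' := fun x => DFunLike.congr_fun h x
  simp only [AlgHom.comp_apply, TrivSqZeroExt.fstHom_apply, AlgHom.id_apply] at h'
  simp [freeDeriv, -DualNumber.inr_eq_smul_eps, h']

theorem freeDeriv_one {n : ℕ} (δ : Fin n → FreeAlgebra ℂ (Fin n)) : freeDeriv δ 1 = 0 := by
  simp [freeDeriv]

/-- The derivation of the free algebra lifting `∂/∂xᵢ`. -/
def freePartial {n : ℕ} (i : Fin n) : FreeAlgebra ℂ (Fin n) →ₗ[ℂ] FreeAlgebra ℂ (Fin n) :=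
  freeDeriv (Pi.single i 1)

/-- The Euler derivation of the free algebra, multiplying words by their length. -/
def freeEuler (n : ℕ) : FreeAlgebra ℂ (Fin n) →ₗ[ℂ] FreeAlgebra ℂ (Fin n) :=
  freeDeriv (FreeAlgebra.ι ℂ)

/-! ## Lie elements -/

theorem lieToFree_of {n : ℕ} (i : Fin n) :
    lieToFree n (FreeLieAlgebra.of ℂ i) = FreeAlgebra.ι ℂ i := by
  simp [lieToFree]

theorem lieToFree_lie {n : ℕ} (u v : FreeLieAlgebra ℂ (Fin n)) :
    lieToFree n ⁅u, v⁆ = lieToFree n u * lieToFree n v - lieToFree n v * lieToFree n u := by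
  let _ := LieRing.ofAssociativeRing (A := FreeAlgebra ℂ (Fin n))
  exact LieHom.map_lie (FreeLieAlgebra.lift ℂ (FreeAlgebra.ι ℂ : Fin n → FreeAlgebra ℂ (Fin n)))
    u v

theorem IsLieMonomial.pos {n d : ℕ} {u : FreeLieAlgebra ℂ (Fin n)} (h : IsLieMonomial d u) :
    0 < d := by
  induction h with
  | of => exact one_pos
  | bracket => omega

theorem lie_mem_lieDegree {n d e : ℕ} {u v : FreeLieAlgebra ℂ (Fin n)} (hu : u ∈ lieDegree n d)
    (hv : v ∈ lieDegree n e) : ⁅u, v⁆ ∈ lieDegree n (d + e) := by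
  induction hu using Submodule.span_induction with
  | mem u hu =>
    induction hv using Submodule.span_induction with
    | mem v hv => exact Submodule.subset_span (.bracket hu hv)
    | zero => simp
    | add x y _ _ hx hy => rw [lie_add]; exact add_mem hx hy
    | smul c x _ hx => rw [lie_smul]; exact Submodule.smul_mem _ _ hx
  | zero => simp
  | add x y _ _ hx hy => rw [add_lie]; exact add_mem hx hy
  | smul c x _ hx => rw [smul_lie]; exact Submodule.smul_mem _ _ hx

/-- The Jacobi identity `[[u₁, u₂], v] = [u₁, [u₂, v]] - [u₂, [u₁, v]]` shortens the left factor
until it is a variable; `v` has to vary in the induction. -/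
theorem lie_mem_span_of_lie {n d e : ℕ} {u v : FreeLieAlgebra ℂ (Fin n)} (hu : IsLieMonomial d u)
    (hv : v ∈ lieDegree n e) :
    ⁅u, v⁆ ∈ Submodule.span ℂ {w | ∃ i : Fin n, ∃ v ∈ lieDegree n (d + e - 1),
      w = ⁅FreeLieAlgebra.of ℂ i, v⁆} := by
  induction hu generalizing v e with
  | of i => exact Submodule.subset_span ⟨i, v, by simpa using hv, rfl⟩
  | @bracket d₁ d₂ u₁ u₂ h₁ h₂ ih₁ ih₂ =>
    rw [lie_lie]
    refine sub_mem ?_ ?_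
    · have := ih₁ (lie_mem_lieDegree (Submodule.subset_span h₂) hv)
      rwa [← add_assoc] at this
    · have := ih₂ (lie_mem_lieDegree (Submodule.subset_span h₁) hv)
      rwa [← add_assoc, add_comm d₂] at this

/-- A Lie element of degree `k + 2` is a combination of brackets `[xᵢ, v]`. -/
theorem lieDegree_le_span {n k : ℕ} :
    lieDegree n (k + 2) ≤ Submodule.span ℂ {w | ∃ i : Fin n, ∃ v ∈ lieDegree n (k + 1),
      w = ⁅FreeLieAlgebra.of ℂ i, v⁆} := by
  refine Submodule.span_le.2 fun u hu => ?_
  generalize hd : k + 2 = d at hu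
  cases hu with
  | of i => omega
  | @bracket d e u v h h' =>
    have := lie_mem_span_of_lie h (Submodule.subset_span h')
    rwa [show d + e - 1 = k + 1 by omega] at this

theorem lieDegree_one (n : ℕ) :
    lieDegree n 1 = Submodule.span ℂ (Set.range (FreeLieAlgebra.of ℂ)) := by
  refine congrArg (Submodule.span ℂ) (Set.ext fun u => ⟨fun hu => ?_, ?_⟩)
  · change IsLieMonomial 1 u at hu
    generalize hd : 1 = d at hu
    cases hu with
    | of i => exact ⟨i, rfl⟩
    | bracket h h' => have := h.pos; have := h'.pos; omega
  · rintro ⟨i, rfl⟩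
    exact .of i

/-- The representation of the free algebra on `L × ℂ` which realises Dynkin's operator. -/
def dynkinRep (n : ℕ) :
    FreeAlgebra ℂ (Fin n) →ₐ[ℂ] Module.End ℂ (FreeLieAlgebra ℂ (Fin n) × ℂ) :=
  FreeAlgebra.lift ℂ fun i => LinearMap.inl ℂ _ _ ∘ₗ
    LinearMap.coprod ((LieAlgebra.ad ℂ _ (FreeLieAlgebra.of ℂ i) : Module.End ℂ _))
      (LinearMap.toSpanSingleton ℂ _ (FreeLieAlgebra.of ℂ i))

/-- A variable acts by `(v, c) ↦ ([xᵢ, v] + c xᵢ, 0)`. Taking commutators adds the degrees in the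
second summand and reproduces the adjoint action in the first, so the vector `(0, 1)` recovers `d •
u` from the associative element: this is the Dynkin–Specht–Wever argument. -/
theorem dynkinRep_lieToFree {n d : ℕ} {u : FreeLieAlgebra ℂ (Fin n)} (hu : IsLieMonomial d u)
    (x : FreeLieAlgebra ℂ (Fin n) × ℂ) :
    dynkinRep n (lieToFree n u) x = (⁅u, x.1⁆ + (x.2 * d) • u, 0) := by
  induction hu generalizing x with
  | of i => simp [dynkinRep, lieToFree_of]
  | @bracket d e u v hu hv ihu ihv =>
    rw [lieToFree_lie, map_sub, map_mul, map_mul, LinearMap.sub_apply, Module.End.mul_apply,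
      Module.End.mul_apply, ihu, ihv, ihu, ihv]
    ext
    · simp only [Prod.fst_sub, lie_add, lie_smul, zero_mul, zero_smul, add_zero, lie_lie]
      rw [← lie_skew u v]
      push_cast
      simp only [mul_add, add_smul, smul_neg]
      abel
    · simp

/-- Lie elements of positive degree of the free Lie algebra embed into the free algebra. -/
theorem eq_zero_of_lieToFree_eq_zero {n d : ℕ} {u : FreeLieAlgebra ℂ (Fin n)}
    (hu : u ∈ lieDegree n (d + 1)) (h : lieToFree n u = 0) : u = 0 := by
  have key : dynkinRep n (lieToFree n u) (0, 1) = (((d + 1 : ℕ) : ℂ) • u, 0) := by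
    clear h
    induction hu using Submodule.span_induction with
    | mem u hu => rw [dynkinRep_lieToFree hu]; simp
    | zero => simp; rfl
    | add x y _ _ hx hy => rw [map_add, map_add, LinearMap.add_apply, hx, hy]; simp
    | smul c x _ hx =>
      rw [map_smul, map_smul, LinearMap.smul_apply, hx, Prod.smul_mk, smul_comm, smul_zero]
  rw [h, map_zero, LinearMap.zero_apply] at key
  have h2 := (congrArg Prod.fst key).symm
  exact (smul_eq_zero.1 h2).resolve_left (by exact_mod_cast Nat.succ_ne_zero d)

/-- Under a derivation, eigenvalues add in products, hence in commutators. -/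
theorem freeEuler_lieToFree {n d : ℕ} {u : FreeLieAlgebra ℂ (Fin n)} (hu : u ∈ lieDegree n d) :
    freeEuler n (lieToFree n u) = (d : ℂ) • lieToFree n u := by
  induction hu using Submodule.span_induction with
  | mem u hu =>
    induction hu with
    | of i => rw [lieToFree_of, freeEuler, freeDeriv_ι]; simp
    | bracket hu hv ihu ihv =>
      simp only [freeEuler] at *
      rw [lieToFree_lie, map_sub, freeDeriv_mul, freeDeriv_mul, ihu, ihv]
      simp only [mul_smul_comm, smul_mul_assoc]
      push_cast
      module
  | zero => simp
  | add x y _ _ hx hy => rw [map_add, map_add, hx, hy, smul_add]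
  | smul c x _ hx => rw [map_smul, map_smul, hx, smul_comm]

/-- The derivative of any Lie monomial is a scalar. Scalars are central, so the Leibniz rule makes
the derivative of every bracket vanish. -/
theorem freePartial_lieToFree {n d : ℕ} (i : Fin n) {u : FreeLieAlgebra ℂ (Fin n)}
    (hu : u ∈ lieDegree n (d + 2)) : freePartial i (lieToFree n u) = 0 := by
  have key : ∀ {e} {u : FreeLieAlgebra ℂ (Fin n)}, IsLieMonomial e u →
      (∃ c : ℂ, freePartial i (lieToFree n u) = algebraMap ℂ _ c) ∧
        (2 ≤ e → freePartial i (lieToFree n u) = 0) := by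
    intro e u hu
    induction hu with
    | of j =>
      refine ⟨⟨if j = i then 1 else 0, ?_⟩, by omega⟩
      rw [lieToFree_of, freePartial, freeDeriv_ι, Pi.single_apply]
      split_ifs <;> simp
    | bracket hu hv ihu ihv =>
      suffices h : freePartial i (lieToFree n ⁅_, _⁆) = 0 from ⟨⟨0, by rw [h, map_zero]⟩, fun _ => h⟩
      obtain ⟨⟨c, hc⟩, -⟩ := ihu
      obtain ⟨⟨c', hc'⟩, -⟩ := ihv
      simp only [freePartial] at *
      rw [lieToFree_lie, map_sub, freeDeriv_mul, freeDeriv_mul, hc, hc', Algebra.commutes c,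
        Algebra.commutes c']
      abel
  induction hu using Submodule.span_induction with
  | mem u hu => exact (key hu).2 (by omega)
  | zero => simp
  | add x y _ _ hx hy => rw [map_add, map_add, hx, hy, add_zero]
  | smul c x _ hx => rw [map_smul, map_smul, hx, smul_zero]

/-! ## The lower central series -/

section Central

variable {R : Type*} [Ring R] [Algebra ℂ R]

theorem lie_mem_lieCentral_succ (a : R) {b : R} {k : ℕ} (hb : b ∈ lieCentral R k) :
    a * b - b * a ∈ lieCentral R (k + 1) :=
  Submodule.subset_span ⟨a, b, hb, rfl⟩

/-- Induction on `i` with the Jacobi identity. The index counts brackets, and the outer commutator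
is one more bracket. -/
theorem lie_mem_lieCentral {a b : R} {i j : ℕ} (ha : a ∈ lieCentral R i)
    (hb : b ∈ lieCentral R j) : a * b - b * a ∈ lieCentral R (i + j + 1) := by
  induction i generalizing a b j with
  | zero => simpa using lie_mem_lieCentral_succ a hb
  | succ i ih =>
    rw [lieCentral] at ha
    induction ha using Submodule.span_induction with
    | mem x hx =>
      obtain ⟨c, a, ha, rfl⟩ := hx
      have h1 := lie_mem_lieCentral_succ c (ih ha hb)
      have h2 := ih ha (lie_mem_lieCentral_succ c hb)
      rw [show i + (j + 1) + 1 = i + j + 1 + 1 by ring] at h2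
      rw [show i + 1 + j + 1 = i + j + 1 + 1 by ring]
      convert sub_mem h1 h2 using 1
      noncomm_ring
    | zero => simp
    | add x y _ _ hx hy =>
      rw [show (x + y) * b - b * (x + y) = (x * b - b * x) + (y * b - b * y) by noncomm_ring]
      exact add_mem hx hy
    | smul c x _ hx =>
      rw [smul_mul_assoc, mul_smul_comm, ← smul_sub]
      exact Submodule.smul_mem _ _ hx

theorem lieCentral_map {R' : Type*} [Ring R'] [Algebra ℂ R'] (f : R →ₐ[ℂ] R') {k : ℕ} {x : R}
    (hx : x ∈ lieCentral R k) : f x ∈ lieCentral R' k := by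
  induction k generalizing x with
  | zero => simp [lieCentral]
  | succ k ih =>
    rw [lieCentral] at hx
    induction hx using Submodule.span_induction with
    | mem x hx =>
      obtain ⟨a, b, hb, rfl⟩ := hx
      simpa using lie_mem_lieCentral_succ (f a) (ih hb)
    | zero => simp
    | add x y _ _ hx hy => rw [map_add]; exact add_mem hx hy
    | smul c x _ hx => rw [map_smul]; exact Submodule.smul_mem _ _ hx

theorem ncFiltration_antitone : Antitone (ncFiltration R) :=
  antitone_nat_of_succ_le (ncFiltration_succ_le R)

theorem mul_mem_ncFiltration {d e : ℕ} {x y : R} (hx : x ∈ ncFiltration R d)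
    (hy : y ∈ ncFiltration R e) : x * y ∈ ncFiltration R (d + e) := by
  induction hy using Submodule.span_induction generalizing x with
  | mem y hy =>
    induction hx using Submodule.span_induction with
    | mem x hx =>
      obtain ⟨w, r, hw, rfl, rfl⟩ := hx
      obtain ⟨w', r', hw', rfl, rfl⟩ := hy
      -- The trailing factor of the left product becomes an inner factor with no bracket, since the
      -- zeroth term of the lower central series is everything.
      refine Submodule.subset_span ⟨w ++ (0, 1, r) :: w', r', fun e he => ?_, by simp, ?_⟩
      · rcases List.mem_append.1 he with he | he
        · exact hw e he
        · rcases List.mem_cons.1 he with rfl | he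
          · simp [lieCentral]
          · exact hw' e he
      · simp [mul_assoc]
    | zero => simp
    | add a b _ _ ha hb => rw [add_mul]; exact add_mem ha hb
    | smul c x _ hx => rw [smul_mul_assoc]; exact Submodule.smul_mem _ _ hx
  | zero => simp
  | add a b _ _ ha hb => rw [mul_add]; exact add_mem (ha hx) (hb hx)
  | smul c y _ hy =>
    rw [smul_eq_mul, ← mul_assoc]
    exact hy (Ideal.mul_mem_right c _ hx)

theorem mem_ncFiltration_zero (x : R) : x ∈ ncFiltration R 0 :=
  Submodule.subset_span ⟨[], x, by simp, by simp, by simp⟩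

theorem lieCentral_le_ncFiltration {k : ℕ} {x : R} (hx : x ∈ lieCentral R k) :
    x ∈ ncFiltration R k :=
  Submodule.subset_span ⟨[(k, 1, x)], 1, by simpa using hx, by simp, by simp⟩

/-- Leibniz rule for `[a, ·]`: the new bracket falls on one factor and raises its layer by one. -/
theorem lie_mul_mem_ncFiltration_succ (a : R) {d e : ℕ} {x y : R} (hx : x ∈ ncFiltration R d)
    (hy : y ∈ ncFiltration R e) (hx' : a * x - x * a ∈ ncFiltration R (d + 1))
    (hy' : a * y - y * a ∈ ncFiltration R (e + 1)) :
    a * (x * y) - x * y * a ∈ ncFiltration R (d + e + 1) := by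
  have h1 := mul_mem_ncFiltration hx' hy
  have h2 := mul_mem_ncFiltration hx hy'
  rw [add_right_comm] at h1
  rw [← add_assoc] at h2
  rw [show a * (x * y) - x * y * a = (a * x - x * a) * y + x * (a * y - y * a) by noncomm_ring]
  exact add_mem h1 h2

theorem lie_mem_ncFiltration_succ_of_lieCentral (a : R) {k : ℕ} {x : R}
    (hx : x ∈ lieCentral R k) : a * x - x * a ∈ ncFiltration R (k + 1) :=
  lieCentral_le_ncFiltration (lie_mem_lieCentral_succ a hx)

theorem lie_mem_ncFiltration_one (a x : R) : a * x - x * a ∈ ncFiltration R (0 + 1) :=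
  lie_mem_ncFiltration_succ_of_lieCentral a (k := 0) (x := x) Submodule.mem_top

theorem lie_list_prod_mem_ncFiltration_succ (a : R) (w : List (ℕ × R × R))
    (hw : ∀ e ∈ w, e.2.2 ∈ lieCentral R e.1) :
    (w.map fun e => e.2.1 * e.2.2).prod ∈ ncFiltration R (w.map fun e => e.1).sum ∧
      a * (w.map fun e => e.2.1 * e.2.2).prod - (w.map fun e => e.2.1 * e.2.2).prod * a ∈
        ncFiltration R ((w.map fun e => e.1).sum + 1) := by
  induction w with
  | nil => exact ⟨mem_ncFiltration_zero _, by simp⟩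
  | cons e w ih =>
    obtain ⟨ih1, ih2⟩ := ih fun e he => hw e (List.mem_cons_of_mem _ he)
    have he := hw e List.mem_cons_self
    have h1 := Ideal.mul_mem_left _ e.2.1 (lieCentral_le_ncFiltration he)
    have h2 := lie_mul_mem_ncFiltration_succ a (mem_ncFiltration_zero e.2.1)
      (lieCentral_le_ncFiltration he) (lie_mem_ncFiltration_one a _)
      (lie_mem_ncFiltration_succ_of_lieCentral a he)
    rw [zero_add] at h2
    rw [List.map_cons, List.map_cons, List.prod_cons, List.sum_cons]
    exact ⟨mul_mem_ncFiltration h1 ih1, lie_mul_mem_ncFiltration_succ a h1 ih1 h2 ih2⟩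

theorem lie_mem_ncFiltration_succ (a : R) {e : ℕ} {x : R} (hx : x ∈ ncFiltration R e) :
    a * x - x * a ∈ ncFiltration R (e + 1) := by
  induction hx using Submodule.span_induction with
  | mem x hx =>
    obtain ⟨w, r, hw, rfl, rfl⟩ := hx
    obtain ⟨h1, h2⟩ := lie_list_prod_mem_ncFiltration_succ a w hw
    have h := lie_mul_mem_ncFiltration_succ a h1 (mem_ncFiltration_zero r) h2
      (lie_mem_ncFiltration_one a r)
    rwa [add_zero] at h
  | zero => simp
  | add x y _ _ hx hy =>
    rw [show a * (x + y) - (x + y) * a = (a * x - x * a) + (a * y - y * a) by noncomm_ring]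
    exact add_mem hx hy
  | smul c x hx hx' =>
    rw [smul_eq_mul, ← zero_add e]
    exact lie_mul_mem_ncFiltration_succ a (mem_ncFiltration_zero c) hx
      (lie_mem_ncFiltration_one a c) hx'

theorem ncFiltration_map {R' : Type*} [Ring R'] [Algebra ℂ R'] (f : R →ₐ[ℂ] R') {d : ℕ} {x : R}
    (hx : x ∈ ncFiltration R d) : f x ∈ ncFiltration R' d := by
  induction hx using Submodule.span_induction with
  | mem x hx =>
    obtain ⟨w, r, hw, rfl, rfl⟩ := hx
    refine Submodule.subset_span ⟨w.map fun e => (e.1, f e.2.1, f e.2.2), f r, ?_, ?_, ?_⟩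
    · intro e he
      obtain ⟨e', he', rfl⟩ := List.mem_map.1 he
      exact lieCentral_map f (hw e' he')
    · simp [Function.comp_def]
    · simp [Function.comp_def, map_list_prod]
  | zero => simp
  | add x y _ _ hx hy => rw [map_add]; exact add_mem hx hy
  | smul c x _ hx => rw [smul_eq_mul, map_mul]; exact Ideal.mul_mem_left _ _ hx

theorem exists_mem_lieCentral_of_surjective {R' : Type*} [Ring R'] [Algebra ℂ R']
    (f : R →ₐ[ℂ] R') (hf : Function.Surjective f) {k : ℕ} {x : R'} (hx : x ∈ lieCentral R' k) :
    ∃ y ∈ lieCentral R k, f y = x := by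
  induction k generalizing x with
  | zero =>
    obtain ⟨y, rfl⟩ := hf x
    exact ⟨y, by simp [lieCentral], rfl⟩
  | succ k ih =>
    rw [lieCentral] at hx
    induction hx using Submodule.span_induction with
    | mem x hx =>
      obtain ⟨a, b, hb, rfl⟩ := hx
      obtain ⟨a, rfl⟩ := hf a
      obtain ⟨b', hb', rfl⟩ := ih hb
      exact ⟨_, lie_mem_lieCentral_succ a hb', by simp⟩
    | zero => exact ⟨0, zero_mem _, map_zero f⟩
    | add x y _ _ hx hy =>
      obtain ⟨x, hx, rfl⟩ := hx
      obtain ⟨y, hy, rfl⟩ := hy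
      exact ⟨x + y, add_mem hx hy, map_add f x y⟩
    | smul c x _ hx =>
      obtain ⟨x, hx, rfl⟩ := hx
      exact ⟨c • x, Submodule.smul_mem _ _ hx, map_smul f c x⟩

/-- Applied to `R → R / F^d`, this shows that the layer `F^d` of the quotient is zero. -/
theorem exists_mem_ncFiltration_of_surjective {R' : Type*} [Ring R'] [Algebra ℂ R']
    (f : R →ₐ[ℂ] R') (hf : Function.Surjective f) {d : ℕ} {x : R'} (hx : x ∈ ncFiltration R' d) :
    ∃ y ∈ ncFiltration R d, f y = x := by
  induction hx using Submodule.span_induction with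
  | mem x hx =>
    obtain ⟨w, r, hw, rfl, rfl⟩ := hx
    obtain ⟨r, rfl⟩ := hf r
    suffices h : ∃ y ∈ ncFiltration R (w.map fun e => e.1).sum,
        f y = (w.map fun e => e.2.1 * e.2.2).prod by
      obtain ⟨y, hy, h⟩ := h
      exact ⟨y * r, Ideal.mul_mem_right _ _ hy, by rw [map_mul, h]⟩
    induction w with
    | nil => exact ⟨1, mem_ncFiltration_zero 1, by simp⟩
    | cons e w ih =>
      obtain ⟨y, hy, h⟩ := ih fun e he => hw e (List.mem_cons_of_mem _ he)
      obtain ⟨l, hl, h'⟩ := exists_mem_lieCentral_of_surjective f hf (hw e List.mem_cons_self)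
      obtain ⟨a, ha⟩ := hf e.2.1
      refine ⟨a * l * y, mul_mem_ncFiltration
        (Ideal.mul_mem_left _ _ (lieCentral_le_ncFiltration hl)) hy, ?_⟩
      rw [map_mul, map_mul, h, h', ha, List.map_cons, List.prod_cons]
  | zero => exact ⟨0, zero_mem _, map_zero f⟩
  | add x y _ _ hx hy =>
    obtain ⟨x, hx, rfl⟩ := hx
    obtain ⟨y, hy, rfl⟩ := hy
    exact ⟨x + y, add_mem hx hy, map_add f x y⟩
  | smul c x _ hx =>
    obtain ⟨x, hx, rfl⟩ := hx
    obtain ⟨c, rfl⟩ := hf c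
    exact ⟨c * x, Ideal.mul_mem_left _ _ hx, map_mul f c x⟩

end Central

theorem lieToFree_mem_lieCentral {n k : ℕ} {u : FreeLieAlgebra ℂ (Fin n)}
    (hu : u ∈ lieDegree n (k + 1)) : lieToFree n u ∈ lieCentral (FreeAlgebra ℂ (Fin n)) k := by
  have key : ∀ {e} {u : FreeLieAlgebra ℂ (Fin n)}, IsLieMonomial e u →
      lieToFree n u ∈ lieCentral (FreeAlgebra ℂ (Fin n)) (e - 1) := by
    intro e u hu
    induction hu with
    | of i => simp [lieCentral]
    | @bracket d e u v hu hv ihu ihv =>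
      rw [lieToFree_lie]
      have := lie_mem_lieCentral ihu ihv
      have h1 := hu.pos
      have h2 := hv.pos
      rwa [show d - 1 + (e - 1) + 1 = d + e - 1 by omega] at this
  induction hu using Submodule.span_induction with
  | mem u hu => exact key hu
  | zero => simp
  | add x y _ _ hx hy => rw [map_add]; exact add_mem hx hy
  | smul c x _ hx => rw [map_smul]; exact Submodule.smul_mem _ _ hx

/-! ## Ordered products -/

section Products

variable {J A : Type*} [Ring A] [Algebra ℂ A]

/-- The span of the products of the `b j` of total weight at least `e`. -/
def weightSpan (b : J → A) (w : J → ℕ) (e : ℕ) : Submodule ℂ A :=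
  Submodule.span ℂ {x | ∃ l : List J, e ≤ (l.map w).sum ∧ x = (l.map b).prod}

/-- The span of the products of at most `N` of the `b j` of total weight at least `e`. -/
def boundedWeightSpan (b : J → A) (w : J → ℕ) (N e : ℕ) : Submodule ℂ A :=
  Submodule.span ℂ {x | ∃ l : List J, l.length ≤ N ∧ e ≤ (l.map w).sum ∧ x = (l.map b).prod}

variable {b : J → A} {w : J → ℕ}

theorem boundedWeightSpan_mono {N N' e e' : ℕ} (hN : N ≤ N') (he : e' ≤ e) :
    boundedWeightSpan b w N e ≤ boundedWeightSpan b w N' e' :=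
  Submodule.span_mono fun _ ⟨l, h1, h2, h3⟩ => ⟨l, h1.trans hN, he.trans h2, h3⟩

theorem boundedWeightSpan_le {N e : ℕ} : boundedWeightSpan b w N e ≤ weightSpan b w e :=
  Submodule.span_mono fun _ ⟨l, _, h2, h3⟩ => ⟨l, h2, h3⟩

theorem weightSpan_mono {e e' : ℕ} (he : e' ≤ e) : weightSpan b w e ≤ weightSpan b w e' :=
  Submodule.span_mono fun _ ⟨l, h2, h3⟩ => ⟨l, he.trans h2, h3⟩

theorem mul_mem_boundedWeightSpan {N M e f : ℕ} {x y : A} (hx : x ∈ boundedWeightSpan b w N e)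
    (hy : y ∈ boundedWeightSpan b w M f) : x * y ∈ boundedWeightSpan b w (N + M) (e + f) := by
  have := Submodule.mul_mem_mul hx hy
  rw [boundedWeightSpan, boundedWeightSpan, Submodule.span_mul_span] at this
  refine Submodule.span_mono ?_ this
  rintro _ ⟨_, ⟨l, h1, h2, rfl⟩, _, ⟨l', h1', h2', rfl⟩, rfl⟩
  exact ⟨l ++ l', by simp; omega, by simp; omega, by simp⟩

theorem mul_mem_weightSpan {e f : ℕ} {x y : A} (hx : x ∈ weightSpan b w e)
    (hy : y ∈ weightSpan b w f) : x * y ∈ weightSpan b w (e + f) := by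
  have := Submodule.mul_mem_mul hx hy
  rw [weightSpan, weightSpan, Submodule.span_mul_span] at this
  refine Submodule.span_mono ?_ this
  rintro _ ⟨_, ⟨l, h2, rfl⟩, _, ⟨l', h2', rfl⟩, rfl⟩
  exact ⟨l ++ l', by simp; omega, by simp⟩

theorem prod_mem_boundedWeightSpan (l : List J) :
    (l.map b).prod ∈ boundedWeightSpan b w l.length (l.map w).sum :=
  Submodule.subset_span ⟨l, le_rfl, le_rfl, rfl⟩

theorem mem_boundedWeightSpan (j : J) : b j ∈ boundedWeightSpan b w 1 (w j) :=
  Submodule.subset_span ⟨[j], by simp, by simp, by simp⟩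

section SortedProd

variable [LinearOrder J]

/-- The product of the elements `b j`, `j ∈ s`, in increasing order. -/
def sortedProd (b : J → A) (s : Multiset J) : A := (s.sort.map b).prod

omit [Algebra ℂ A] in
theorem sortedProd_zero (b : J → A) : sortedProd b 0 = 1 := by
  simp [sortedProd]

omit [Algebra ℂ A] in
theorem sortedProd_singleton (b : J → A) (j : J) : sortedProd b {j} = b j := by
  simp [sortedProd]

omit [Algebra ℂ A] in
theorem sortedProd_cons (b : J → A) {j : J} {s : Multiset J} (h : ∀ i ∈ s, j ≤ i) :
    sortedProd b (j ::ₘ s) = b j * sortedProd b s := by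
  rw [sortedProd, Multiset.sort_cons _ _ _ h, List.map_cons, List.prod_cons, sortedProd]

end SortedProd

/-! ### Straightening products modulo shorter products of larger weight -/

section Straighten

variable (hb : ∀ i j, b i * b j - b j * b i ∈ Submodule.span ℂ (b '' {k | w k = w i + w j + 1}))

include hb

/-- Swapping two neighbours leaves their commutator, in which single generators of weight one more
replace two generators. The error is thus shorter by one and heavier by one, and permutations are
compositions of swaps. -/
theorem prod_sub_prod_mem_of_perm {l l' : List J} (h : l.Perm l') :
    (l.map b).prod - (l'.map b).prod ∈
      boundedWeightSpan b w (l.length - 1) ((l.map w).sum + 1) := by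
  induction h with
  | nil => simp
  | @cons x l l' h ih =>
    -- An empty tail is separate: there the truncated `l.length - 1` would make the length bound too
    -- large by one after multiplication by `b x`.
    rcases l with _ | ⟨y, l⟩
    · simp [List.nil_perm.1 h]
    · have := mul_mem_boundedWeightSpan (mem_boundedWeightSpan (b := b) (w := w) x) ih
      rw [List.map_cons (f := b), List.prod_cons, List.map_cons (f := b) (a := x), List.prod_cons,
        ← mul_sub]
      refine boundedWeightSpan_mono ?_ ?_ this
      · simp
        omega
      · simp [add_assoc]
  | swap x y l =>
    have h1 : b y * b x - b x * b y ∈ boundedWeightSpan b w 1 (w y + w x + 1) := by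
      refine Submodule.span_le.2 ?_ (hb y x)
      rintro _ ⟨k, hk, rfl⟩
      have := mem_boundedWeightSpan (b := b) (w := w) k
      rwa [hk] at this
    have := mul_mem_boundedWeightSpan h1 (prod_mem_boundedWeightSpan (b := b) (w := w) l)
    have e1 : (List.map b (y :: x :: l)).prod - (List.map b (x :: y :: l)).prod =
        (b y * b x - b x * b y) * (l.map b).prod := by
      simp only [List.map_cons, List.prod_cons]; noncomm_ring
    rw [e1]
    refine boundedWeightSpan_mono ?_ ?_ this
    · simp only [List.length_cons]; omega
    · simp only [List.map_cons, List.sum_cons]; omega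
  | @trans l₁ l₂ l₃ h₁ h₂ ih₁ ih₂ =>
    rw [← h₁.length_eq, ← (h₁.map w).sum_eq] at ih₂
    simpa using add_mem ih₁ ih₂

/-- The straightening of products into ordered products. -/
theorem weightSpan_eq_span_sortedProd [LinearOrder J] (e : ℕ) :
    weightSpan b w e =
      Submodule.span ℂ (sortedProd b '' {s : Multiset J | e ≤ (s.map w).sum}) := by
  refine le_antisymm ?_ ?_
  -- Induction on the number of factors: a product differs from its sorted version by shorter
  -- products. The weight never drops, so the bound `e` is kept.
  · have key : ∀ N e, boundedWeightSpan b w N e ≤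
        Submodule.span ℂ (sortedProd b '' {s : Multiset J | e ≤ (s.map w).sum}) := by
      intro N
      induction N with
      | zero =>
        refine fun e => Submodule.span_le.2 ?_
        rintro _ ⟨l, h1, h2, rfl⟩
        obtain rfl : l = [] := List.length_eq_zero_iff.1 (Nat.le_zero.1 h1)
        exact Submodule.subset_span ⟨0, by simpa using h2, by simp [sortedProd_zero]⟩
      | succ N ih =>
        refine fun e => Submodule.span_le.2 ?_
        rintro _ ⟨l, h1, h2, rfl⟩
        have hp : l.Perm (Multiset.sort ↑l (· ≤ ·)) := by
          rw [← Multiset.coe_eq_coe, Multiset.sort_eq]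
        have h3 := ih e (boundedWeightSpan_mono (by omega) (by omega)
          (prod_sub_prod_mem_of_perm hb hp))
        have h4 : sortedProd b ↑l ∈ Submodule.span ℂ (sortedProd b '' {s : Multiset J |
            e ≤ (s.map w).sum}) := Submodule.subset_span ⟨↑l, by simpa using h2, rfl⟩
        simpa [sortedProd] using add_mem h3 h4
    refine Submodule.span_le.2 ?_
    rintro _ ⟨l, h2, rfl⟩
    exact key l.length e (boundedWeightSpan_mono le_rfl h2 (prod_mem_boundedWeightSpan l))
  · refine Submodule.span_mono ?_
    rintro _ ⟨s, hs, rfl⟩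
    refine ⟨s.sort, ?_, rfl⟩
    rw [← Multiset.sum_coe, ← Multiset.map_coe, Multiset.sort_eq]
    exact hs

/-- For products of generators, `x * y` and `y * x` are rearrangements of one list. -/
theorem lie_mem_weightSpan {e f : ℕ} {x y : A} (hx : x ∈ weightSpan b w e)
    (hy : y ∈ weightSpan b w f) : x * y - y * x ∈ weightSpan b w (e + f + 1) := by
  induction hx using Submodule.span_induction with
  | mem x hx =>
    induction hy using Submodule.span_induction with
    | mem y hy =>
      obtain ⟨l, hl, rfl⟩ := hx
      obtain ⟨l', hl', rfl⟩ := hy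
      have := boundedWeightSpan_le (prod_sub_prod_mem_of_perm hb
        (List.perm_append_comm (l₁ := l) (l₂ := l')))
      simp only [List.map_append, List.prod_append, List.sum_append] at this
      exact weightSpan_mono (by omega) this
    | zero => simp
    | add y z _ _ hy hz =>
      rw [show x * (y + z) - (y + z) * x = (x * y - y * x) + (x * z - z * x) by noncomm_ring]
      exact add_mem hy hz
    | smul c y _ hy =>
      rw [mul_smul_comm, smul_mul_assoc, ← smul_sub]
      exact Submodule.smul_mem _ _ hy
  | zero => simp
  | add x z _ _ hx hz =>
    rw [show (x + z) * y - y * (x + z) = (x * y - y * x) + (z * y - y * z) by noncomm_ring]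
    exact add_mem hx hz
  | smul c x _ hx =>
    rw [mul_smul_comm, smul_mul_assoc, ← smul_sub]
    exact Submodule.smul_mem _ _ hx

end Straighten

/-! ### Independence of ordered products of primitive elements -/

section Independence

open TensorProduct

open Classical in
/-- The coproduct of ordered products on the level of formal combinations. -/
def formalComul (J : Type*) : (Multiset J →₀ ℂ) →ₗ[ℂ] (Multiset J × Multiset J →₀ ℂ) :=
  Finsupp.linearCombination ℂ fun s => (s.antidiagonal.map fun p => Finsupp.single p 1).sum

/-- A pair occurs in the antidiagonal of its sum only. The multiplicity there is a positive integer,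
hence nonzero in `ℂ`; characteristic zero enters the independence proof at this point. -/
theorem formalComul_apply {J : Type*} [DecidableEq (Multiset J × Multiset J)] (v : Multiset J →₀ ℂ) (p : Multiset J × Multiset J) :
    formalComul J v p = v (p.1 + p.2) * (p.1 + p.2).antidiagonal.count p := by
  have h1 : ∀ s : Multiset J, (s.antidiagonal.map fun p => Finsupp.single p (1 : ℂ)).sum p =
      s.antidiagonal.count p := by
    intro s
    induction s.antidiagonal using Multiset.induction_on with
    | empty => simp
    | cons q t ih =>
      rw [Multiset.map_cons, Multiset.sum_cons, Finsupp.add_apply, ih, Multiset.count_cons,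
        Finsupp.single_apply]
      push_cast
      simp only [eq_comm (a := q)]
      ring
  rw [formalComul, Finsupp.linearCombination_apply, Finsupp.sum, Finsupp.finsetSum_apply,
    Finset.sum_eq_single (p.1 + p.2)]
  · rw [Finsupp.smul_apply, h1, smul_eq_mul]
  · intro s _ hs
    rw [Finsupp.smul_apply, h1, Multiset.count_eq_zero_of_notMem, Nat.cast_zero, smul_zero]
    rw [Multiset.mem_antidiagonal]
    exact fun h => hs h.symm
  · intro h
    rw [Finsupp.notMem_support_iff.1 h, zero_smul]
    simp

variable [LinearOrder J] (Δ : A →ₐ[ℂ] A ⊗[ℂ] A) (hΔ : ∀ j, Δ (b j) = b j ⊗ₜ 1 + 1 ⊗ₜ b j)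

include hΔ in
-- Each primitive factor goes either to the left or to the right. Subfamilies of a sorted family
-- stay sorted, so both tensor factors are again ordered products.
theorem comul_sortedProd (s : Multiset J) :
    Δ (sortedProd b s) =
      (s.antidiagonal.map fun p => sortedProd b p.1 ⊗ₜ[ℂ] sortedProd b p.2).sum := by
  have key : ∀ l : List J, l.Pairwise (· ≤ ·) → Δ (sortedProd b ↑l) =
      ((l : Multiset J).antidiagonal.map fun p =>
        sortedProd b p.1 ⊗ₜ[ℂ] sortedProd b p.2).sum := by
    intro l hl
    induction l with
    | nil => simp [sortedProd_zero, Algebra.TensorProduct.one_def]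
    | cons j l ih =>
      rw [List.pairwise_cons] at hl
      have hj : ∀ p ∈ (l : Multiset J).antidiagonal,
          (∀ i ∈ p.1, j ≤ i) ∧ ∀ i ∈ p.2, j ≤ i := by
        intro p hp
        rw [Multiset.mem_antidiagonal] at hp
        refine ⟨fun i hi => hl.1 i ?_, fun i hi => hl.1 i ?_⟩ <;>
        · rw [← Multiset.mem_coe, ← hp, Multiset.mem_add]
          simp [hi]
      rw [← Multiset.cons_coe, sortedProd_cons b (by simpa using hl.1), map_mul, ih hl.2, hΔ,
        Multiset.antidiagonal_cons, Multiset.map_add, Multiset.sum_add, Multiset.map_map,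
        Multiset.map_map, add_mul, ← Multiset.sum_map_mul_left, ← Multiset.sum_map_mul_left,
        add_comm]
      congr 2
      · refine Multiset.map_congr rfl fun p hp => ?_
        simp [sortedProd_cons b (hj p hp).2]
      · refine Multiset.map_congr rfl fun p hp => ?_
        simp [sortedProd_cons b (hj p hp).1]
  have := key s.sort (Multiset.pairwise_sort s (· ≤ ·))
  rwa [Multiset.sort_eq] at this

variable (ε : A →ₐ[ℂ] ℂ) (hε : ∀ j, ε (b j) = 0)

include hε in
theorem counit_sortedProd {s : Multiset J} (hs : s ≠ 0) : ε (sortedProd b s) = 0 := by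
  rw [sortedProd, map_list_prod, List.map_map]
  obtain ⟨j, hj⟩ := Multiset.exists_mem_of_ne_zero hs
  exact List.prod_eq_zero (List.mem_map.2 ⟨j, (Multiset.mem_sort _).2 hj, hε j⟩)

include hΔ hε in
/-- Ordered products of linearly independent primitive elements are linearly independent. -/
theorem linearIndependent_sortedProd (hb : LinearIndependent ℂ b) :
    LinearIndependent ℂ (sortedProd b) := by
  classical
  have hε1 : ∀ v : Multiset J →₀ ℂ, Finsupp.linearCombination ℂ (sortedProd b) v = 0 →
      v 0 = 0 := by
    intro v hv
    have := congrArg ε hv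
    rw [Finsupp.linearCombination_apply, Finsupp.sum, map_sum, map_zero,
      Finset.sum_eq_single 0] at this
    · simpa [sortedProd_zero] using this
    · intro s _ hs
      rw [map_smul, counit_sortedProd ε hε hs, smul_zero]
    · intro h
      rw [Finsupp.notMem_support_iff.1 h, zero_smul, map_zero]
  -- Induction on the number of factors. With at most one factor, the counit removes the constant
  -- term and the independence of `b` remains.
  have key : ∀ N : ℕ, LinearIndepOn ℂ (sortedProd b) {s | s.card ≤ N + 1} := by
    intro N
    induction N with
    | zero =>
      rw [linearIndepOn_iff]
      intro v hv h0
      have hinj : Function.Injective (fun j : J => ({j} : Multiset J)) :=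
        fun _ _ h => Multiset.singleton_inj.1 h
      have hv' : (Finsupp.comapDomain (fun j : J => ({j} : Multiset J)) v hinj.injOn).mapDomain
          (fun j => {j}) = v := by
        refine Finsupp.mapDomain_comapDomain _ hinj _ fun s hs => ?_
        have h1 : s.card ≤ 1 := hv hs
        have h2 : s ≠ 0 := by
          rintro rfl
          exact (Finsupp.mem_support_iff.1 hs) (hε1 v h0)
        obtain ⟨j, rfl⟩ := Multiset.card_eq_one.1
          (le_antisymm h1 (Nat.one_le_iff_ne_zero.2 (by simpa using h2)))
        exact ⟨j, rfl⟩
      rw [← hv', Finsupp.linearCombination_mapDomain] at h0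
      have h3 : (sortedProd b ∘ fun j => {j}) = b := funext fun j => sortedProd_singleton b j
      rw [h3] at h0
      rw [← hv', linearIndependent_iff.1 hb _ h0, Finsupp.mapDomain_zero]
    | succ N ih =>
      have ih2 := ih.tmul_of_isDomain ih
      rw [linearIndepOn_iff] at ih ih2 ⊢
      intro v hv h0
      -- It suffices that no multiset with `N + 2` elements occurs; the induction hypothesis does
      -- the rest.
      refine ih v (fun s hs => ?_) h0
      by_contra hcard
      change ¬ s.card ≤ N + 1 at hcard
      set F : Multiset J × Multiset J → A ⊗[ℂ] A := fun p => sortedProd b p.1 ⊗ₜ sortedProd b p.2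
      have hF : Finsupp.linearCombination ℂ F (formalComul J v) = 0 := by
        rw [← map_zero Δ, ← h0, formalComul]
        simp only [Finsupp.linearCombination_apply, Finsupp.sum, map_sum, map_smul]
        refine Finset.sum_congr rfl fun s _ => ?_
        rw [comul_sortedProd Δ hΔ]
        congr 1
        have := map_multiset_sum (Finsupp.linearCombination ℂ F)
          (s.antidiagonal.map fun p => Finsupp.single p (1 : ℂ))
        rw [Multiset.map_map] at this
        simpa [Function.comp_def, Finsupp.linearCombination_apply, Finsupp.sum] using this
      -- Projecting along the unit in both tensor factors keeps only splittings into two nonempty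
      -- parts. Each part then has at most `N + 1` elements, so `ih2` applies.
      set q : A →ₗ[ℂ] A := LinearMap.id - (Algebra.linearMap ℂ A) ∘ₗ ε.toLinearMap
      have hq0 : q (sortedProd b 0) = 0 := by simp [q, sortedProd_zero]
      have hq : ∀ s : Multiset J, s ≠ 0 → q (sortedProd b s) = sortedProd b s := by
        intro s hs
        simp [q, counit_sortedProd ε hε hs]
      have hw : Finsupp.linearCombination ℂ F
          ((formalComul J v).filter fun p => p.1 ≠ 0 ∧ p.2 ≠ 0) = 0 := by
        have := congrArg (TensorProduct.map q q) hF
        rw [map_zero] at this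
        rw [← this]
        simp only [Finsupp.linearCombination_apply, Finsupp.sum, map_sum, map_smul,
          Finsupp.support_filter, Finset.sum_filter, Finsupp.filter_apply]
        refine Finset.sum_congr rfl fun p _ => ?_
        simp only [F, TensorProduct.map_tmul]
        split_ifs with hp
        · rw [hq _ hp.1, hq _ hp.2]
        · rw [not_and_or, not_ne_iff, not_ne_iff] at hp
          rcases hp with hp | hp <;> simp [hp, hq0]
      have h2 := ih2 _ (fun p hp => by
        have hp' : p ∈ ((formalComul J v).filter fun p => p.1 ≠ 0 ∧ p.2 ≠ 0).support := hp
        rw [Finsupp.support_filter, Finset.mem_filter, Finsupp.mem_support_iff,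
          formalComul_apply] at hp'
        obtain ⟨h3, h4, h5⟩ := hp'
        have h6 : (p.1 + p.2).card ≤ N + 1 + 1 :=
          hv (Finsupp.mem_support_iff.2 (left_ne_zero_of_mul h3))
        rw [Multiset.card_add] at h6
        have h7 := Multiset.card_pos.2 h4
        have h8 := Multiset.card_pos.2 h5
        exact ⟨show p.1.card ≤ N + 1 by omega, show p.2.card ≤ N + 1 by omega⟩) hw
      -- Split one element off `s`: the coefficient of the pair `({j}, t)` is `v s` times a positive
      -- integer, and it vanishes.
      obtain ⟨j, hj⟩ := Multiset.exists_mem_of_ne_zero (s := s) (by rintro rfl; simp at hcard)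
      obtain ⟨t, rfl⟩ := Multiset.exists_cons_of_mem hj
      have ht : t ≠ 0 := by rintro rfl; simp at hcard
      have h3 := DFunLike.congr_fun h2 ({j}, t)
      rw [Finsupp.filter_apply, if_pos ⟨Multiset.singleton_ne_zero j, ht⟩, formalComul_apply,
        Finsupp.zero_apply, mul_eq_zero] at h3
      rcases h3 with h3 | h3
      · exact (Finsupp.mem_support_iff.1 hs) h3
      · rw [Nat.cast_eq_zero, Multiset.count_eq_zero, Multiset.mem_antidiagonal] at h3
        exact h3 rfl
  rw [linearIndependent_iff]
  intro v hv
  refine linearIndepOn_iff.1 (key (v.support.sup Multiset.card)) v (fun s hs => ?_) hv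
  exact (Finset.le_sup (f := Multiset.card) hs).trans (Nat.le_succ _)

end Independence

end Products

/-! ## The Poincaré–Birkhoff–Witt basis of the free algebra -/

section PBW

open Sum.Lex

variable {n : ℕ} {m : ℕ → ℕ} (B : ∀ d, Module.Basis (Fin (m d)) ℂ (lieDegree n (d + 2)))

/-- The basic Lie element `β` in the free algebra. -/
def basicLie (β : LieIndex m) : FreeAlgebra ℂ (Fin n) :=
  lieToFree n (B (ofLex β).1 (ofLex β).2 : FreeLieAlgebra ℂ (Fin n))

/-- The variables, followed by the basic Lie elements. -/
def pbwGen (j : Fin n ⊕ₗ LieIndex m) : FreeAlgebra ℂ (Fin n) :=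
  Sum.elim (FreeAlgebra.ι ℂ) (basicLie B) (ofLex j)

/-- The number of brackets in a generator. -/
def pbwWeight (j : Fin n ⊕ₗ LieIndex m) : ℕ :=
  Sum.elim (fun _ => 0) (fun β => (ofLex β).1 + 1) (ofLex j)

/-- Variables and basic elements are treated uniformly as Lie elements of degree weight plus one. -/
theorem exists_pbwGen_eq (j : Fin n ⊕ₗ LieIndex m) :
    ∃ u ∈ lieDegree n (pbwWeight j + 1), pbwGen B j = lieToFree n u := by
  rcases j with i | β
  · exact ⟨FreeLieAlgebra.of ℂ i, Submodule.subset_span (.of i), (lieToFree_of i).symm⟩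
  · exact ⟨_, (B (ofLex β).1 (ofLex β).2).2, rfl⟩

theorem basicLie_mem_image (β : LieIndex m) (d : ℕ) (hd : (ofLex β).1 = d) :
    basicLie B β ∈ pbwGen B '' {k | pbwWeight k = d + 1} :=
  ⟨Sum.inrₗ β, by simp [pbwWeight, hd], rfl⟩

theorem lieToFree_mem_span {d : ℕ} {u : FreeLieAlgebra ℂ (Fin n)} (hu : u ∈ lieDegree n (d + 2)) :
    lieToFree n u ∈ Submodule.span ℂ (pbwGen B '' {k | pbwWeight k = d + 1}) := by
  have h := congrArg Subtype.val ((B d).sum_repr ⟨u, hu⟩)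
  rw [Submodule.coe_sum] at h
  rw [← show _ = u from h, map_sum]
  refine sum_mem fun i _ => ?_
  rw [Submodule.coe_smul, map_smul]
  exact Submodule.smul_mem _ _ (Submodule.subset_span
    (basicLie_mem_image B (toLex ⟨d, i⟩) d rfl))

/-- The input of the straightening: degrees add under the bracket and the weight is the degree minus
one. Having degree at least two, the bracket involves basic elements only. -/
theorem pbwGen_lie_mem (i j : Fin n ⊕ₗ LieIndex m) :
    pbwGen B i * pbwGen B j - pbwGen B j * pbwGen B i ∈
      Submodule.span ℂ (pbwGen B '' {k | pbwWeight k = pbwWeight i + pbwWeight j + 1}) := by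
  obtain ⟨u, hu, hu'⟩ := exists_pbwGen_eq B i
  obtain ⟨v, hv, hv'⟩ := exists_pbwGen_eq B j
  rw [hu', hv', ← lieToFree_lie]
  apply lieToFree_mem_span
  have := lie_mem_lieDegree hu hv
  rwa [show pbwWeight i + 1 + (pbwWeight j + 1) = pbwWeight i + pbwWeight j + 2 by ring] at this

theorem freePartial_basicLie (i : Fin n) (β : LieIndex m) : freePartial i (basicLie B β) = 0 :=
  freePartial_lieToFree i (B (ofLex β).1 (ofLex β).2).2

theorem freeEuler_basicLie (β : LieIndex m) :
    freeEuler n (basicLie B β) = (((ofLex β).1 + 2 : ℕ) : ℂ) • basicLie B β :=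
  freeEuler_lieToFree (B (ofLex β).1 (ofLex β).2).2

theorem linearIndependent_ι (n : ℕ) :
    LinearIndependent ℂ (FreeAlgebra.ι ℂ : Fin n → FreeAlgebra ℂ (Fin n)) := by
  rw [Fintype.linearIndependent_iff]
  intro g hg i
  have := congrArg (freePartial i) hg
  simpa [freePartial, freeDeriv_ι, Pi.single_apply] using this

theorem linearIndependent_basicLie_degree (d : ℕ) :
    LinearIndependent ℂ fun i : Fin (m d) => basicLie B (toLex ⟨d, i⟩) := by
  rw [Fintype.linearIndependent_iff]
  intro g hg
  refine Fintype.linearIndependent_iff.1 (B d).linearIndependent g ?_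
  apply Subtype.ext
  refine eq_zero_of_lieToFree_eq_zero (d := d + 1) (Subtype.prop _) ?_
  rw [← hg]
  simp only [basicLie, Submodule.coe_sum, Submodule.coe_smul, map_sum, map_smul]
  rfl

theorem basicLie_mem_eigenspace (β : LieIndex m) :
    basicLie B β ∈ Module.End.eigenspace (freeEuler n) (((ofLex β).1 + 2 : ℕ) : ℂ) :=
  Module.End.mem_eigenspace_iff.2 (freeEuler_basicLie B β)

/-- The variables and the sets `B_d` lie in eigenspaces of the Euler derivation for distinct
eigenvalues, so independence in each degree suffices. -/
theorem linearIndependent_pbwGen : LinearIndependent ℂ (pbwGen B) := by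
  have hind := Module.End.eigenspaces_iSupIndep (freeEuler n)
  have hle : ∀ d, Submodule.span ℂ (Set.range fun i : Fin (m d) => basicLie B (toLex ⟨d, i⟩)) ≤
      Module.End.eigenspace (freeEuler n) ((d + 2 : ℕ) : ℂ) := by
    refine fun d => Submodule.span_le.2 ?_
    rintro _ ⟨i, rfl⟩
    exact basicLie_mem_eigenspace B (toLex ⟨d, i⟩)
  have h1 : LinearIndependent ℂ fun β : (Σ d : ℕ, Fin (m d)) => basicLie B (toLex β) := by
    refine linearIndependent_iUnion_finite (f := fun d i => basicLie B (toLex ⟨d, i⟩))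
      (linearIndependent_basicLie_degree B) fun d t _ hd => ?_
    refine (hind ((d + 2 : ℕ) : ℂ)).mono (hle d) (iSup₂_le fun e he => (hle e).trans ?_)
    refine le_iSup₂_of_le ((e + 2 : ℕ) : ℂ) ?_ le_rfl
    intro h
    have : e = d := by simpa using h
    exact hd (this ▸ he)
  have h2 := (linearIndependent_ι n).sum_type (h1.comp ofLex ofLex.injective) (by
    refine (hind 1).mono (Submodule.span_le.2 ?_) (Submodule.span_le.2 ?_)
    · rintro _ ⟨i, rfl⟩
      exact Module.End.mem_eigenspace_iff.2 (by simp [freeEuler, freeDeriv_ι])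
    · rintro _ ⟨β, rfl⟩
      refine Submodule.mem_iSup_of_mem (((ofLex β).1 + 2 : ℕ) : ℂ)
        (Submodule.mem_iSup_of_mem ?_ (basicLie_mem_eigenspace B β))
      norm_cast
      omega)
  exact h2.comp ofLex ofLex.injective

open TensorProduct in
/-- The coproduct of the free algebra for which the variables are primitive. -/
def freeComul (n : ℕ) :
    FreeAlgebra ℂ (Fin n) →ₐ[ℂ] FreeAlgebra ℂ (Fin n) ⊗[ℂ] FreeAlgebra ℂ (Fin n) :=
  FreeAlgebra.lift ℂ fun i => FreeAlgebra.ι ℂ i ⊗ₜ 1 + 1 ⊗ₜ FreeAlgebra.ι ℂ i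

open TensorProduct in
theorem freeComul_lieToFree {d : ℕ} {u : FreeLieAlgebra ℂ (Fin n)} (hu : u ∈ lieDegree n d) :
    freeComul n (lieToFree n u) = lieToFree n u ⊗ₜ 1 + 1 ⊗ₜ lieToFree n u := by
  induction hu using Submodule.span_induction with
  | mem u hu =>
    induction hu with
    | of i => simp [freeComul, lieToFree_of]
    | bracket hu hv ihu ihv =>
      rw [lieToFree_lie, map_sub, map_mul, map_mul, ihu, ihv]
      simp only [add_mul, mul_add, Algebra.TensorProduct.tmul_mul_tmul, one_mul, mul_one,
        TensorProduct.sub_tmul, TensorProduct.tmul_sub]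
      abel
  | zero => simp
  | add x y _ _ hx hy =>
    rw [map_add, map_add, hx, hy, TensorProduct.add_tmul, TensorProduct.tmul_add]
    abel
  | smul c x _ hx =>
    rw [map_smul, map_smul, hx, smul_add, TensorProduct.smul_tmul', TensorProduct.tmul_smul]

/-- Lie elements are primitive for `freeComul` and are killed by the counit `FreeAlgebra.lift ℂ 0`.
-/
theorem linearIndependent_sortedProd_pbwGen : LinearIndependent ℂ (sortedProd (pbwGen B)) := by
  refine linearIndependent_sortedProd (freeComul n) (fun j => ?_) (FreeAlgebra.lift ℂ 0)
    (fun j => ?_) (linearIndependent_pbwGen B)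
  · obtain ⟨u, hu, h⟩ := exists_pbwGen_eq B j
    rw [h, freeComul_lieToFree hu]
  · obtain ⟨u, hu, h⟩ := exists_pbwGen_eq B j
    rw [h]
    clear h
    generalize pbwWeight j + 1 = d at hu
    induction hu using Submodule.span_induction with
    | mem u hu =>
      induction hu with
      | of i => simp [lieToFree_of]
      | bracket hu hv ihu ihv => rw [lieToFree_lie, map_sub, map_mul, map_mul, ihu, ihv]; simp
    | zero => simp
    | add x y _ _ hx hy => rw [map_add, map_add, hx, hy, add_zero]
    | smul c x _ hx => rw [map_smul, map_smul, hx, smul_zero]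

/-! ### The filtration -/

theorem weightSpan_pbwGen_zero : weightSpan (pbwGen B) pbwWeight 0 = ⊤ := by
  rw [eq_top_iff]
  rintro x -
  induction x using FreeAlgebra.induction with
  | grade0 c =>
    rw [Algebra.algebraMap_eq_smul_one]
    exact Submodule.smul_mem _ _ (Submodule.subset_span ⟨[], by simp, by simp⟩)
  | grade1 i =>
    exact Submodule.subset_span ⟨[Sum.inlₗ i], Nat.zero_le _, by
      rw [List.map_singleton, List.prod_singleton]; rfl⟩
  | mul a b ha hb => exact mul_mem_weightSpan (e := 0) (f := 0) ha hb
  | add a b ha hb => exact add_mem ha hb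

theorem lieCentral_le_weightSpan (k : ℕ) :
    lieCentral (FreeAlgebra ℂ (Fin n)) k ≤ weightSpan (pbwGen B) pbwWeight k := by
  induction k with
  | zero => rw [weightSpan_pbwGen_zero]; exact le_top
  | succ k ih =>
    refine Submodule.span_le.2 ?_
    rintro _ ⟨a, b, hb, rfl⟩
    have ha : a ∈ weightSpan (pbwGen B) pbwWeight 0 := by
      rw [weightSpan_pbwGen_zero]; exact Submodule.mem_top
    simpa using lie_mem_weightSpan (pbwGen_lie_mem B) ha (ih hb)

/-- The weight spans are multiplicative and contain the lower central series, which gives one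
inclusion. For the other, a product of generators is itself a product of the defining form, each
generator being an element with as many brackets as its weight. -/
theorem mem_ncFiltration_iff_mem_weightSpan (e : ℕ) (x : FreeAlgebra ℂ (Fin n)) :
    x ∈ ncFiltration (FreeAlgebra ℂ (Fin n)) e ↔ x ∈ weightSpan (pbwGen B) pbwWeight e := by
  have hmem : ∀ a, a ∈ weightSpan (pbwGen B) pbwWeight 0 := fun a => by
    rw [weightSpan_pbwGen_zero]; exact Submodule.mem_top
  constructor
  · intro hx
    induction hx using Submodule.span_induction with
    | mem x hx =>
      obtain ⟨w, r, hw, rfl, rfl⟩ := hx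
      suffices h : (w.map fun e => e.2.1 * e.2.2).prod ∈
          weightSpan (pbwGen B) pbwWeight (w.map fun e => e.1).sum by
        simpa using mul_mem_weightSpan h (hmem r)
      induction w with
      | nil => simpa using hmem 1
      | cons e w ih =>
        rw [List.map_cons, List.map_cons, List.prod_cons, List.sum_cons]
        refine mul_mem_weightSpan ?_ (ih fun e he => hw e (List.mem_cons_of_mem _ he))
        simpa using mul_mem_weightSpan (hmem e.2.1)
          (lieCentral_le_weightSpan B e.1 (hw e List.mem_cons_self))
    | zero => exact zero_mem _
    | add x y _ _ hx hy => exact add_mem hx hy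
    | smul c x _ hx => simpa using mul_mem_weightSpan (hmem c) hx
  · intro hx
    induction hx using Submodule.span_induction with
    | mem x hx =>
      obtain ⟨l, hl, rfl⟩ := hx
      refine ncFiltration_antitone hl (Submodule.subset_span
        ⟨l.map fun j => (pbwWeight j, 1, pbwGen B j), 1, ?_, ?_, ?_⟩)
      · intro e he
        obtain ⟨j, -, rfl⟩ := List.mem_map.1 he
        obtain ⟨u, hu, h⟩ := exists_pbwGen_eq B j
        change pbwGen B j ∈ lieCentral _ (pbwWeight j)
        rw [h]
        exact lieToFree_mem_lieCentral hu
      · simp [Function.comp_def]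
      · simp [Function.comp_def]
    | zero => exact zero_mem _
    | add x y _ _ hx hy => exact add_mem hx hy
    | smul c x _ hx =>
      rw [Algebra.smul_def]
      exact Ideal.mul_mem_left _ _ hx

/-! ### The normal form -/

/-- The exponents of a monomial in the variables and of one in the basic Lie elements, combined. -/
def pbwExponent (a : Fin n →₀ ℕ) (l : MultiIndex m) : (Fin n ⊕ₗ LieIndex m) →₀ ℕ :=
  a.mapDomain Sum.inlₗ + l.mapDomain Sum.inrₗ

theorem inlₗ_injective : Function.Injective (Sum.inlₗ : Fin n → Fin n ⊕ₗ LieIndex m) :=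
  toLex.injective.comp Sum.inl_injective

theorem inrₗ_injective : Function.Injective (Sum.inrₗ : LieIndex m → Fin n ⊕ₗ LieIndex m) :=
  toLex.injective.comp Sum.inr_injective

theorem pbwExponent_inl (a : Fin n →₀ ℕ) (l : MultiIndex m) (i : Fin n) :
    pbwExponent a l (Sum.inlₗ i) = a i := by
  rw [pbwExponent, Finsupp.add_apply, Finsupp.mapDomain_apply inlₗ_injective,
    Finsupp.mapDomain_of_notMem_range, add_zero]
  rintro ⟨β, h⟩
  simp at h

theorem pbwExponent_inr (a : Fin n →₀ ℕ) (l : MultiIndex m) (β : LieIndex m) :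
    pbwExponent a l (Sum.inrₗ β) = l β := by
  rw [pbwExponent, Finsupp.add_apply, Finsupp.mapDomain_apply inrₗ_injective,
    Finsupp.mapDomain_of_notMem_range, zero_add]
  rintro ⟨β, h⟩
  simp at h

/-- Reindexes the ordered products by the pairs `(λ, a)` that occur in the normal form. -/
theorem pbwExponent_bijective : Function.Bijective
    fun x : (Σ _ : MultiIndex m, Fin n →₀ ℕ) => Finsupp.toMultiset (pbwExponent x.2 x.1) := by
  classical
  refine Multiset.toFinsupp.symm.bijective.comp ⟨fun x y h => ?_, fun f => ?_⟩
  · obtain ⟨l, a⟩ := x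
    obtain ⟨k, b⟩ := y
    have h1 : l = k := Finsupp.ext fun β => by
      rw [← pbwExponent_inr a l, ← pbwExponent_inr b k]; exact DFunLike.congr_fun h _
    have h2 : a = b := Finsupp.ext fun i => by
      rw [← pbwExponent_inl a l, ← pbwExponent_inl b k]; exact DFunLike.congr_fun h _
    rw [h1, h2]
  · refine ⟨⟨f.comapDomain Sum.inrₗ inrₗ_injective.injOn,
      f.comapDomain Sum.inlₗ inlₗ_injective.injOn⟩, Finsupp.ext fun j => ?_⟩
    rcases j with i | β
    · exact pbwExponent_inl _ _ i
    · exact pbwExponent_inr _ _ β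

theorem sum_pbwWeight_pbwExponent (a : Fin n →₀ ℕ) (l : MultiIndex m) :
    ((Finsupp.toMultiset (pbwExponent a l)).map pbwWeight).sum = l.ord := by
  have h : ∀ f : (Fin n ⊕ₗ LieIndex m) →₀ ℕ,
      ((Finsupp.toMultiset f).map pbwWeight).sum = f.sum fun j k => k * pbwWeight j := by
    intro f
    induction f using Finsupp.induction_linear with
    | zero => simp
    | add f g hf hg =>
      rw [map_add, Multiset.map_add, Multiset.sum_add, hf, hg, Finsupp.sum_add_index'] <;>
      simp [add_mul]
    | single j k => simp [Multiset.map_nsmul, Multiset.sum_nsmul]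
  rw [h, pbwExponent, Finsupp.sum_add_index' (by simp) (by simp [add_mul]),
    Finsupp.sum_mapDomain_index (by simp) (by simp [add_mul]),
    Finsupp.sum_mapDomain_index (by simp) (by simp [add_mul])]
  simp [pbwWeight, MultiIndex.ord]

/-- The list need only contain the support, since absent elements contribute `b j ^ 0 = 1`; this
allows all variables to be listed, as in the definition of `⟦f⟧`. -/
theorem sortedProd_toMultiset {J A : Type*} [LinearOrder J] [Ring A] (b : J → A) (f : J →₀ ℕ)
    (k : List J) (hk : k.Pairwise (· < ·)) (hf : ∀ j, f j ≠ 0 → j ∈ k) :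
    sortedProd b (Finsupp.toMultiset f) = (k.map fun j => b j ^ f j).prod := by
  have h1 : ∀ (j : J) (r : ℕ) (s : Multiset J), (∀ i ∈ s, j ≤ i) →
      sortedProd b (r • {j} + s) = b j ^ r * sortedProd b s := by
    intro j r s hs
    induction r with
    | zero => simp
    | succ r ih =>
      rw [succ_nsmul', add_assoc, Multiset.singleton_add, sortedProd_cons, ih, pow_succ',
        mul_assoc]
      intro i hi
      rcases Multiset.mem_add.1 hi with hi | hi
      · rw [Multiset.mem_singleton.1 (Multiset.mem_of_mem_nsmul hi)]
      · exact hs i hi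
  have h0 : ∀ (k : List J) {i : J}, i ∈ (k.map fun j => f j • ({j} : Multiset J)).sum → i ∈ k := by
    intro k i hi
    induction k with
    | nil => simp at hi
    | cons j k ih =>
      rw [List.map_cons, List.sum_cons, Multiset.mem_add] at hi
      rcases hi with hi | hi
      · rw [Multiset.mem_singleton.1 (Multiset.mem_of_mem_nsmul hi)]
        exact List.mem_cons_self
      · exact List.mem_cons_of_mem _ (ih hi)
  have h2 : sortedProd b (k.map fun j => f j • ({j} : Multiset J)).sum =
      (k.map fun j => b j ^ f j).prod := by
    clear hf
    induction k with
    | nil => simp [sortedProd_zero]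
    | cons j k ih =>
      rw [List.pairwise_cons] at hk
      rw [List.map_cons, List.sum_cons, h1, ih hk.2, List.map_cons, List.prod_cons]
      exact fun i hi => (hk.1 i (h0 k hi)).le
  rw [← h2, Finsupp.toMultiset_apply]
  congr 1
  rw [← List.sum_toFinset _ (hk.imp fun h => h.ne), Finsupp.sum]
  refine Finset.sum_subset (fun j hj => ?_) fun j _ hj => ?_
  · simpa using hf j (Finsupp.mem_support_iff.1 hj)
  · rw [Finsupp.notMem_support_iff.1 hj, zero_smul]

theorem normalOrder_monomial (a : Fin n →₀ ℕ) :
    normalOrder n (MvPolynomial.monomial a 1) =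
      (List.ofFn fun i => FreeAlgebra.ι ℂ i ^ a i).prod := by
  have := (MvPolynomial.basisMonomials (Fin n) ℂ).constr_basis ℂ
    (fun a : Fin n →₀ ℕ => (List.ofFn fun i => FreeAlgebra.ι ℂ i ^ a i).prod) a
  rwa [MvPolynomial.coe_basisMonomials] at this

/-- In the lexicographic sum every variable precedes every Lie element, so the ordered product
splits into the two factors. -/
theorem sortedProd_pbwExponent (a : Fin n →₀ ℕ) (l : MultiIndex m) :
    sortedProd (pbwGen B) (Finsupp.toMultiset (pbwExponent a l)) =
      normalOrder n (MvPolynomial.monomial a 1) * orderedMonomial B l := by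
  rw [sortedProd_toMultiset (pbwGen B) _
    ((List.finRange n).map Sum.inlₗ ++ l.support.sort.map Sum.inrₗ), List.map_append,
    List.prod_append, List.map_map, List.map_map, normalOrder_monomial, List.ofFn_eq_map]
  · simp only [Function.comp_def, pbwExponent_inl, pbwExponent_inr]
    rfl
  · rw [List.pairwise_append]
    refine ⟨?_, ?_, ?_⟩
    · exact List.pairwise_map.2 ((List.pairwise_lt_finRange n).imp fun h =>
        Sum.Lex.inl_lt_inl_iff.2 h)
    · exact List.pairwise_map.2 ((Finset.sortedLT_sort l.support).pairwise.imp fun h =>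
        Sum.Lex.inr_lt_inr_iff.2 h)
    · intro x hx y hy
      obtain ⟨i, -, rfl⟩ := List.mem_map.1 hx
      obtain ⟨β, -, rfl⟩ := List.mem_map.1 hy
      exact Sum.Lex.inl_lt_inr _ _
  · intro j hj
    rcases j with i | β
    · exact List.mem_append_left _ (List.mem_map.2 ⟨i, List.mem_finRange i, rfl⟩)
    · refine List.mem_append_right _ (List.mem_map.2 ⟨β, ?_, rfl⟩)
      rw [Finset.mem_sort, Finsupp.mem_support_iff]
      intro h
      exact hj ((pbwExponent_inr a l β).trans h)

/-- The basis of the free algebra consisting of the products `⟦x^a⟧ M_λ`. -/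
def pbwBasis : Module.Basis (Σ _ : MultiIndex m, Fin n →₀ ℕ) ℂ (FreeAlgebra ℂ (Fin n)) :=
  (Module.Basis.mk (linearIndependent_sortedProd_pbwGen B) (by
    have h := weightSpan_eq_span_sortedProd (pbwGen_lie_mem B) 0
    rw [weightSpan_pbwGen_zero] at h
    rw [h]
    exact Submodule.span_mono (Set.image_subset_range _ _))).reindex
      (Equiv.ofBijective _ pbwExponent_bijective).symm

theorem pbwBasis_apply (x : Σ _ : MultiIndex m, Fin n →₀ ℕ) :
    pbwBasis B x = normalOrder n (MvPolynomial.monomial x.2 1) * orderedMonomial B x.1 := by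
  rw [pbwBasis, Module.Basis.reindex_apply, Equiv.symm_symm, Module.Basis.mk_apply,
    Equiv.ofBijective_apply, sortedProd_pbwExponent]

/-- The normal form of an element of the free algebra. -/
def normalForm : FreeAlgebra ℂ (Fin n) ≃ₗ[ℂ] (MultiIndex m →₀ MvPolynomial (Fin n) ℂ) :=
  (pbwBasis B).equiv
    (Finsupp.basis fun _ : MultiIndex m => MvPolynomial.basisMonomials (Fin n) ℂ) (Equiv.refl _)

theorem normalForm_term (f : MvPolynomial (Fin n) ℂ) (l : MultiIndex m) :
    normalForm B (normalOrder n f * orderedMonomial B l) = Finsupp.single l f := by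
  suffices h : (normalForm B).toLinearMap ∘ₗ LinearMap.mulRight ℂ (orderedMonomial B l) ∘ₗ
      normalOrder n = Finsupp.lsingle l from DFunLike.congr_fun h f
  refine (MvPolynomial.basisMonomials (Fin n) ℂ).ext fun a => ?_
  have := (pbwBasis B).equiv_apply (b' :=
    (Finsupp.basis fun _ : MultiIndex m => MvPolynomial.basisMonomials (Fin n) ℂ))
    ⟨l, a⟩ (Equiv.refl _)
  rw [pbwBasis_apply, Finsupp.coe_basis] at this
  simpa [normalForm] using this

theorem normalForm_symm_single (f : MvPolynomial (Fin n) ℂ) (l : MultiIndex m) :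
    (normalForm B).symm (Finsupp.single l f) = normalOrder n f * orderedMonomial B l := by
  rw [LinearEquiv.symm_apply_eq, normalForm_term]

theorem eq_sum_normalForm (x : FreeAlgebra ℂ (Fin n)) :
    x = (normalForm B x).sum fun l f => normalOrder n f * orderedMonomial B l := by
  conv_lhs => rw [← (normalForm B).symm_apply_apply x, ← Finsupp.sum_single (normalForm B x)]
  rw [map_finsuppSum]
  simp only [normalForm_symm_single]

theorem normalForm_induction {p : FreeAlgebra ℂ (Fin n) → Prop}
    (term : ∀ (f : MvPolynomial (Fin n) ℂ) (l : MultiIndex m),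
      p (normalOrder n f * orderedMonomial B l)) (zero : p 0)
    (add : ∀ x y, p x → p y → p (x + y)) (x : FreeAlgebra ℂ (Fin n)) : p x := by
  rw [eq_sum_normalForm B x]
  exact Finset.sum_induction _ p add zero fun l _ => term _ l

/-- The terms of the NC-filtration in terms of the normal form. -/
theorem mem_ncFiltration_iff (e : ℕ) (x : FreeAlgebra ℂ (Fin n)) :
    x ∈ ncFiltration (FreeAlgebra ℂ (Fin n)) e ↔
      ∀ l : MultiIndex m, l.ord < e → normalForm B x l = 0 := by
  rw [mem_ncFiltration_iff_mem_weightSpan B,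
    weightSpan_eq_span_sortedProd (pbwGen_lie_mem B) e]
  constructor
  · intro hx
    induction hx using Submodule.span_induction with
    | mem x hx =>
      obtain ⟨s, hs, rfl⟩ := hx
      obtain ⟨⟨l, a⟩, rfl⟩ := (pbwExponent_bijective (n := n) (m := m)).2 s
      intro k hk
      rw [sortedProd_pbwExponent, normalForm_term, Finsupp.single_eq_of_ne]
      rintro rfl
      simp only [Set.mem_ofPred_eq, sum_pbwWeight_pbwExponent] at hs
      omega
    | zero => simp
    | add x y _ _ hx hy =>
      intro l hl
      rw [map_add, Finsupp.add_apply, hx l hl, hy l hl, add_zero]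
    | smul c x _ hx =>
      intro l hl
      rw [map_smul, Finsupp.smul_apply, hx l hl, smul_zero]
  · intro h
    rw [eq_sum_normalForm B x]
    refine sum_mem fun l hl => ?_
    have hle : e ≤ l.ord := by
      by_contra hlt
      exact Finsupp.mem_support_iff.1 hl (h l (by omega))
    change normalOrder n (normalForm B x l) * orderedMonomial B l ∈ _
    generalize normalForm B x l = f
    rw [f.as_sum, map_sum, Finset.sum_mul]
    refine sum_mem fun a _ => ?_
    have ha : MvPolynomial.monomial a (MvPolynomial.coeff a f) =
        MvPolynomial.coeff a f • MvPolynomial.monomial a 1 := by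
      rw [MvPolynomial.smul_monomial, smul_eq_mul, mul_one]
    rw [ha, map_smul, smul_mul_assoc, ← sortedProd_pbwExponent]
    refine Submodule.smul_mem _ _ (Submodule.subset_span ⟨_, ?_, rfl⟩)
    rwa [Set.mem_ofPred_eq, sum_pbwWeight_pbwExponent]

end PBW

/-! ## Derivations and the normal form -/

section FreeDeriv

variable {n : ℕ} {m : ℕ → ℕ} (B : ∀ d, Module.Basis (Fin (m d)) ℂ (lieDegree n (d + 2)))

theorem freeDeriv_pow_of_eigen (δ : Fin n → FreeAlgebra ℂ (Fin n)) {y : FreeAlgebra ℂ (Fin n)}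
    {c : ℕ} (h : freeDeriv δ y = (c : ℂ) • y) (r : ℕ) :
    freeDeriv δ (y ^ r) = ((r * c : ℕ) : ℂ) • y ^ r := by
  induction r with
  | zero => simp [freeDeriv_one]
  | succ r ih =>
    rw [pow_succ, freeDeriv_mul, ih, h, mul_smul_comm, smul_mul_assoc, ← add_smul]
    push_cast
    ring_nf

/-- Serves both for the Euler derivation, where `c` is the degree, and for partial derivatives of
Lie elements, where `c = 0`. -/
theorem freeDeriv_list_prod_of_eigen {ι : Type*} (δ : Fin n → FreeAlgebra ℂ (Fin n))
    (y : ι → FreeAlgebra ℂ (Fin n)) (c : ι → ℕ) (h : ∀ j, freeDeriv δ (y j) = (c j : ℂ) • y j)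
    (k : List ι) :
    freeDeriv δ (k.map y).prod = ((k.map c).sum : ℂ) • (k.map y).prod := by
  induction k with
  | nil => simp [freeDeriv_one]
  | cons j k ih =>
    rw [List.map_cons, List.prod_cons, freeDeriv_mul, ih, h, mul_smul_comm, smul_mul_assoc,
      ← add_smul, List.map_cons, List.sum_cons]
    push_cast
    ring_nf

/-- The degree of `M_λ`. -/
def MultiIndex.deg (l : MultiIndex m) : ℕ :=
  l.sum fun β k => k * ((ofLex β).1 + 2)

theorem freeEuler_orderedMonomial (l : MultiIndex m) :
    freeEuler n (orderedMonomial B l) = (l.deg : ℂ) • orderedMonomial B l := by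
  have h := freeDeriv_list_prod_of_eigen (FreeAlgebra.ι ℂ) (fun β => basicLie B β ^ l β)
    (fun β => l β * ((ofLex β).1 + 2))
    (fun β => freeDeriv_pow_of_eigen _ (freeEuler_basicLie B β) _) l.support.sort
  have h2 : ((l.support.sort.map fun β => l β * ((ofLex β).1 + 2))).sum = l.deg := by
    rw [MultiIndex.deg, Finsupp.sum, ← Finset.sum_map_toList]
    exact (List.Perm.map _ (Finset.sort_perm_toList _ _)).sum_eq
  rw [← h2]
  exact_mod_cast h

theorem freePartial_orderedMonomial (i : Fin n) (l : MultiIndex m) :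
    freePartial i (orderedMonomial B l) = 0 := by
  have h := freeDeriv_list_prod_of_eigen (Pi.single i 1) (fun β => basicLie B β ^ l β)
    (fun β => l β * 0) (fun β => freeDeriv_pow_of_eigen _
      ((freePartial_basicLie B i β).trans (by rw [Nat.cast_zero, zero_smul])) _) l.support.sort
  rw [List.sum_eq_zero (by simp), Nat.cast_zero, zero_smul] at h
  exact h

theorem freeEuler_normalOrder_monomial (a : Fin n →₀ ℕ) :
    freeEuler n (normalOrder n (MvPolynomial.monomial a 1)) =
      (a.degree : ℂ) • normalOrder n (MvPolynomial.monomial a 1) := by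
  have h := freeDeriv_list_prod_of_eigen (FreeAlgebra.ι ℂ)
    (fun i => FreeAlgebra.ι ℂ i ^ a i) a
    (fun i => by
      simpa using freeDeriv_pow_of_eigen (c := 1) (FreeAlgebra.ι ℂ) (y := FreeAlgebra.ι ℂ i)
        (by simp [freeDeriv_ι]) (a i)) (List.finRange n)
  rw [normalOrder_monomial, List.ofFn_eq_map, Finsupp.degree_eq_sum, ← List.sum_ofFn,
    List.ofFn_eq_map]
  exact_mod_cast h

/-- The partial derivative as an element of the endomorphism algebra. -/
abbrev pderivEnd (i : Fin n) : Module.End ℂ (MvPolynomial (Fin n) ℂ) :=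
  ((MvPolynomial.pderiv i : Derivation ℂ (MvPolynomial (Fin n) ℂ) (MvPolynomial (Fin n) ℂ)) :
    MvPolynomial (Fin n) ℂ →ₗ[ℂ] MvPolynomial (Fin n) ℂ)

theorem freePartial_normalOrder (i : Fin n) (f : MvPolynomial (Fin n) ℂ) :
    freePartial i (normalOrder n f) = normalOrder n (MvPolynomial.pderiv i f) := by
  suffices h : freePartial i ∘ₗ normalOrder n =
      normalOrder n ∘ₗ pderivEnd i by
    have h2 := LinearMap.congr_fun h f
    rwa [LinearMap.comp_apply, LinearMap.comp_apply, Derivation.coeFn_coe] at h2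
  refine (MvPolynomial.basisMonomials (Fin n) ℂ).ext fun a => ?_
  have h0 : ∀ j, i ≠ j → ∀ r : ℕ, freePartial i (FreeAlgebra.ι ℂ j ^ r) = 0 := fun j hj r => by
    have h : freeDeriv (Pi.single i 1) (FreeAlgebra.ι ℂ j : FreeAlgebra ℂ (Fin n)) =
        ((0 : ℕ) : ℂ) • FreeAlgebra.ι ℂ j := by
      rw [freeDeriv_ι, Pi.single_eq_of_ne hj.symm, Nat.cast_zero, zero_smul]
    rw [freePartial, freeDeriv_pow_of_eigen _ h, mul_zero, Nat.cast_zero, zero_smul]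
  have h1 : ∀ r : ℕ, freePartial i (FreeAlgebra.ι ℂ i ^ r) =
      (r : ℂ) • FreeAlgebra.ι ℂ i ^ (r - 1) := by
    intro r
    induction r with
    | zero => simp [freePartial, freeDeriv_one]
    | succ r ih =>
      rw [freePartial] at ih ⊢
      rw [pow_succ, freeDeriv_mul, ih, freeDeriv_ι, Pi.single_eq_same, mul_one, smul_mul_assoc]
      rcases r with _ | r
      · simp
      · rw [Nat.add_sub_cancel, ← pow_succ, Nat.add_sub_cancel]
        push_cast
        module
  -- As the variables in the list are distinct, only the factor with index `i` is differentiated.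
  have key : ∀ k : List (Fin n), k.Nodup →
      freePartial i (k.map fun j => FreeAlgebra.ι ℂ j ^ a j).prod = if i ∈ k then
        (a i : ℂ) • (k.map fun j => FreeAlgebra.ι ℂ j ^ (a - Finsupp.single i 1 : Fin n →₀ ℕ) j).prod
        else 0 := by
    intro k hk
    induction k with
    | nil => simp [freePartial, freeDeriv_one]
    | cons j k ih =>
      rw [List.nodup_cons] at hk
      rw [List.map_cons, List.prod_cons]
      have hm := freeDeriv_mul (Pi.single i 1) (FreeAlgebra.ι ℂ j ^ a j)
        (k.map fun j => FreeAlgebra.ι ℂ j ^ a j).prod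
      rw [← freePartial] at hm
      rw [hm, ih hk.2]
      by_cases hj : i = j
      · subst hj
        rw [if_neg hk.1, h1, if_pos List.mem_cons_self, mul_zero, zero_add, List.map_cons,
          List.prod_cons, smul_mul_assoc]
        have h2 : (k.map fun j => FreeAlgebra.ι ℂ j ^ a j) =
            k.map fun j => FreeAlgebra.ι ℂ j ^ (a - Finsupp.single i 1 : Fin n →₀ ℕ) j := by
          refine List.map_congr_left fun j hj => ?_
          rw [Finsupp.tsub_apply, Finsupp.single_eq_of_ne (by rintro rfl; exact hk.1 hj),
            tsub_zero]
        rw [h2]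
        simp
      · rw [h0 j hj, zero_mul, add_zero]
        simp only [List.mem_cons, hj, false_or]
        split_ifs
        · rw [List.map_cons, List.prod_cons, mul_smul_comm, Finsupp.tsub_apply,
            Finsupp.single_eq_of_ne (Ne.symm hj), tsub_zero]
        · rw [mul_zero]
  have h3 := key _ (List.nodup_finRange n)
  rw [if_pos (List.mem_finRange i)] at h3
  rw [LinearMap.comp_apply, LinearMap.comp_apply, MvPolynomial.coe_basisMonomials,
    normalOrder_monomial, List.ofFn_eq_map, h3]
  change _ = normalOrder n (MvPolynomial.pderiv i (MvPolynomial.monomial a 1))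
  have ha : MvPolynomial.monomial (a - Finsupp.single i 1) (a i : ℂ) =
      (a i : ℂ) • MvPolynomial.monomial (a - Finsupp.single i 1) 1 := by
    rw [MvPolynomial.smul_monomial, smul_eq_mul, mul_one]
  rw [MvPolynomial.pderiv_monomial, one_mul, ha, map_smul, normalOrder_monomial, List.ofFn_eq_map]

/-- The derivation kills each `M_λ`, so it acts on the polynomial coefficients alone. -/
theorem normalForm_freePartial (i : Fin n) (x : FreeAlgebra ℂ (Fin n)) (l : MultiIndex m) :
    normalForm B (freePartial i x) l = MvPolynomial.pderiv i (normalForm B x l) := by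
  induction x using normalForm_induction B with
  | term f k =>
    have hm := freeDeriv_mul (Pi.single i 1) (normalOrder n f) (orderedMonomial B k)
    rw [← freePartial] at hm
    rw [hm, freePartial_orderedMonomial, mul_zero, zero_add, freePartial_normalOrder,
      normalForm_term, normalForm_term]
    rcases eq_or_ne l k with rfl | h
    · simp
    · simp [Finsupp.single_eq_of_ne h]
  | zero => simp
  | add x y hx hy => rw [map_add, map_add, map_add, Finsupp.add_apply, Finsupp.add_apply, hx, hy,
      map_add]

/-- The product `⟦x^a⟧ M_k` is an eigenvector with eigenvalue `|a| + deg k`; the constant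
coefficient at `l` sees only `a = 0`, `k = l`. -/
theorem constantCoeff_normalForm_freeEuler (x : FreeAlgebra ℂ (Fin n)) (l : MultiIndex m) :
    MvPolynomial.coeff 0 (normalForm B (freeEuler n x) l) =
      l.deg * MvPolynomial.coeff 0 (normalForm B x l) := by
  have h : MvPolynomial.lcoeff ℂ (0 : Fin n →₀ ℕ) ∘ₗ Finsupp.lapply l ∘ₗ
      (normalForm B).toLinearMap ∘ₗ freeEuler n =
      (l.deg : ℂ) • (MvPolynomial.lcoeff ℂ (0 : Fin n →₀ ℕ) ∘ₗ Finsupp.lapply l ∘ₗ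
      (normalForm B).toLinearMap) := by
    refine (pbwBasis B).ext fun x => ?_
    obtain ⟨k, a⟩ := x
    have hm := freeDeriv_mul (FreeAlgebra.ι ℂ) (normalOrder n (MvPolynomial.monomial a 1))
      (orderedMonomial B k)
    rw [← freeEuler, freeEuler_orderedMonomial, freeEuler_normalOrder_monomial, mul_smul_comm,
      smul_mul_assoc, ← add_smul] at hm
    rw [pbwBasis_apply]
    simp only [LinearMap.comp_apply, LinearMap.smul_apply, hm, map_smul, LinearEquiv.coe_coe,
      normalForm_term, Finsupp.lapply_apply]
    rcases eq_or_ne l k with rfl | h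
    · rcases eq_or_ne a 0 with rfl | ha
      · simp
      · simp [MvPolynomial.lcoeff_apply, MvPolynomial.coeff_monomial, ha]
    · simp [Finsupp.single_eq_of_ne h]
  simpa using DFunLike.congr_fun h x

end FreeDeriv

/-! ## Bidifferential operators -/

section BiDiff

variable {n : ℕ}

/-- The number `r` is a product of falling factorials. -/
theorem coeff_iterDeriv_pderiv (a c : Fin n →₀ ℕ) : ∃ r : ℕ, r ≠ 0 ∧
    ∀ f : MvPolynomial (Fin n) ℂ, MvPolynomial.coeff c (iterDeriv MvPolynomial.pderiv a f) =
      r * MvPolynomial.coeff (c + a) f := by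
  have h1 : ∀ (i : Fin n) (k : ℕ) (c : Fin n →₀ ℕ), ∃ r : ℕ, r ≠ 0 ∧
      ∀ f : MvPolynomial (Fin n) ℂ, MvPolynomial.coeff c
        ((pderivEnd i ^ k) f) =
        r * MvPolynomial.coeff (c + Finsupp.single i k) f := by
    intro i k
    induction k with
    | zero => exact fun c => ⟨1, one_ne_zero, by simp⟩
    | succ k ih =>
      intro c
      obtain ⟨r, hr, h⟩ := ih (c + Finsupp.single i 1)
      refine ⟨r * (c i + 1), by positivity, fun f => ?_⟩
      rw [pow_succ', Module.End.mul_apply, Derivation.coeFn_coe, MvPolynomial.coeff_pderiv, h,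
        add_assoc, ← Finsupp.single_add, add_comm 1 k]
      push_cast
      ring
  have h2 : ∀ (l : List (Fin n)) (c : Fin n →₀ ℕ), ∃ r : ℕ, r ≠ 0 ∧
      ∀ f : MvPolynomial (Fin n) ℂ, MvPolynomial.coeff c
        ((l.map fun i => pderivEnd i ^ a i).prod f) =
        r * MvPolynomial.coeff (c + (l.map fun i => Finsupp.single i (a i)).sum) f := by
    intro l
    induction l with
    | nil => exact fun c => ⟨1, one_ne_zero, by simp⟩
    | cons i l ih =>
      intro c
      obtain ⟨r, hr, h⟩ := h1 i (a i) c
      obtain ⟨r', hr', h'⟩ := ih (c + Finsupp.single i (a i))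
      refine ⟨r * r', mul_ne_zero hr hr', fun f => ?_⟩
      rw [List.map_cons, List.prod_cons, Module.End.mul_apply, h, h', List.map_cons,
        List.sum_cons, add_assoc]
      push_cast
      ring
  obtain ⟨r, hr, h⟩ := h2 (List.finRange n) c
  refine ⟨r, hr, fun f => ?_⟩
  rw [iterDeriv, List.ofFn_eq_map, h, ← List.ofFn_eq_map, List.sum_ofFn, Finsupp.univ_sum_single]

theorem pderiv_iterDeriv (i : Fin n) (a : Fin n →₀ ℕ) (f : MvPolynomial (Fin n) ℂ) :
    MvPolynomial.pderiv i (iterDeriv MvPolynomial.pderiv a f) =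
      iterDeriv MvPolynomial.pderiv a (MvPolynomial.pderiv i f) := by
  have h : Commute (pderivEnd i)
      (iterDeriv MvPolynomial.pderiv a) := by
    refine Commute.list_prod_right _ _ fun x hx => ?_
    obtain ⟨j, rfl⟩ := (List.mem_ofFn' _ _).1 hx
    refine Commute.pow_right (LinearMap.ext fun f => ?_) _
    rw [Module.End.mul_apply, Module.End.mul_apply]
    ext c
    simp only [Derivation.coeFn_coe, MvPolynomial.coeff_pderiv, Finsupp.add_apply,
      add_right_comm c]
    rcases eq_or_ne i j with rfl | h
    · rfl
    · rw [Finsupp.single_eq_of_ne h, Finsupp.single_eq_of_ne h.symm]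
      push_cast
      ring
  exact DFunLike.congr_fun h f

namespace BiDiffOp

variable {A : Type*} [CommRing A] [Algebra ℂ A] (e : MvPolynomial (Fin n) ℂ →ₐ[ℂ] A)
  (D : Fin n → Derivation ℂ A A)

/-- The bilinear map given by a bilinear differential operator. -/
def bilin (C : BiDiffOp n) : A →ₗ[ℂ] A →ₗ[ℂ] A :=
  C.sum fun αβ c => ((LinearMap.mul ℂ A).compl₁₂ (iterDeriv D αβ.1) (iterDeriv D αβ.2)).compr₂
    (LinearMap.mulLeft ℂ (e c))

theorem eval_eq_bilin (C : BiDiffOp n) (f g : A) : C.eval e D f g = C.bilin e D f g := by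
  simp [eval, bilin, Finsupp.sum, LinearMap.sum_apply]

theorem iterDeriv_map {A' : Type*} [CommRing A'] [Algebra ℂ A'] (D' : Fin n → Derivation ℂ A' A')
    (φ : A →ₐ[ℂ] A') (hD : ∀ i a, φ (D i a) = D' i (φ a)) (α : Fin n →₀ ℕ) (a : A) :
    φ (iterDeriv D α a) = iterDeriv D' α (φ a) := by
  have h1 : ∀ i k a, φ ((((D i : A →ₗ[ℂ] A) : Module.End ℂ A) ^ k) a) =
      (((D' i : A' →ₗ[ℂ] A') : Module.End ℂ A') ^ k) (φ a) := by
    intro i k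
    induction k with
    | zero => simp
    | succ k ih =>
      intro a
      rw [pow_succ, pow_succ, Module.End.mul_apply, Module.End.mul_apply, ih,
        Derivation.coeFn_coe, Derivation.coeFn_coe, hD]
  rw [iterDeriv, iterDeriv, List.ofFn_eq_map, List.ofFn_eq_map]
  induction List.finRange n generalizing a with
  | nil => simp
  | cons i l ih => rw [List.map_cons, List.map_cons, List.prod_cons, List.prod_cons,
      Module.End.mul_apply, Module.End.mul_apply, h1, ih]

theorem eval_map {A' : Type*} [CommRing A'] [Algebra ℂ A'] (D' : Fin n → Derivation ℂ A' A')
    (e' : MvPolynomial (Fin n) ℂ →ₐ[ℂ] A')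
    (φ : A →ₐ[ℂ] A') (hD : ∀ i a, φ (D i a) = D' i (φ a)) (he : ∀ p, φ (e p) = e' p)
    (C : BiDiffOp n) (f g : A) : φ (C.eval e D f g) = C.eval e' D' (φ f) (φ g) := by
  simp only [eval, Finsupp.sum, map_sum, map_mul, he, iterDeriv_map D D' φ hD]

theorem eval_sub (C C' : BiDiffOp n) (f g : A) :
    (C - C').eval e D f g = C.eval e D f g - C'.eval e D f g :=
  Finsupp.sum_sub_index fun _ _ _ => by rw [map_sub, sub_mul]

end BiDiffOp

theorem coeff_zero_iterDeriv_monomial_of_ne {a c : Fin n →₀ ℕ} (h : a ≠ c) :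
    MvPolynomial.coeff 0 (iterDeriv MvPolynomial.pderiv a
      (MvPolynomial.monomial c (1 : ℂ))) = 0 := by
  obtain ⟨r, -, hr⟩ := coeff_iterDeriv_pderiv a 0
  rw [hr, zero_add, MvPolynomial.coeff_monomial, if_neg h.symm, mul_zero]

theorem iterDeriv_monomial_of_not_le {a c : Fin n →₀ ℕ} (h : ¬ a ≤ c) :
    iterDeriv MvPolynomial.pderiv a (MvPolynomial.monomial c (1 : ℂ)) = 0 := by
  ext b
  obtain ⟨r, -, hr⟩ := coeff_iterDeriv_pderiv a b
  rw [hr, MvPolynomial.coeff_monomial, if_neg, mul_zero, MvPolynomial.coeff_zero]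
  rintro rfl
  exact h le_add_self

/-- The nonzero number `∂^a(x^a)`. -/
def derivFactor (a : Fin n →₀ ℕ) : ℂ :=
  MvPolynomial.coeff 0 (iterDeriv MvPolynomial.pderiv a (MvPolynomial.monomial a (1 : ℂ)))

theorem derivFactor_ne_zero (a : Fin n →₀ ℕ) : derivFactor a ≠ 0 := by
  obtain ⟨r, h, hr⟩ := coeff_iterDeriv_pderiv a 0
  rw [derivFactor, hr, zero_add, MvPolynomial.coeff_monomial, if_pos rfl, mul_one]
  exact_mod_cast h

theorem iterDeriv_monomial_self (a : Fin n →₀ ℕ) :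
    iterDeriv MvPolynomial.pderiv a (MvPolynomial.monomial a (1 : ℂ)) =
      MvPolynomial.C (derivFactor a) := by
  ext b
  rcases eq_or_ne b 0 with rfl | hb
  · simp [derivFactor]
  · obtain ⟨r, -, hr⟩ := coeff_iterDeriv_pderiv a b
    rw [hr, MvPolynomial.coeff_monomial, if_neg (by simpa using hb), mul_zero,
      MvPolynomial.coeff_C, if_neg hb.symm]

/-- A bilinear differential operator is determined by its values on polynomials. -/
theorem BiDiffOp.eq_zero_of_evalPoly_eq_zero (C : BiDiffOp n)
    (h : ∀ f g, C.evalPoly f g = 0) : C = 0 := by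
  by_contra hC
  -- Evaluate on the monomials with the exponents of a term of minimal total order: every other term
  -- differentiates one of them to zero, while this term gives its coefficient times nonzero
  -- constants.
  obtain ⟨x, hx, hmin⟩ := Finset.exists_min_image C.support
    (fun x => x.1.degree + x.2.degree) (Finsupp.support_nonempty_iff.2 hC)
  have h1 := h (MvPolynomial.monomial x.1 1) (MvPolynomial.monomial x.2 1)
  rw [evalPoly, eval, Finsupp.sum, Finset.sum_eq_single x] at h1
  · rw [iterDeriv_monomial_self, iterDeriv_monomial_self, AlgHom.id_apply, mul_eq_zero,
      mul_eq_zero] at h1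
    rcases h1 with h1 | h1 | h1
    · exact Finsupp.mem_support_iff.1 hx h1
    · exact derivFactor_ne_zero x.1 (by simpa using h1)
    · exact derivFactor_ne_zero x.2 (by simpa using h1)
  · intro y hy hne
    by_cases hle1 : y.1 ≤ x.1
    · by_cases hle2 : y.2 ≤ x.2
      · exfalso
        apply hne
        have h2 := hmin y hy
        obtain ⟨u, hu⟩ := exists_add_of_le hle1
        obtain ⟨v, hv⟩ := exists_add_of_le hle2
        simp only [hu, hv, map_add] at h2
        have hu0 : u = 0 := (Finsupp.degree_eq_zero_iff u).1 (by omega)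
        have hv0 : v = 0 := (Finsupp.degree_eq_zero_iff v).1 (by omega)
        rw [hu0, add_zero] at hu
        rw [hv0, add_zero] at hv
        exact Prod.ext hu.symm hv.symm
      · rw [iterDeriv_monomial_of_not_le hle2, mul_zero, mul_zero]
    · rw [iterDeriv_monomial_of_not_le hle1, zero_mul, mul_zero]
  · exact fun h => absurd hx h

/-- A translation invariant bilinear map is determined by the constant terms of its values. -/
theorem eq_zero_of_invariant
    (b : MvPolynomial (Fin n) ℂ →ₗ[ℂ] MvPolynomial (Fin n) ℂ →ₗ[ℂ] MvPolynomial (Fin n) ℂ)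
    (hb : ∀ i f g, MvPolynomial.pderiv i (b f g) =
      b (MvPolynomial.pderiv i f) g + b f (MvPolynomial.pderiv i g))
    (h0 : ∀ α β, MvPolynomial.coeff 0
      (b (MvPolynomial.monomial α 1) (MvPolynomial.monomial β 1)) = 0) : b = 0 := by
  have h1 : ∀ f g, MvPolynomial.coeff 0 (b f g) = 0 := by
    suffices h : b.compr₂ (MvPolynomial.lcoeff ℂ 0) = 0 from
      fun f g => DFunLike.congr_fun (DFunLike.congr_fun h f) g
    refine (MvPolynomial.basisMonomials (Fin n) ℂ).ext fun α =>
      (MvPolynomial.basisMonomials (Fin n) ℂ).ext fun β => ?_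
    simpa using h0 α β
  -- Induction on the degree of `c`: a coefficient of positive degree is seen, up to a nonzero
  -- integer, in a partial derivative, which invariance moves onto the arguments.
  have h2 : ∀ (c : Fin n →₀ ℕ) f g, MvPolynomial.coeff c (b f g) = 0 := by
    suffices h : ∀ (N : ℕ) (c : Fin n →₀ ℕ), c.degree = N → ∀ f g,
        MvPolynomial.coeff c (b f g) = 0 from fun c => h _ c rfl
    intro N
    induction N with
    | zero =>
      intro c hc
      rw [(Finsupp.degree_eq_zero_iff c).1 hc]
      exact h1
    | succ N ih =>
      intro c hc f g
      have hc0 : c ≠ 0 := by rintro rfl; simp at hc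
      obtain ⟨i, hi⟩ := Finsupp.ne_iff.1 hc0
      obtain ⟨c', rfl⟩ : ∃ c', c = c' + Finsupp.single i 1 :=
        ⟨c - Finsupp.single i 1, (tsub_add_cancel_of_le (Finsupp.single_le_iff.2
          (Nat.one_le_iff_ne_zero.2 hi))).symm⟩
      rw [map_add, Finsupp.degree_single, Nat.add_right_cancel_iff] at hc
      have h2 := congrArg (MvPolynomial.coeff c') (hb i f g)
      rw [MvPolynomial.coeff_pderiv, MvPolynomial.coeff_add, ih c' hc, ih c' hc, add_zero,
        mul_eq_zero] at h2
      exact h2.resolve_right (by exact_mod_cast (c' i).succ_ne_zero)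
  refine LinearMap.ext fun f => LinearMap.ext fun g => MvPolynomial.ext _ _ fun c => ?_
  simpa using h2 c f g

end BiDiff

/-! ## The operators of the normal form -/

section NormalOp

variable {n : ℕ} {m : ℕ → ℕ} (B : ∀ d, Module.Basis (Fin (m d)) ℂ (lieDegree n (d + 2)))

/-- The coefficient of `M_ν` in the normal form of `⟦f⟧ M_λ ⟦g⟧ M_μ`. -/
def prodForm (l k v : MultiIndex m) : MvPolynomial (Fin n) ℂ →ₗ[ℂ] MvPolynomial (Fin n) ℂ →ₗ[ℂ]
    MvPolynomial (Fin n) ℂ :=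
  ((LinearMap.mul ℂ (FreeAlgebra ℂ (Fin n))).compl₁₂
    (LinearMap.mulRight ℂ (orderedMonomial B l) ∘ₗ normalOrder n)
    (LinearMap.mulRight ℂ (orderedMonomial B k) ∘ₗ normalOrder n)).compr₂
      (Finsupp.lapply v ∘ₗ (normalForm B).toLinearMap)

theorem prodForm_apply (l k v : MultiIndex m) (f g : MvPolynomial (Fin n) ℂ) :
    prodForm B l k v f g = normalForm B
      (normalOrder n f * orderedMonomial B l * (normalOrder n g * orderedMonomial B k)) v := by
  simp [prodForm]

theorem freePartial_mul (i : Fin n) (a b : FreeAlgebra ℂ (Fin n)) :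
    freePartial i (a * b) = a * freePartial i b + freePartial i a * b :=
  freeDeriv_mul _ a b

theorem freeEuler_mul (a b : FreeAlgebra ℂ (Fin n)) :
    freeEuler n (a * b) = a * freeEuler n b + freeEuler n a * b :=
  freeDeriv_mul _ a b

/-- Infinitesimal translation invariance. It holds because the partial derivations of the free
algebra do not see the factors `M_λ`, `M_μ`, `M_ν`. -/
theorem pderiv_prodForm (l k v : MultiIndex m) (i : Fin n) (f g : MvPolynomial (Fin n) ℂ) :
    MvPolynomial.pderiv i (prodForm B l k v f g) =
      prodForm B l k v (MvPolynomial.pderiv i f) g +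
        prodForm B l k v f (MvPolynomial.pderiv i g) := by
  have h : ∀ f (l : MultiIndex m), freePartial i (normalOrder n f * orderedMonomial B l) =
      normalOrder n (MvPolynomial.pderiv i f) * orderedMonomial B l := fun f l => by
    rw [freePartial_mul, freePartial_orderedMonomial, mul_zero, zero_add, freePartial_normalOrder]
  rw [prodForm_apply, prodForm_apply, prodForm_apply, ← normalForm_freePartial, freePartial_mul, h,
    h, map_add, Finsupp.add_apply, add_comm]

/-- Multiplication in the free algebra is homogeneous. The resulting bound on `α` and `β` gives the
operators finite order. -/
theorem coeff_prodForm_monomial (l k v : MultiIndex m) (α β : Fin n →₀ ℕ)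
    (h : MvPolynomial.coeff 0
      (prodForm B l k v (MvPolynomial.monomial α 1) (MvPolynomial.monomial β 1)) ≠ 0) :
    α.degree + β.degree + l.deg + k.deg = v.deg := by
  rw [prodForm_apply] at h
  have h2 : ∀ (α : Fin n →₀ ℕ) (l : MultiIndex m),
      freeEuler n (normalOrder n (MvPolynomial.monomial α 1) * orderedMonomial B l) =
        ((α.degree + l.deg : ℕ) : ℂ) •
          (normalOrder n (MvPolynomial.monomial α 1) * orderedMonomial B l) := fun α l => by
    rw [freeEuler_mul, freeEuler_orderedMonomial, freeEuler_normalOrder_monomial, mul_smul_comm,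
      smul_mul_assoc, ← add_smul, add_comm]
    push_cast
    rfl
  have h3 := constantCoeff_normalForm_freeEuler B
    (normalOrder n (MvPolynomial.monomial α 1) * orderedMonomial B l *
      (normalOrder n (MvPolynomial.monomial β 1) * orderedMonomial B k)) v
  rw [freeEuler_mul, h2, h2, mul_smul_comm, smul_mul_assoc, ← add_smul, map_smul,
    Finsupp.smul_apply, MvPolynomial.coeff_smul, smul_eq_mul] at h3
  have h4 := mul_right_cancel₀ h h3
  norm_cast at h4
  omega

/-- The operator `C^ν_{λμ}`. Its coefficients are constants. -/
def normalOp (l k v : MultiIndex m) : BiDiffOp n :=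
  Finsupp.ofSupportFinite (fun αβ => MvPolynomial.C (MvPolynomial.coeff 0
    (prodForm B l k v (MvPolynomial.monomial αβ.1 1) (MvPolynomial.monomial αβ.2 1)) /
      (derivFactor αβ.1 * derivFactor αβ.2))) (by
    -- Both exponents are bounded by the degree of `M_ν`.
    refine ((Finsupp.finite_of_degree_le v.deg).prod (Finsupp.finite_of_degree_le v.deg)).subset
      fun αβ h => ?_
    have h1 := coeff_prodForm_monomial B l k v αβ.1 αβ.2 (by rintro h0; simp [h0] at h)
    exact ⟨show αβ.1.degree ≤ _ by omega, show αβ.2.degree ≤ _ by omega⟩)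

theorem normalOp_apply (l k v : MultiIndex m) (αβ : (Fin n →₀ ℕ) × (Fin n →₀ ℕ)) :
    normalOp B l k v αβ = MvPolynomial.C (MvPolynomial.coeff 0
    (prodForm B l k v (MvPolynomial.monomial αβ.1 1) (MvPolynomial.monomial αβ.2 1)) /
      (derivFactor αβ.1 * derivFactor αβ.2)) := rfl

/-- Both sides are translation invariant, the left one because its coefficients are constants, and
their constant terms on monomials agree by the choice of the coefficients. -/
theorem evalPoly_normalOp (l k v : MultiIndex m) (f g : MvPolynomial (Fin n) ℂ) :
    (normalOp B l k v).evalPoly f g = prodForm B l k v f g := by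
  suffices h : (normalOp B l k v).bilin (AlgHom.id ℂ _) MvPolynomial.pderiv - prodForm B l k v = 0
    by
    have h' := LinearMap.congr_fun (LinearMap.congr_fun h f) g
    rw [LinearMap.sub_apply, LinearMap.sub_apply, LinearMap.zero_apply, LinearMap.zero_apply,
      sub_eq_zero] at h'
    rw [BiDiffOp.evalPoly, BiDiffOp.eval_eq_bilin, h']
  refine eq_zero_of_invariant _ (fun i f g => ?_) fun α β => ?_
  · simp only [LinearMap.sub_apply, map_sub, pderiv_prodForm, ← BiDiffOp.eval_eq_bilin]
    have : MvPolynomial.pderiv i ((normalOp B l k v).eval (AlgHom.id ℂ _) MvPolynomial.pderiv f g)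
        = (normalOp B l k v).eval (AlgHom.id ℂ _) MvPolynomial.pderiv (MvPolynomial.pderiv i f) g +
          (normalOp B l k v).eval (AlgHom.id ℂ _) MvPolynomial.pderiv f
            (MvPolynomial.pderiv i g) := by
      rw [BiDiffOp.eval, BiDiffOp.eval, BiDiffOp.eval, Finsupp.sum, Finsupp.sum, Finsupp.sum,
        map_sum, ← Finset.sum_add_distrib]
      refine Finset.sum_congr rfl fun x _ => ?_
      rw [normalOp_apply, AlgHom.id_apply, MvPolynomial.pderiv_C_mul, MvPolynomial.pderiv_mul,
        pderiv_iterDeriv, pderiv_iterDeriv, mul_add]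
    rw [this]
    abel
  · rw [LinearMap.sub_apply, LinearMap.sub_apply, MvPolynomial.coeff_sub, sub_eq_zero,
      ← BiDiffOp.eval_eq_bilin, BiDiffOp.eval, Finsupp.sum, MvPolynomial.coeff_sum,
      Finset.sum_eq_single (α, β)]
    · rw [iterDeriv_monomial_self, iterDeriv_monomial_self, normalOp_apply, AlgHom.id_apply,
        ← map_mul, ← map_mul, MvPolynomial.coeff_zero_C,
        div_mul_cancel₀ _ (mul_ne_zero (derivFactor_ne_zero α) (derivFactor_ne_zero β))]
    · intro x _ hx
      rw [normalOp_apply, AlgHom.id_apply, MvPolynomial.coeff_C_mul]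
      have h3 : MvPolynomial.coeff 0 (iterDeriv MvPolynomial.pderiv x.1 (MvPolynomial.monomial α
          (1 : ℂ)) * iterDeriv MvPolynomial.pderiv x.2 (MvPolynomial.monomial β 1)) = 0 := by
        rw [← MvPolynomial.constantCoeff_eq, map_mul, mul_eq_zero]
        by_cases h1 : x.1 = α
        · exact Or.inr (coeff_zero_iterDeriv_monomial_of_ne fun h2 => hx (Prod.ext h1 h2))
        · exact Or.inl (coeff_zero_iterDeriv_monomial_of_ne h1)
      rw [h3, mul_zero]
    · intro h
      rw [Finsupp.notMem_support_iff.1 h, map_zero, zero_mul, MvPolynomial.coeff_zero]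

/-- The characterization of the operators of the normal form. -/
theorem isNormalFormOperators_iff (C : MultiIndex m → MultiIndex m → MultiIndex m → BiDiffOp n) :
    IsNormalFormOperators B C ↔ ∀ l k v f g, (C l k v).evalPoly f g = prodForm B l k v f g := by
  constructor
  · intro h l k v f g
    obtain ⟨hfin, h⟩ := h l k f g
    rw [prodForm_apply, h, finsum_eq_sum_of_support_subset (s := hfin.toFinset), map_sum,
      Finsupp.finsetSum_apply]
    · simp only [normalForm_term]
      rw [Finset.sum_eq_single v]
      · rw [Finsupp.single_eq_same]
      · exact fun w _ hw => Finsupp.single_eq_of_ne hw.symm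
      · intro hv
        rw [Finsupp.single_eq_same]
        by_contra h0
        exact hv (hfin.mem_toFinset.2 h0)
    · intro v hv
      rw [hfin.coe_toFinset]
      intro h0
      simp [h0] at hv
  · intro h l k f g
    set x := normalOrder n f * orderedMonomial B l * (normalOrder n g * orderedMonomial B k) with hx
    have hC : ∀ v, (C l k v).evalPoly f g = normalForm B x v := fun v => by
      rw [h, prodForm_apply]
    simp only [hC]
    refine ⟨?_, ?_⟩
    · refine (normalForm B x).support.finite_toSet.subset fun v hv => ?_
      exact Finsupp.mem_support_iff.2 hv
    · conv_lhs => rw [eq_sum_normalForm B x]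
      rw [finsum_eq_sum_of_support_subset (s := (normalForm B x).support), Finsupp.sum]
      intro v hv
      refine Finsupp.mem_support_iff.2 fun h0 => ?_
      simp [h0] at hv

theorem isNormalFormOperators_normalOp : IsNormalFormOperators B (normalOp B) :=
  (isNormalFormOperators_iff B _).2 fun l k v => evalPoly_normalOp B l k v

theorem IsNormalFormOperators.unique
    {C : MultiIndex m → MultiIndex m → MultiIndex m → BiDiffOp n}
    (h : IsNormalFormOperators B C) : C = normalOp B := by
  rw [isNormalFormOperators_iff] at h
  funext l k v
  refine sub_eq_zero.1 (BiDiffOp.eq_zero_of_evalPoly_eq_zero _ fun f g => ?_)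
  have h1 := h l k v f g
  have h2 := evalPoly_normalOp B l k v f g
  rw [BiDiffOp.evalPoly] at h1 h2 ⊢
  rw [BiDiffOp.eval_sub, h1, h2, sub_self]

theorem term_mem_ncFiltration (f : MvPolynomial (Fin n) ℂ) (l : MultiIndex m) :
    normalOrder n f * orderedMonomial B l ∈ ncFiltration (FreeAlgebra ℂ (Fin n)) l.ord := by
  rw [mem_ncFiltration_iff B]
  intro k hk
  rw [normalForm_term, Finsupp.single_eq_of_ne]
  rintro rfl
  exact lt_irrefl _ hk

/-- Multiplicativity of the NC-filtration. It makes all sums over `λ` and `μ` for fixed `ν` finite.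
-/
theorem ord_add_ord_le_of_normalOp_ne_zero {l k v : MultiIndex m} (h : normalOp B l k v ≠ 0) :
    l.ord + k.ord ≤ v.ord := by
  by_contra hlt
  apply h
  ext1 αβ
  have h1 := (mem_ncFiltration_iff B (l.ord + k.ord) _).1 (mul_mem_ncFiltration
    (term_mem_ncFiltration B (MvPolynomial.monomial αβ.1 1) l)
    (term_mem_ncFiltration B (MvPolynomial.monomial αβ.2 1) k)) v (by omega)
  rw [normalOp_apply, prodForm_apply, h1]
  simp

end NormalOp

/-- Only the basic elements with at most `d` brackets can occur, with exponents at most `d`, and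
each `B_d` is finite. -/
theorem finite_ord_le (m : ℕ → ℕ) (d : ℕ) : {l : MultiIndex m | l.ord ≤ d}.Finite := by
  classical
  set g : MultiIndex m := ∑ e ∈ Finset.range d, ∑ i : Fin (m e), Finsupp.single (toLex ⟨e, i⟩) d
  refine (Set.finite_Iic g).subset fun l hl β => ?_
  by_cases hβ : l β = 0
  · rw [hβ]; exact Nat.zero_le _
  have h1 : l β * ((ofLex β).1 + 1) ≤ l.ord :=
    Finset.single_le_sum (f := fun β => l β * ((ofLex β).1 + 1)) (fun _ _ => Nat.zero_le _)
      (Finsupp.mem_support_iff.2 hβ)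
  have h2 : l β * ((ofLex β).1 + 1) ≤ d := h1.trans hl
  have h3 : l β ≤ d := le_trans (Nat.le_mul_of_pos_right _ (Nat.succ_pos _)) h2
  have h4 : (ofLex β).1 < d :=
    lt_of_lt_of_le (Nat.lt_succ_self _) (le_trans (Nat.le_mul_of_pos_left _ (by omega)) h2)
  refine h3.trans ?_
  have h5 : Finsupp.single β d ≤ g := by
    refine le_trans ?_ (Finset.single_le_sum (f := fun e => ∑ i : Fin (m e),
      Finsupp.single (toLex ⟨e, i⟩ : LieIndex m) d) (fun _ _ => zero_le)
        (Finset.mem_range.2 h4))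
    exact Finset.single_le_sum (f := fun i : Fin (m (ofLex β).1) =>
      Finsupp.single (toLex ⟨(ofLex β).1, i⟩ : LieIndex m) d) (fun _ _ => zero_le)
        (Finset.mem_univ (ofLex β).2)
  simpa using h5 β

theorem MultiIndex.ord_zero {m : ℕ → ℕ} : (0 : MultiIndex m).ord = 0 := by
  simp [MultiIndex.ord]

theorem MultiIndex.eq_zero_of_ord {m : ℕ → ℕ} {l : MultiIndex m} (h : l.ord = 0) : l = 0 := by
  ext β
  by_contra hβ
  have h1 : l β * ((ofLex β).1 + 1) ≤ l.ord :=
    Finset.single_le_sum (f := fun β => l β * ((ofLex β).1 + 1)) (fun _ _ => Nat.zero_le _)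
      (Finsupp.mem_support_iff.2 hβ)
  rw [h, Nat.le_zero, mul_eq_zero] at h1
  exact hβ (h1.resolve_right (Nat.succ_ne_zero _))

/-! ## The filtration of the completed free algebra -/

section Commutators

variable {n : ℕ} {m : ℕ → ℕ} (B : ∀ d, Module.Basis (Fin (m d)) ℂ (lieDegree n (d + 2)))

/-- The map `(u, v) ↦ ∑ [xᵢ, uᵢ] + ∑ vᵢⱼ [xᵢ, xⱼ]`. -/
def commMap {A : Type*} [Ring A] [Algebra ℂ A] (x : Fin n → A) :
    ((Fin n → A) × (Fin n → Fin n → A)) →ₗ[ℂ] A where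
  toFun p := ∑ i, (x i * p.1 i - p.1 i * x i) + ∑ i, ∑ j, p.2 i j * (x i * x j - x j * x i)
  map_add' p q := by
    simp only [Prod.fst_add, Prod.snd_add, Pi.add_apply, mul_add, add_mul, add_sub_add_comm,
      Finset.sum_add_distrib]
    abel
  map_smul' c p := by
    simp only [Prod.smul_fst, Prod.smul_snd, Pi.smul_apply, mul_smul_comm, smul_mul_assoc,
      ← smul_sub, ← Finset.smul_sum, ← smul_add, RingHom.id_apply]

/-- The sums `∑ [xᵢ, uᵢ] + ∑ vᵢⱼ [xᵢ, xⱼ]` with `uᵢ`, `vᵢⱼ` in the layer `F^e`. -/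
def commSpan (n e : ℕ) : Submodule ℂ (FreeAlgebra ℂ (Fin n)) where
  carrier := {y | ∃ (u : Fin n → FreeAlgebra ℂ (Fin n)) (v : Fin n → Fin n → FreeAlgebra ℂ (Fin n)),
    (∀ i, u i ∈ ncFiltration _ e) ∧ (∀ i j, v i j ∈ ncFiltration _ e) ∧
      y = commMap (FreeAlgebra.ι ℂ) (u, v)}
  zero_mem' := ⟨0, 0, fun _ => zero_mem _, fun _ _ => zero_mem _, (map_zero _).symm⟩
  add_mem' := by
    rintro _ _ ⟨u, v, hu, hv, rfl⟩ ⟨u', v', hu', hv', rfl⟩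
    exact ⟨u + u', v + v', fun i => add_mem (hu i) (hu' i), fun i j => add_mem (hv i j) (hv' i j),
      (map_add _ _ _).symm⟩
  smul_mem' := by
    rintro c _ ⟨u, v, hu, hv, rfl⟩
    refine ⟨c • u, c • v, fun i => ?_, fun i j => ?_, (map_smul _ _ _).symm⟩
    · rw [Pi.smul_apply, Algebra.smul_def]
      exact Ideal.mul_mem_left _ _ (hu i)
    · rw [Pi.smul_apply, Pi.smul_apply, Algebra.smul_def]
      exact Ideal.mul_mem_left _ _ (hv i j)

theorem commSpan_antitone (n : ℕ) : Antitone (commSpan n) := by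
  rintro e e' h _ ⟨u, v, hu, hv, rfl⟩
  exact ⟨u, v, fun i => ncFiltration_antitone h (hu i),
    fun i j => ncFiltration_antitone h (hv i j), rfl⟩

theorem lie_mem_commSpan (i : Fin n) {e : ℕ} {u : FreeAlgebra ℂ (Fin n)}
    (hu : u ∈ ncFiltration _ e) :
    FreeAlgebra.ι ℂ i * u - u * FreeAlgebra.ι ℂ i ∈ commSpan n e := by
  refine ⟨Pi.single i u, 0, fun j => ?_, fun _ _ => zero_mem _, ?_⟩
  · rcases eq_or_ne j i with rfl | h
    · rwa [Pi.single_eq_same]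
    · rw [Pi.single_eq_of_ne h]; exact zero_mem _
  · simp only [commMap, LinearMap.coe_mk, AddHom.coe_mk, Pi.zero_apply, zero_mul,
      Finset.sum_const_zero, add_zero]
    rw [Finset.sum_eq_single i]
    · simp
    · intro j _ h; simp [Pi.single_eq_of_ne h]
    · simp

theorem mul_lie_mem_commSpan (i j : Fin n) {e : ℕ} {u : FreeAlgebra ℂ (Fin n)}
    (hu : u ∈ ncFiltration _ e) :
    u * (FreeAlgebra.ι ℂ i * FreeAlgebra.ι ℂ j - FreeAlgebra.ι ℂ j * FreeAlgebra.ι ℂ i) ∈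
      commSpan n e := by
  refine ⟨0, Pi.single i (Pi.single j u), fun _ => zero_mem _, fun k l => ?_, ?_⟩
  · rcases eq_or_ne k i with rfl | h
    · rw [Pi.single_eq_same]
      rcases eq_or_ne l j with rfl | h
      · rwa [Pi.single_eq_same]
      · rw [Pi.single_eq_of_ne h]; exact zero_mem _
    · rw [Pi.single_eq_of_ne h]; exact zero_mem _
  · simp only [commMap, LinearMap.coe_mk, AddHom.coe_mk, Pi.zero_apply, zero_mul, mul_zero,
      sub_zero, Finset.sum_const_zero, zero_add]
    rw [Finset.sum_eq_single i, Finset.sum_eq_single j]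
    · simp
    · intro l _ h; simp [Pi.single_eq_of_ne h]
    · simp
    · intro k _ h; simp [Pi.single_eq_of_ne h]
    · simp

/-- The identity `g [xᵢ, v] = [xᵢ, g v] - [xᵢ, g] v` moves one bracket from the Lie element to `g`;
the recursion stops at `g [xᵢ, xⱼ]`. -/
theorem mul_lieToFree_mem_commSpan {k a : ℕ} {u : FreeLieAlgebra ℂ (Fin n)}
    (hu : u ∈ lieDegree n (k + 2)) {g : FreeAlgebra ℂ (Fin n)} (hg : g ∈ ncFiltration _ a) :
    g * lieToFree n u ∈ commSpan n (a + k) := by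
  suffices h : lieDegree n (k + 2) ≤
      (commSpan n (a + k)).comap (LinearMap.mulLeft ℂ g ∘ₗ lieToFree n) from h hu
  clear hu u
  induction k generalizing a g with
  | zero =>
    refine lieDegree_le_span.trans (Submodule.span_le.2 ?_)
    rintro _ ⟨i, v, hv, rfl⟩
    suffices h : lieDegree n 1 ≤ (commSpan n a).comap (LinearMap.mulLeft ℂ g ∘ₗ lieToFree n ∘ₗ
        (LieAlgebra.ad ℂ _ (FreeLieAlgebra.of ℂ i) : Module.End ℂ _)) from h hv
    rw [lieDegree_one]
    refine Submodule.span_le.2 ?_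
    rintro _ ⟨j, rfl⟩
    change g * lieToFree n ⁅FreeLieAlgebra.of ℂ i, FreeLieAlgebra.of ℂ j⁆ ∈ commSpan n a
    rw [lieToFree_lie, lieToFree_of, lieToFree_of]
    exact mul_lie_mem_commSpan i j hg
  | succ k ih =>
    refine lieDegree_le_span.trans (Submodule.span_le.2 ?_)
    rintro _ ⟨i, v, hv, rfl⟩
    change g * lieToFree n ⁅FreeLieAlgebra.of ℂ i, v⁆ ∈ commSpan n (a + (k + 1))
    rw [lieToFree_lie, lieToFree_of]
    have h1 := lie_mem_commSpan i (mul_mem_ncFiltration hg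
      (lieCentral_le_ncFiltration (lieToFree_mem_lieCentral hv)))
    have h2 : _ ∈ commSpan n _ := ih (lie_mem_ncFiltration_succ (FreeAlgebra.ι ℂ i) hg) hv
    change (_ - _) * lieToFree n v ∈ _ at h2
    rw [show a + 1 + k = a + (k + 1) by ring] at h2
    convert sub_mem h1 h2 using 1
    noncomm_ring

include B in
/-- The elements of `F^{e+1}` are combinations of commutators with the variables. -/
theorem ncFiltration_succ_le_commSpan {e : ℕ} {x : FreeAlgebra ℂ (Fin n)}
    (hx : x ∈ ncFiltration _ (e + 1)) : x ∈ commSpan n e := by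
  rw [mem_ncFiltration_iff_mem_weightSpan B,
    weightSpan_eq_span_sortedProd (pbwGen_lie_mem B)] at hx
  refine Submodule.span_le.2 ?_ hx
  rintro _ ⟨s, hs, rfl⟩
  change e + 1 ≤ (s.map pbwWeight).sum at hs
  have hsort := Multiset.pairwise_sort s (· ≤ ·)
  rw [← Multiset.sort_eq s (· ≤ ·)] at hs
  rw [sortedProd]
  rw [Multiset.map_coe, Multiset.sum_coe] at hs
  generalize s.sort (· ≤ ·) = l at hs hsort
  -- Look at the last factor of the ordered product. If it is a variable, so are all others and the
  -- weight is zero; otherwise it is a Lie element of degree at least two and the preceding lemma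
  -- applies.
  rcases List.eq_nil_or_concat l with rfl | ⟨l, j, rfl⟩
  · simp at hs
  rw [List.concat_eq_append] at hs hsort ⊢
  rw [List.map_append, List.sum_append, List.map_singleton, List.sum_singleton] at hs
  rw [List.map_append, List.prod_append, List.map_singleton, List.prod_singleton]
  have hl : (l.map (pbwGen B)).prod ∈ ncFiltration _ (l.map pbwWeight).sum := by
    rw [mem_ncFiltration_iff_mem_weightSpan B]
    exact Submodule.subset_span ⟨l, le_rfl, rfl⟩
  rcases j with i | β
  · exfalso
    rw [List.sum_eq_zero] at hs
    · exact absurd hs (Nat.not_succ_le_zero e)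
    · intro k hk
      obtain ⟨j, hj, rfl⟩ := List.mem_map.1 hk
      have hle := (List.pairwise_append.1 hsort).2.2 j hj _ (List.mem_singleton_self _)
      rcases j with i | β
      · rfl
      · exact absurd hle Sum.Lex.not_inr_le_inl
  · refine commSpan_antitone n ?_ (mul_lieToFree_mem_commSpan (B (ofLex β).1 (ofLex β).2).2 hl)
    change e + 1 ≤ _ + ((ofLex β).1 + 1) at hs
    omega

end Commutators

section Completion

variable {n : ℕ}

/-- The projection of the completed free algebra to `ℂ⟨x₁, …, xₙ⟩ / F^d`. -/
def freeNCProj (n d : ℕ) :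
    FreeNC n →ₐ[ℂ] FreeAlgebra ℂ (Fin n) ⧸ ncFiltration (FreeAlgebra ℂ (Fin n)) d :=
  (Pi.evalAlgHom ℂ (fun d : ℕ => FreeAlgebra ℂ (Fin n) ⧸ ncFiltration (FreeAlgebra ℂ (Fin n)) d)
      d).comp (ncCompletion (FreeAlgebra ℂ (Fin n))).val

theorem freeNCProj_toFreeNC (d : ℕ) (r : FreeAlgebra ℂ (Fin n)) :
    freeNCProj n d (toFreeNC n r) = Ideal.Quotient.mk _ r := rfl

theorem freeNC_ext {x y : FreeNC n} (h : ∀ d, freeNCProj n d x = freeNCProj n d y) : x = y :=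
  Subtype.ext (funext h)

/-- The sum of a series whose `k`-th term is in `F^k`. -/
def freeNCSeries (t : ℕ → FreeAlgebra ℂ (Fin n)) (ht : ∀ k, t k ∈ ncFiltration _ k) : FreeNC n :=
  ⟨fun d => Ideal.Quotient.mk _ (∑ k ∈ Finset.range d, t k), fun d => by
    change Ideal.Quotient.mk _ _ = Ideal.Quotient.mk _ _
    rw [Ideal.Quotient.eq, Finset.sum_range_succ, add_sub_cancel_left]
    exact ht d⟩

theorem freeNCProj_series (t : ℕ → FreeAlgebra ℂ (Fin n)) (ht : ∀ k, t k ∈ ncFiltration _ k)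
    (d : ℕ) : freeNCProj n d (freeNCSeries t ht) =
      Ideal.Quotient.mk _ (∑ k ∈ Finset.range d, t k) := rfl

theorem exists_reps (x : FreeNC n) : ∃ r : ℕ → FreeAlgebra ℂ (Fin n),
    (∀ d, freeNCProj n d x = Ideal.Quotient.mk _ (r d)) ∧
      ∀ d, r (d + 1) - r d ∈ ncFiltration _ d := by
  choose r hr using fun d => Ideal.Quotient.mk_surjective (freeNCProj n d x)
  refine ⟨r, fun d => (hr d).symm, fun d => ?_⟩
  rw [← Ideal.Quotient.eq, hr d]
  have h := x.2 d
  change Ideal.Quotient.factorₐ ℂ _ (freeNCProj n (d + 1) x) = freeNCProj n d x at h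
  rw [← h, ← hr (d + 1)]
  rfl

theorem freeNCProj_eq_zero_of_le {x : FreeNC n} {d e : ℕ} (hde : d ≤ e)
    (h : freeNCProj n e x = 0) : freeNCProj n d x = 0 := by
  induction hde with
  | refl => exact h
  | @step e _ ih =>
    refine ih ?_
    have h2 := x.2 e
    change Ideal.Quotient.factorₐ ℂ _ (freeNCProj n (e + 1) x) = freeNCProj n e x at h2
    rw [← h2, h, map_zero]

variable {m : ℕ → ℕ} (B : ∀ d, Module.Basis (Fin (m d)) ℂ (lieDegree n (d + 2)))

include B in
/-- The NC-filtration of the completed free algebra is closed. -/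
theorem mem_ncFiltration_freeNC_of_proj_eq_zero {e : ℕ} {x : FreeNC n}
    (hx : freeNCProj n e x = 0) : x ∈ ncFiltration (FreeNC n) e := by
  induction e generalizing x with
  | zero => exact mem_ncFiltration_zero x
  | succ e ih =>
    obtain ⟨r, hr, hr'⟩ := exists_reps x
    -- Representatives that vanish up to index `e + 1` write `x` as a series whose terms with index
    -- at most `e` are zero.
    set r' : ℕ → FreeAlgebra ℂ (Fin n) := fun d => if d ≤ e + 1 then 0 else r d with hr'_def
    have h1 : ∀ d, freeNCProj n d x = Ideal.Quotient.mk _ (r' d) := by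
      intro d
      by_cases hd : d ≤ e + 1
      · simp only [hr'_def, if_pos hd, map_zero]
        exact freeNCProj_eq_zero_of_le hd hx
      · simp only [hr'_def, if_neg hd, hr]
    set y : ℕ → FreeAlgebra ℂ (Fin n) := fun k => r' (k + 1) - r' k with hy_def
    have hy : ∀ k, y k ∈ ncFiltration _ k := by
      intro k
      rw [hy_def, ← Ideal.Quotient.eq, ← h1]
      have h := x.2 k
      change Ideal.Quotient.factorₐ ℂ _ (freeNCProj n (k + 1) x) = freeNCProj n k x at h
      rw [← h, h1]
      rfl
    have hy0 : ∀ k, k ≤ e → y k = 0 := fun k hk => by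
      simp [hy_def, hr'_def, hk, Nat.le_succ_of_le hk]
    have hsum : ∀ d, ∑ k ∈ Finset.range d, y k = r' d := fun d => by
      rw [Finset.sum_range_sub]
      simp [hr'_def]
    -- Every term is expressed by the same number `n + n²` of entries, which lie in `F^k`; these can
    -- therefore be summed over `k` entry by entry.
    have h2 : ∀ k, ∃ (u : Fin n → FreeAlgebra ℂ (Fin n))
        (v : Fin n → Fin n → FreeAlgebra ℂ (Fin n)),
        (∀ i, u i ∈ ncFiltration _ k) ∧ (∀ i j, v i j ∈ ncFiltration _ k) ∧
        (k < e → u = 0 ∧ v = 0) ∧ y (k + 1) = commMap (FreeAlgebra.ι ℂ) (u, v) := by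
      intro k
      by_cases hk : k < e
      · exact ⟨0, 0, fun _ => zero_mem _, fun _ _ => zero_mem _, fun _ => ⟨rfl, rfl⟩,
          (hy0 _ hk).trans (map_zero _).symm⟩
      · obtain ⟨u, v, hu, hv, h⟩ := ncFiltration_succ_le_commSpan B (hy (k + 1))
        exact ⟨u, v, hu, hv, fun h => absurd h hk, h⟩
    choose u v hu hv huv h3 using h2
    set X : Fin n → FreeNC n := fun i => toFreeNC n (FreeAlgebra.ι ℂ i)
    set U : Fin n → FreeNC n := fun i => freeNCSeries (fun k => u k i) fun k => hu k i
    set V : Fin n → Fin n → FreeNC n := fun i j =>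
      freeNCSeries (fun k => v k i j) fun k => hv k i j
    -- The summed entries start at index `e`, so the induction hypothesis puts them in `F^e` of the
    -- completion.
    have hU : ∀ i, U i ∈ ncFiltration (FreeNC n) e := fun i => ih (by
      rw [freeNCProj_series, Finset.sum_eq_zero, map_zero]
      intro k hk
      rw [(huv k (Finset.mem_range.1 hk)).1, Pi.zero_apply])
    have hV : ∀ i j, V i j ∈ ncFiltration (FreeNC n) e := fun i j => ih (by
      rw [freeNCProj_series, Finset.sum_eq_zero, map_zero]
      intro k hk
      rw [(huv k (Finset.mem_range.1 hk)).2, Pi.zero_apply, Pi.zero_apply])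
    have hxUV : x = commMap X (U, V) := by
      refine freeNC_ext fun d => ?_
      have h4 : freeNCProj n d (commMap X (U, V)) =
          Ideal.Quotient.mk _ (∑ k ∈ Finset.range d, y (k + 1)) := by
        have h5 : ∑ k ∈ Finset.range d, y (k + 1) = commMap (FreeAlgebra.ι ℂ)
            (∑ k ∈ Finset.range d, u k, ∑ k ∈ Finset.range d, v k) := by
          rw [Finset.sum_congr rfl fun k _ => h3 k, ← map_sum]
          exact congrArg _ (Prod.ext (by simp [Prod.fst_sum]) (by simp [Prod.snd_sum]))
        rw [h5]
        simp only [commMap, LinearMap.coe_mk, AddHom.coe_mk, map_add, map_sum, map_sub, map_mul,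
          X, U, V, freeNCProj_series, freeNCProj_toFreeNC, Finset.sum_apply]
      rw [h1, h4, Ideal.Quotient.eq, ← hsum, ← neg_sub, neg_mem_iff]
      have h6 : ∑ k ∈ Finset.range d, y (k + 1) - ∑ k ∈ Finset.range d, y k = y d := by
        rw [← Finset.sum_sub_distrib, Finset.sum_range_sub, hy0 0 (Nat.zero_le _), sub_zero]
      rw [h6]
      exact hy d
    rw [hxUV]
    refine add_mem (sum_mem fun i _ => lie_mem_ncFiltration_succ _ (hU i))
      (sum_mem fun i _ => sum_mem fun j _ => mul_mem_ncFiltration (hV i j)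
        (lie_mem_ncFiltration_one _ _))

theorem proj_eq_zero_of_mem_ncFiltration {e : ℕ} {x : FreeNC n}
    (hx : x ∈ ncFiltration (FreeNC n) e) : freeNCProj n e x = 0 := by
  obtain ⟨y, hy, h⟩ := exists_mem_ncFiltration_of_surjective
    (Ideal.Quotient.mkₐ ℂ (ncFiltration (FreeAlgebra ℂ (Fin n)) e)) Ideal.Quotient.mk_surjective
    (ncFiltration_map (freeNCProj n e) hx)
  rw [← h]
  exact Ideal.Quotient.eq_zero_iff_mem.2 hy

/-- The homomorphism from the free algebra to the truncations of its completion. -/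
def freeToTrunc (n d : ℕ) : FreeAlgebra ℂ (Fin n) →ₐ[ℂ] Trunc (FreeNC n) d :=
  (Trunc.mk (FreeNC n) d).comp (toFreeNC n)

theorem freeNCProj_eq_zero_of_trunc_eq_zero {d : ℕ} {x : FreeNC n} (h : Trunc.mk (FreeNC n) d x = 0) :
    freeNCProj n (d + 1) x = 0 :=
  proj_eq_zero_of_mem_ncFiltration (Ideal.Quotient.eq_zero_iff_mem.1 h)

theorem mem_ncFiltration_of_freeToTrunc_eq_zero {d : ℕ} {r : FreeAlgebra ℂ (Fin n)}
    (h : freeToTrunc n d r = 0) : r ∈ ncFiltration _ (d + 1) :=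
  Ideal.Quotient.eq_zero_iff_mem.1 (freeNCProj_eq_zero_of_trunc_eq_zero h)

include B in
-- By closedness, elements of the completion with equal image modulo `F^{d+1}` agree in its
-- truncation. Hence numerators and denominators in the stalks may be taken to be noncommutative
-- polynomials.
theorem freeToTrunc_surjective (d : ℕ) : Function.Surjective (freeToTrunc n d) := by
  intro x
  obtain ⟨x, rfl⟩ := Trunc.mk_surjective _ d x
  obtain ⟨r, hr⟩ := Ideal.Quotient.mk_surjective (freeNCProj n (d + 1) x)
  refine ⟨r, Eq.symm (sub_eq_zero.1 ?_)⟩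
  rw [freeToTrunc, AlgHom.comp_apply, ← map_sub]
  refine Ideal.Quotient.eq_zero_iff_mem.2 (mem_ncFiltration_freeNC_of_proj_eq_zero B ?_)
  rw [map_sub, freeNCProj_toFreeNC, hr, sub_self]

/-! ### The abelianization -/

/-- For `λ ≠ 0` the monomial `M_λ` contains a commutator and dies; for `λ = 0` the ordering is
forgotten. -/
theorem lift_X_eq_normalForm (r : FreeAlgebra ℂ (Fin n)) :
    FreeAlgebra.lift ℂ (MvPolynomial.X : Fin n → MvPolynomial (Fin n) ℂ) r =
      normalForm B r 0 := by
  set φ := FreeAlgebra.lift ℂ (MvPolynomial.X : Fin n → MvPolynomial (Fin n) ℂ) with hφ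
  suffices h : φ.toLinearMap = Finsupp.lapply 0 ∘ₗ (normalForm B).toLinearMap from
    LinearMap.congr_fun h r
  refine (pbwBasis B).ext fun x => ?_
  obtain ⟨l, a⟩ := x
  rw [pbwBasis_apply]
  simp only [LinearMap.comp_apply, LinearEquiv.coe_coe, normalForm_term, Finsupp.lapply_apply,
    AlgHom.toLinearMap_apply]
  rcases eq_or_ne l 0 with rfl | hl
  · rw [Finsupp.single_eq_same, map_mul, normalOrder_monomial, map_list_prod, List.map_ofFn,
      List.prod_ofFn]
    simp [orderedMonomial, hφ, MvPolynomial.monomial_eq, Finsupp.prod_fintype]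
  · rw [Finsupp.single_eq_of_ne hl.symm]
    refine ncFiltration_succ_map_eq_zero φ 0 _ (ncFiltration_antitone ?_
      (term_mem_ncFiltration B _ l))
    exact Nat.one_le_iff_ne_zero.2 fun h => hl (MultiIndex.eq_zero_of_ord h)

theorem abMap_surjective : Function.Surjective (abMap n) := by
  have h : Function.Surjective
      (FreeAlgebra.lift ℂ (MvPolynomial.X : Fin n → MvPolynomial (Fin n) ℂ)) := by
    rw [← AlgHom.range_eq_top, eq_top_iff, ← MvPolynomial.adjoin_range_X]
    refine Algebra.adjoin_le ?_
    rintro _ ⟨i, rfl⟩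
    exact ⟨FreeAlgebra.ι ℂ i, by simp⟩
  intro f
  obtain ⟨r, rfl⟩ := h f
  exact ⟨toFreeNC n r, rfl⟩

include B in
theorem abMap_eq_zero_iff (x : FreeNC n) :
    abMap n x = 0 ↔ x ∈ ncFiltration (FreeNC n) 1 := by
  refine ⟨fun h => mem_ncFiltration_freeNC_of_proj_eq_zero B ?_,
    ncFiltration_succ_map_eq_zero (abMap n) 0 x⟩
  obtain ⟨r, hr⟩ := Ideal.Quotient.mk_surjective (freeNCProj n 1 x)
  have h2 : FreeAlgebra.lift ℂ (MvPolynomial.X : Fin n → MvPolynomial (Fin n) ℂ) r = 0 := by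
    rw [← h]
    exact congrArg (Ideal.Quotient.liftₐ (ncFiltration (FreeAlgebra ℂ (Fin n)) 1)
      (FreeAlgebra.lift ℂ (MvPolynomial.X : Fin n → MvPolynomial (Fin n) ℂ))
      (ncFiltration_succ_map_eq_zero _ 0)) hr
  rw [← hr]
  refine Ideal.Quotient.eq_zero_iff_mem.2 ((mem_ncFiltration_iff B 1 r).2 fun l hl => ?_)
  rw [MultiIndex.eq_zero_of_ord (l := l) (by omega), ← lift_X_eq_normalForm, h2]

end Completion

/-! ## Differential operators on rational functions -/

section DiffOps

variable {K : Type*} [CommRing K] [Algebra ℂ K]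

/-- The operators of order less than `r` in the sense of Grothendieck. -/
def IsDiffOpOfOrder : ℕ → Module.End ℂ K → Prop
  | 0, P => P = 0
  | r + 1, P => ∀ k : K, IsDiffOpOfOrder r (P * LinearMap.mulLeft ℂ k - LinearMap.mulLeft ℂ k * P)

theorem IsDiffOpOfOrder.zero (r : ℕ) : IsDiffOpOfOrder r (0 : Module.End ℂ K) := by
  induction r with
  | zero => rfl
  | succ r ih => intro k; rwa [zero_mul, mul_zero, sub_zero]

theorem IsDiffOpOfOrder.succ {r : ℕ} {P : Module.End ℂ K} (h : IsDiffOpOfOrder r P) :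
    IsDiffOpOfOrder (r + 1) P := by
  induction r generalizing P with
  | zero => cases h; exact .zero 1
  | succ r ih => exact fun k => ih (h k)

theorem IsDiffOpOfOrder.mono {r r' : ℕ} (hr : r ≤ r') {P : Module.End ℂ K}
    (h : IsDiffOpOfOrder r P) : IsDiffOpOfOrder r' P := by
  induction hr with
  | refl => exact h
  | step _ ih => exact ih.succ

theorem IsDiffOpOfOrder.add {r : ℕ} {P Q : Module.End ℂ K} (hP : IsDiffOpOfOrder r P)
    (hQ : IsDiffOpOfOrder r Q) : IsDiffOpOfOrder r (P + Q) := by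
  induction r generalizing P Q with
  | zero => cases hP; cases hQ; exact add_zero _
  | succ r ih =>
    intro k
    convert ih (hP k) (hQ k) using 1
    noncomm_ring

theorem IsDiffOpOfOrder.mul {r r' : ℕ} {P Q : Module.End ℂ K} (hP : IsDiffOpOfOrder r P)
    (hQ : IsDiffOpOfOrder r' Q) : IsDiffOpOfOrder (r + r') (P * Q) := by
  induction hs : r + r' generalizing r r' P Q with
  | zero =>
    obtain ⟨rfl, rfl⟩ : r = 0 ∧ r' = 0 := by omega
    cases hP
    exact zero_mul _
  | succ d ih =>
    rcases r with _ | r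
    · cases hP
      rw [zero_mul]
      exact .zero _
    rcases r' with _ | r'
    · cases hQ
      rw [mul_zero]
      exact .zero _
    intro k
    convert (ih hP (hQ k) (by omega)).add (ih (hP k) hQ (by omega)) using 1
    rw [mul_sub, sub_mul, mul_assoc, mul_assoc, mul_assoc, sub_add_sub_cancel]

/-- A multiplication operator has order zero. -/
theorem isDiffOpOfOrder_mulLeft (k : K) : IsDiffOpOfOrder 1 (LinearMap.mulLeft ℂ k) := by
  intro j
  refine LinearMap.ext fun x => ?_
  simp [mul_left_comm]

/-- A derivation has order one. -/
theorem isDiffOpOfOrder_derivation (D : Derivation ℂ K K) :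
    IsDiffOpOfOrder 2 ((D : K →ₗ[ℂ] K) : Module.End ℂ K) := by
  intro k
  convert isDiffOpOfOrder_mulLeft (D k) using 1
  refine LinearMap.ext fun x => ?_
  simp [mul_comm]

variable (K) in
/-- The algebra of differential operators on a commutative algebra. -/
def diffOps : Subalgebra ℂ (Module.End ℂ K) where
  carrier := {P | ∃ r, IsDiffOpOfOrder r P}
  mul_mem' := fun ⟨r, hP⟩ ⟨r', hQ⟩ => ⟨r + r', hP.mul hQ⟩
  add_mem' := fun ⟨r, hP⟩ ⟨r', hQ⟩ =>
    ⟨max r r', (hP.mono (le_max_left _ _)).add (hQ.mono (le_max_right _ _))⟩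
  algebraMap_mem' c := ⟨1, by
    convert isDiffOpOfOrder_mulLeft (algebraMap ℂ K c) using 1
    refine LinearMap.ext fun x => ?_
    simp [Algebra.smul_def]⟩

theorem mulLeft_mem_diffOps (k : K) : LinearMap.mulLeft ℂ k ∈ diffOps K :=
  ⟨1, isDiffOpOfOrder_mulLeft k⟩

theorem iterDeriv_mem_diffOps {n : ℕ} (D : Fin n → Derivation ℂ K K) (a : Fin n →₀ ℕ) :
    iterDeriv D a ∈ diffOps K := by
  refine Subalgebra.list_prod_mem _ fun x hx => ?_
  obtain ⟨j, rfl⟩ := (List.mem_ofFn' _ _).1 hx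
  exact pow_mem (show _ ∈ diffOps K from ⟨2, isDiffOpOfOrder_derivation (D j)⟩) _

theorem BiDiffOp.bilin_mem_diffOps {n : ℕ} (e : MvPolynomial (Fin n) ℂ →ₐ[ℂ] K)
    (D : Fin n → Derivation ℂ K K) (C : BiDiffOp n) (f : K) : C.bilin e D f ∈ diffOps K := by
  rw [bilin, Finsupp.sum, LinearMap.sum_apply]
  refine sum_mem fun x _ => ?_
  convert mul_mem (mulLeft_mem_diffOps (e (C x)))
    (mul_mem (mulLeft_mem_diffOps (iterDeriv D x.1 f)) (iterDeriv_mem_diffOps D x.2)) using 1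
  rfl

theorem BiDiffOp.bilin_flip_mem_diffOps {n : ℕ} (e : MvPolynomial (Fin n) ℂ →ₐ[ℂ] K)
    (D : Fin n → Derivation ℂ K K) (C : BiDiffOp n) (g : K) :
    (C.bilin e D).flip g ∈ diffOps K := by
  have h : (C.bilin e D).flip g = ∑ x ∈ C.support, LinearMap.mulLeft ℂ (e (C x)) *
      (LinearMap.mulLeft ℂ (iterDeriv D x.2 g) * iterDeriv D x.1) := by
    refine LinearMap.ext fun f => ?_
    simp only [bilin, Finsupp.sum, LinearMap.flip_apply, LinearMap.sum_apply]
    refine Finset.sum_congr rfl fun x _ => ?_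
    simp [mul_comm]
  rw [h]
  exact sum_mem fun x _ => mul_mem (mulLeft_mem_diffOps _)
    (mul_mem (mulLeft_mem_diffOps _) (iterDeriv_mem_diffOps D _))

/-- A differential operator on a field of fractions vanishes if it vanishes on the subring. -/
theorem eq_zero_of_mem_diffOps {A F : Type*} [CommRing A] [IsDomain A] [Field F] [Algebra ℂ F]
    [Algebra A F] [IsFractionRing A F] {P : Module.End ℂ F} (hP : P ∈ diffOps F)
    (h : ∀ a : A, P (algebraMap A F a) = 0) : P = 0 := by
  obtain ⟨r, hr⟩ := hP
  induction r generalizing P with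
  | zero => exact hr
  | succ r ih =>
    refine LinearMap.ext fun x => ?_
    obtain ⟨a, s, hs, rfl⟩ := IsFractionRing.div_surjective A x
    have hs' : algebraMap A F s ≠ 0 := by simpa using nonZeroDivisors.ne_zero hs
    -- The commutator of `P` with multiplication by `s` has lower order and kills `A`, hence is
    -- zero. Applied to `a / s` it gives `P a = s P (a / s)`, and `P a = 0`.
    have h1 := LinearMap.congr_fun (ih (fun b => by
      rw [LinearMap.sub_apply, Module.End.mul_apply, Module.End.mul_apply, LinearMap.mulLeft_apply,
        LinearMap.mulLeft_apply, ← map_mul, h, h, mul_zero, sub_zero]) (hr (algebraMap A F s))) (algebraMap A F a / algebraMap A F s)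
    simp only [LinearMap.sub_apply, Module.End.mul_apply, LinearMap.mulLeft_apply,
      LinearMap.zero_apply] at h1 ⊢
    rw [mul_div_cancel₀ _ hs', h, zero_sub, neg_eq_zero, mul_eq_zero] at h1
    exact h1.resolve_left hs'

end DiffOps

/-! ## The ring of formal normal series over the rational functions -/

section SeriesRing

variable {n : ℕ} {m : ℕ → ℕ} (B : ∀ d, Module.Basis (Fin (m d)) ℂ (lieDegree n (d + 2)))

theorem ratEnd_ext {P Q : Module.End ℂ (RatFun n)} (hP : P ∈ diffOps (RatFun n))
    (hQ : Q ∈ diffOps (RatFun n))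
    (h : ∀ a : MvPolynomial (Fin n) ℂ, P (algebraMap _ _ a) = Q (algebraMap _ _ a)) : P = Q :=
  sub_eq_zero.1 (eq_zero_of_mem_diffOps (A := MvPolynomial (Fin n) ℂ) (sub_mem hP hQ) fun a => by
    rw [LinearMap.sub_apply, h, sub_self])

/-- The operator `C^ν_{λμ}` on rational functions. -/
def structMap (l k v : MultiIndex m) : RatFun n →ₗ[ℂ] RatFun n →ₗ[ℂ] RatFun n :=
  (normalOp B l k v).bilin (IsScalarTower.toAlgHom ℂ (MvPolynomial (Fin n) ℂ) (RatFun n)) ratDeriv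

theorem structMap_mem (l k v : MultiIndex m) (f : RatFun n) :
    structMap B l k v f ∈ diffOps (RatFun n) :=
  BiDiffOp.bilin_mem_diffOps _ _ _ _

theorem structMap_flip_mem (l k v : MultiIndex m) (g : RatFun n) :
    (structMap B l k v).flip g ∈ diffOps (RatFun n) :=
  BiDiffOp.bilin_flip_mem_diffOps _ _ _ _

theorem structMap_algebraMap (l k v : MultiIndex m) (f g : MvPolynomial (Fin n) ℂ) :
    structMap B l k v (algebraMap _ _ f) (algebraMap _ _ g) =
      algebraMap _ _ (prodForm B l k v f g) := by
  rw [structMap, ← BiDiffOp.eval_eq_bilin, ← evalPoly_normalOp]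
  exact (BiDiffOp.eval_map _ _ ratDeriv _
    (IsScalarTower.toAlgHom ℂ (MvPolynomial (Fin n) ℂ) (RatFun n))
    (fun i a => (ratDerivFun_algebraMap i a).symm) (fun p => rfl) _ f g).symm

theorem structMap_eq_zero {l k v : MultiIndex m} (h : ¬ l.ord + k.ord ≤ v.ord) :
    structMap B l k v = 0 := by
  rw [structMap, not_imp_comm.1 (ord_add_ord_le_of_normalOp_ne_zero B) h]
  exact Finsupp.sum_zero_index

/-- Two bilinear differential operators agree if they agree on polynomials. -/
theorem structMap_ext {l k v : MultiIndex m} {T : RatFun n →ₗ[ℂ] RatFun n →ₗ[ℂ] RatFun n}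
    (h1 : ∀ f, T f ∈ diffOps (RatFun n)) (h2 : ∀ g, T.flip g ∈ diffOps (RatFun n))
    (h : ∀ f g, algebraMap _ _ (prodForm B l k v f g) =
      T (algebraMap _ _ f) (algebraMap _ _ g)) : structMap B l k v = T := by
  refine LinearMap.ext fun f => ratEnd_ext (structMap_mem B l k v f) (h1 f) fun g => ?_
  exact LinearMap.congr_fun (ratEnd_ext (structMap_flip_mem B l k v _) (h2 (algebraMap _ _ g))
    fun f => by
      rw [LinearMap.flip_apply, LinearMap.flip_apply, structMap_algebraMap, h]) f

variable (m) in
/-- The multi-indices of order at most `d`. -/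
def ordLE (d : ℕ) : Finset (MultiIndex m) := (finite_ord_le m d).toFinset

theorem mem_ordLE {d : ℕ} {l : MultiIndex m} : l ∈ ordLE m d ↔ l.ord ≤ d := by
  simp [ordLE]

theorem prodForm_eq_zero {l k v : MultiIndex m} (h : ¬ l.ord + k.ord ≤ v.ord) :
    prodForm B l k v = 0 := by
  refine LinearMap.ext fun f => LinearMap.ext fun g => ?_
  rw [← evalPoly_normalOp, not_imp_comm.1 (ord_add_ord_le_of_normalOp_ne_zero B) h]
  simp [BiDiffOp.evalPoly, BiDiffOp.eval]

theorem normalOrder_one : normalOrder n 1 = 1 := by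
  rw [← MvPolynomial.C_1, ← MvPolynomial.monomial_zero', normalOrder_monomial]
  simp [List.ofFn_const]

theorem orderedMonomial_zero : orderedMonomial B 0 = 1 := by
  simp [orderedMonomial]

theorem term_one_zero : normalOrder n 1 * orderedMonomial B 0 = 1 := by
  rw [normalOrder_one, orderedMonomial_zero, mul_one]

/-- Bilinearity reduces this to single terms. Any cutoff `d ≥ ord v` works, because terms of larger
order contribute nothing at `v`. -/
theorem normalForm_mul (x y : FreeAlgebra ℂ (Fin n)) {v : MultiIndex m} {d : ℕ} (hd : v.ord ≤ d) :
    normalForm B (x * y) v = ∑ l ∈ ordLE m d, ∑ k ∈ ordLE m d,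
      prodForm B l k v (normalForm B x l) (normalForm B y k) := by
  induction x using normalForm_induction B with
  | zero => simp
  | add x x' hx hx' => simp [add_mul, hx, hx', Finset.sum_add_distrib]
  | term f l' =>
    induction y using normalForm_induction B with
    | zero => simp
    | add y y' hy hy' => simp only [mul_add, map_add, Finsupp.add_apply, hy, hy',
        Finset.sum_add_distrib]
    | term g k' =>
      rw [← prodForm_apply, normalForm_term, normalForm_term]
      by_cases h : l'.ord + k'.ord ≤ v.ord
      · rw [Finset.sum_eq_single_of_mem l' (mem_ordLE.2 (by omega)),
          Finset.sum_eq_single_of_mem k' (mem_ordLE.2 (by omega)), Finsupp.single_eq_same,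
          Finsupp.single_eq_same]
        · intro k _ hk
          rw [Finsupp.single_eq_of_ne hk, map_zero]
        · intro l _ hl
          rw [Finsupp.single_eq_of_ne hl]
          simp
      · rw [prodForm_eq_zero B h]
        symm
        refine Finset.sum_eq_zero fun l _ => Finset.sum_eq_zero fun k _ => ?_
        rcases eq_or_ne l l' with rfl | hl
        · rcases eq_or_ne k k' with rfl | hk
          · simp [prodForm_eq_zero B h]
          · rw [Finsupp.single_eq_of_ne hk, map_zero]
        · rw [Finsupp.single_eq_of_ne hl]
          simp

theorem prodForm_assoc (l k r v : MultiIndex m) (f g h : MvPolynomial (Fin n) ℂ) :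
    ∑ u ∈ ordLE m v.ord, prodForm B u r v (prodForm B l k u f g) h =
      ∑ u ∈ ordLE m v.ord, prodForm B l u v f (prodForm B k r u g h) := by
  have e1 := normalForm_mul B (normalOrder n f * orderedMonomial B l *
    (normalOrder n g * orderedMonomial B k)) (normalOrder n h * orderedMonomial B r) (le_refl v.ord)
  have e2 := normalForm_mul B (normalOrder n f * orderedMonomial B l)
    (normalOrder n g * orderedMonomial B k * (normalOrder n h * orderedMonomial B r))
    (le_refl v.ord)
  rw [mul_assoc] at e1
  rw [e1] at e2
  -- If `l` or `r` exceeds the cutoff, both sums vanish for reasons of order.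
  by_cases hr : r.ord ≤ v.ord ∧ l.ord ≤ v.ord
  · simp only [normalForm_term, ← prodForm_apply] at e2
    have h1 : ∀ u, ∑ j ∈ ordLE m v.ord,
        prodForm B u j v (prodForm B l k u f g) (Finsupp.single r h j) =
        prodForm B u r v (prodForm B l k u f g) h := fun u => by
      rw [Finset.sum_eq_single_of_mem r (mem_ordLE.2 hr.1), Finsupp.single_eq_same]
      intro j _ hj
      rw [Finsupp.single_eq_of_ne hj, map_zero]
    simp only [h1] at e2
    rw [e2, Finset.sum_eq_single_of_mem l (mem_ordLE.2 hr.2), Finsupp.single_eq_same]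
    intro j _ hj
    rw [Finsupp.single_eq_of_ne hj]
    simp
  · refine (Finset.sum_eq_zero fun u _ => ?_).trans (Finset.sum_eq_zero fun u _ => ?_).symm
    · by_cases hu : r.ord ≤ v.ord
      · by_cases hu' : u.ord ≤ v.ord
        · rw [prodForm_eq_zero B (v := u) (by omega)]
          simp
        · rw [prodForm_eq_zero B (v := v) (by omega)]
          simp
      · rw [prodForm_eq_zero B (v := v) (by omega)]
        simp
    · by_cases hu : l.ord ≤ v.ord
      · by_cases hu' : u.ord ≤ v.ord
        · rw [prodForm_eq_zero B (v := u) (by omega)]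
          simp
        · rw [prodForm_eq_zero B (v := v) (by omega)]
          simp
      · rw [prodForm_eq_zero B (v := v) (by omega)]
        simp

/-- With two arguments fixed, both sides are differential operators in the third. The identity
passes from polynomials to rational functions in one argument at a time. -/
theorem structMap_assoc (l k r v : MultiIndex m) (f g h : RatFun n) :
    ∑ u ∈ ordLE m v.ord, structMap B u r v (structMap B l k u f g) h =
      ∑ u ∈ ordLE m v.ord, structMap B l u v f (structMap B k r u g h) := by
  have e1 : ∀ f g h : MvPolynomial (Fin n) ℂ,
      ∑ u ∈ ordLE m v.ord, structMap B u r v (structMap B l k u (algebraMap _ _ f)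
        (algebraMap _ _ g)) (algebraMap _ _ h) =
      ∑ u ∈ ordLE m v.ord, structMap B l u v (algebraMap _ _ f)
        (structMap B k r u (algebraMap _ _ g) (algebraMap _ _ h)) := fun f g h => by
    simp only [structMap_algebraMap, ← map_sum, prodForm_assoc B l k r v f g h]
  have e2 : ∀ (f : RatFun n) (g h : MvPolynomial (Fin n) ℂ),
      ∑ u ∈ ordLE m v.ord, structMap B u r v (structMap B l k u f
        (algebraMap _ _ g)) (algebraMap _ _ h) =
      ∑ u ∈ ordLE m v.ord, structMap B l u v f
        (structMap B k r u (algebraMap _ _ g) (algebraMap _ _ h)) := fun f g h => by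
    have := ratEnd_ext
      (P := ∑ u ∈ ordLE m v.ord, (structMap B u r v).flip (algebraMap _ _ h) *
        (structMap B l k u).flip (algebraMap _ _ g))
      (Q := ∑ u ∈ ordLE m v.ord, (structMap B l u v).flip
        (structMap B k r u (algebraMap _ _ g) (algebraMap _ _ h)))
      (sum_mem fun u _ => mul_mem (structMap_flip_mem B _ _ _ _) (structMap_flip_mem B _ _ _ _))
      (sum_mem fun u _ => structMap_flip_mem B _ _ _ _)
      (fun a => by simpa [LinearMap.sum_apply] using e1 a g h)
    simpa [LinearMap.sum_apply] using LinearMap.congr_fun this f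
  have e3 : ∀ (f g : RatFun n) (h : MvPolynomial (Fin n) ℂ),
      ∑ u ∈ ordLE m v.ord, structMap B u r v (structMap B l k u f g) (algebraMap _ _ h) =
      ∑ u ∈ ordLE m v.ord, structMap B l u v f
        (structMap B k r u g (algebraMap _ _ h)) := fun f g h => by
    have := ratEnd_ext
      (P := ∑ u ∈ ordLE m v.ord, (structMap B u r v).flip (algebraMap _ _ h) *
        structMap B l k u f)
      (Q := ∑ u ∈ ordLE m v.ord, structMap B l u v f *
        (structMap B k r u).flip (algebraMap _ _ h))
      (sum_mem fun u _ => mul_mem (structMap_flip_mem B _ _ _ _) (structMap_mem B _ _ _ _))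
      (sum_mem fun u _ => mul_mem (structMap_mem B _ _ _ _) (structMap_flip_mem B _ _ _ _))
      (fun a => by simpa [LinearMap.sum_apply] using e2 f a h)
    simpa [LinearMap.sum_apply] using LinearMap.congr_fun this g
  have := ratEnd_ext
    (P := ∑ u ∈ ordLE m v.ord, structMap B u r v (structMap B l k u f g))
    (Q := ∑ u ∈ ordLE m v.ord, structMap B l u v f * structMap B k r u g)
    (sum_mem fun u _ => structMap_mem B _ _ _ _)
    (sum_mem fun u _ => mul_mem (structMap_mem B _ _ _ _) (structMap_mem B _ _ _ _))
    (fun a => by simpa [LinearMap.sum_apply] using e3 f g a)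
  simpa [LinearMap.sum_apply] using LinearMap.congr_fun this h

/-- Formal series `∑_λ ⟦f_λ⟧ M_λ` with rational functions `f_λ`. -/
def RatSeries (_ : ∀ d, Module.Basis (Fin (m d)) ℂ (lieDegree n (d + 2))) : Type :=
  MultiIndex m → RatFun n

instance : AddCommGroup (RatSeries B) := inferInstanceAs (AddCommGroup (MultiIndex m → RatFun n))

instance : Module ℂ (RatSeries B) := inferInstanceAs (Module ℂ (MultiIndex m → RatFun n))

variable {B} in
/-- The coefficients of a formal series. -/
def RatSeries.coeff (l : MultiIndex m) : RatSeries B →ₗ[ℂ] RatFun n :=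
  LinearMap.proj (R := ℂ) (φ := fun _ : MultiIndex m => RatFun n) l

/-- The series with the single term `⟦f⟧ M_λ`. -/
def RatSeries.single (l : MultiIndex m) (f : RatFun n) : RatSeries B :=
  open Classical in (Pi.single l f : MultiIndex m → RatFun n)

namespace RatSeries

variable {B}

@[ext]
theorem ext {s t : RatSeries B} (h : ∀ l, coeff l s = coeff l t) : s = t := funext h

theorem coeff_single (l k : MultiIndex m) (f : RatFun n) [Decidable (k = l)] :
    coeff k (single B l f) = if k = l then f else 0 := by
  classical
  change (Pi.single l f : MultiIndex m → RatFun n) k = _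
  rw [Pi.single_apply]
  congr

theorem coeff_single_same (l : MultiIndex m) (f : RatFun n) : coeff l (single B l f) = f := by
  classical
  rw [coeff_single, if_pos rfl]

theorem coeff_single_ne {l k : MultiIndex m} (h : k ≠ l) (f : RatFun n) :
    coeff k (single B l f) = 0 := by
  classical
  rw [coeff_single, if_neg h]

instance : Mul (RatSeries B) := ⟨fun s t => fun v =>
  ∑ l ∈ ordLE m v.ord, ∑ k ∈ ordLE m v.ord, structMap B l k v (coeff l s) (coeff k t)⟩

instance : One (RatSeries B) := ⟨single B 0 1⟩

theorem one_def : (1 : RatSeries B) = single B 0 1 := rfl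

theorem coeff_mul' (s t : RatSeries B) (v : MultiIndex m) : coeff v (s * t) =
    ∑ l ∈ ordLE m v.ord, ∑ k ∈ ordLE m v.ord, structMap B l k v (coeff l s) (coeff k t) := rfl

/-- A common cutoff for all coefficients of bounded order, needed to expand triple products. -/
theorem coeff_mul (s t : RatSeries B) {v : MultiIndex m} {d : ℕ} (hd : v.ord ≤ d) :
    coeff v (s * t) =
    ∑ l ∈ ordLE m d, ∑ k ∈ ordLE m d, structMap B l k v (coeff l s) (coeff k t) := by
  have hT : ordLE m v.ord ⊆ ordLE m d := fun l hl => mem_ordLE.2 ((mem_ordLE.1 hl).trans hd)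
  rw [coeff_mul']
  refine (Finset.sum_congr rfl fun l _ => Finset.sum_subset hT fun k _ hk => ?_).trans
    (Finset.sum_subset hT fun l _ hl => Finset.sum_eq_zero fun k _ => ?_)
  · rw [mem_ordLE] at hk
    rw [structMap_eq_zero B (by omega)]
    simp
  · rw [mem_ordLE] at hl
    rw [structMap_eq_zero B (by omega)]
    simp

theorem structMap_zero_left (k v : MultiIndex m) (g : RatFun n) [Decidable (v = k)] :
    structMap B 0 k v 1 g = if v = k then g else 0 := by
  have h := ratEnd_ext (P := structMap B 0 k v 1) (Q := if v = k then 1 else 0)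
    (structMap_mem B _ _ _ _) (by split_ifs; exacts [one_mem _, zero_mem _]) fun g => by
      rw [← map_one (algebraMap (MvPolynomial (Fin n) ℂ) (RatFun n)), structMap_algebraMap,
        prodForm_apply, term_one_zero, one_mul, normalForm_term]
      rcases eq_or_ne v k with rfl | h
      · simp
      · simp [h, Finsupp.single_eq_of_ne h]
  rw [h]
  split_ifs <;> rfl

theorem structMap_zero_right (l v : MultiIndex m) (f : RatFun n) [Decidable (v = l)] :
    structMap B l 0 v f 1 = if v = l then f else 0 := by
  have h := ratEnd_ext (P := (structMap B l 0 v).flip 1) (Q := if v = l then 1 else 0)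
    (structMap_flip_mem B _ _ _ _) (by split_ifs; exacts [one_mem _, zero_mem _]) fun f => by
      rw [LinearMap.flip_apply,
        ← map_one (algebraMap (MvPolynomial (Fin n) ℂ) (RatFun n)), structMap_algebraMap,
        prodForm_apply, term_one_zero, mul_one, normalForm_term]
      rcases eq_or_ne v l with rfl | h
      · simp
      · simp [h, Finsupp.single_eq_of_ne h]
  rw [← LinearMap.flip_apply, h]
  split_ifs <;> rfl

instance : Ring (RatSeries B) where
  __ := instAddCommGroupRatSeries B
  left_distrib s t u := by
    ext v
    simp only [map_add, coeff_mul', Finset.sum_add_distrib]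
  right_distrib s t u := by
    ext v
    simp only [map_add, coeff_mul', Finset.sum_add_distrib, LinearMap.add_apply]
  zero_mul s := by
    ext v
    simp [coeff_mul']
  mul_zero s := by
    ext v
    simp [coeff_mul']
  one_mul s := by
    classical
    ext v
    rw [coeff_mul', Finset.sum_eq_single_of_mem 0 (mem_ordLE.2 (by simp [MultiIndex.ord_zero]))]
    · simp only [one_def, coeff_single_same, structMap_zero_left]
      rw [Finset.sum_ite_eq, if_pos (mem_ordLE.2 le_rfl)]
    · intro l _ hl
      simp [one_def, coeff_single_ne hl]
  mul_one s := by
    classical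
    ext v
    rw [coeff_mul']
    refine (Finset.sum_congr rfl fun l _ => Finset.sum_eq_single_of_mem 0
      (mem_ordLE.2 (by simp [MultiIndex.ord_zero])) fun k _ hk => ?_).trans ?_
    · simp [one_def, coeff_single_ne hk]
    · simp only [one_def, coeff_single_same, structMap_zero_right]
      rw [Finset.sum_ite_eq, if_pos (mem_ordLE.2 le_rfl)]
  mul_assoc s t u := by
    ext v
    have h1 : coeff v (s * t * u) = ∑ l ∈ ordLE m v.ord, ∑ k ∈ ordLE m v.ord,
        ∑ r ∈ ordLE m v.ord, ∑ j ∈ ordLE m v.ord,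
          structMap B j r v (structMap B l k j (coeff l s) (coeff k t)) (coeff r u) := by
      rw [coeff_mul', Finset.sum_comm]
      refine (Finset.sum_congr rfl fun r _ => ?_).trans (Finset.sum_comm.trans
        (Finset.sum_congr rfl fun l _ => Finset.sum_comm))
      rw [Finset.sum_congr rfl fun j hj => by rw [coeff_mul s t (mem_ordLE.1 hj)]]
      simp only [map_sum, LinearMap.sum_apply]
      rw [Finset.sum_comm]
      exact Finset.sum_congr rfl fun l _ => Finset.sum_comm
    have h2 : coeff v (s * (t * u)) = ∑ l ∈ ordLE m v.ord, ∑ k ∈ ordLE m v.ord,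
        ∑ r ∈ ordLE m v.ord, ∑ j ∈ ordLE m v.ord,
          structMap B l j v (coeff l s) (structMap B k r j (coeff k t) (coeff r u)) := by
      rw [coeff_mul']
      refine Finset.sum_congr rfl fun l _ => ?_
      rw [Finset.sum_congr rfl fun j hj => by rw [coeff_mul t u (mem_ordLE.1 hj)]]
      simp only [map_sum]
      rw [Finset.sum_comm]
      exact Finset.sum_congr rfl fun k _ => Finset.sum_comm
    rw [h1, h2]
    simp only [structMap_assoc]

end RatSeries

end SeriesRing

open TopologicalSpace (Opens)

/-! ### Noncommutative polynomials as formal series, and the filtration by order -/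

namespace RatSeries

variable {n : ℕ} {m : ℕ → ℕ} {B : ∀ d, Module.Basis (Fin (m d)) ℂ (lieDegree n (d + 2))}

instance : Algebra ℂ (RatSeries B) := Algebra.ofModule
  (fun c s t => by
    ext v
    simp only [map_smul, coeff_mul', LinearMap.smul_apply, Finset.smul_sum])
  (fun c s t => by
    ext v
    simp only [map_smul, coeff_mul', Finset.smul_sum])

variable (B) in
/-- The homomorphism from the free algebra to formal series given by the normal form. -/
def ofFree : FreeAlgebra ℂ (Fin n) →ₐ[ℂ] RatSeries B :=
  AlgHom.ofLinearMap
    { toFun := fun r => (fun l => algebraMap _ _ (normalForm B r l) : MultiIndex m → RatFun n)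
      map_add' := fun r r' => funext fun l => by
        rw [map_add, Finsupp.add_apply, map_add]
        rfl
      map_smul' := fun c r => funext fun l => by
        rw [map_smul, Finsupp.smul_apply]
        exact map_smul (IsScalarTower.toAlgHom ℂ (MvPolynomial (Fin n) ℂ) (RatFun n)) c _ }
    (by
      classical
      ext l
      rw [one_def, coeff_single]
      change algebraMap _ _ (normalForm B 1 l) = _
      rw [← term_one_zero B, normalForm_term]
      rcases eq_or_ne l 0 with rfl | h
      · simp
      · simp [h])
    (fun x y => by
      ext v
      change algebraMap _ _ (normalForm B (x * y) v) = _
      rw [normalForm_mul B x y le_rfl, coeff_mul']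
      simp only [map_sum, ← structMap_algebraMap]
      rfl)

theorem coeff_ofFree (r : FreeAlgebra ℂ (Fin n)) (l : MultiIndex m) :
    coeff l (ofFree B r) = algebraMap _ _ (normalForm B r l) := rfl

theorem ofFree_term (f : MvPolynomial (Fin n) ℂ) (l : MultiIndex m) :
    ofFree B (normalOrder n f * orderedMonomial B l) = single B l (algebraMap _ _ f) := by
  ext k
  rw [coeff_ofFree, normalForm_term]
  rcases eq_or_ne k l with rfl | h
  · rw [Finsupp.single_eq_same, coeff_single_same]
  · rw [Finsupp.single_eq_of_ne h, map_zero, coeff_single_ne h]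

variable (B) in
/-- The formal series with terms of order at least `d`. -/
def filtration (d : ℕ) : Ideal (RatSeries B) where
  carrier := {s | ∀ l : MultiIndex m, l.ord < d → coeff l s = 0}
  add_mem' {s t} hs ht l hl := by rw [map_add, hs l hl, ht l hl, add_zero]
  zero_mem' l _ := map_zero _
  smul_mem' s t ht v hv := by
    rw [smul_eq_mul, coeff_mul']
    refine Finset.sum_eq_zero fun l _ => Finset.sum_eq_zero fun k hk => ?_
    rw [ht k ((mem_ordLE.1 hk).trans_lt hv), map_zero]

theorem mem_filtration {d : ℕ} {s : RatSeries B} :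
    s ∈ filtration B d ↔ ∀ l : MultiIndex m, l.ord < d → coeff l s = 0 := Iff.rfl

instance (d : ℕ) : (filtration B d).IsTwoSided where
  mul_mem_of_left {s} t hs v hv := by
    rw [coeff_mul']
    refine Finset.sum_eq_zero fun l hl => Finset.sum_eq_zero fun k _ => ?_
    rw [hs l ((mem_ordLE.1 hl).trans_lt hv)]
    simp

theorem ofFree_mem_filtration {d : ℕ} {r : FreeAlgebra ℂ (Fin n)} :
    ofFree B r ∈ filtration B d ↔ r ∈ ncFiltration (FreeAlgebra ℂ (Fin n)) d := by
  rw [mem_filtration, mem_ncFiltration_iff B]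
  simp only [coeff_ofFree, map_eq_zero_iff _
    (IsFractionRing.injective (MvPolynomial (Fin n) ℂ) (RatFun n))]

variable (B) in
include B in
theorem lift_X_normalOrder (f : MvPolynomial (Fin n) ℂ) :
    FreeAlgebra.lift ℂ (MvPolynomial.X : Fin n → MvPolynomial (Fin n) ℂ) (normalOrder n f) =
      f := by
  have := normalForm_term B f 0
  rw [orderedMonomial_zero, mul_one] at this
  rw [lift_X_eq_normalForm B, this, Finsupp.single_eq_same]

/-- Modulo `F^1` the normal ordering is multiplicative, and the error multiplied by `M_k` has order
greater than `ord k`. -/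
theorem prodForm_zero_top {k v : MultiIndex m} (h : k.ord = v.ord)
    (f g : MvPolynomial (Fin n) ℂ) [Decidable (v = k)] :
    prodForm B 0 k v f g = if v = k then f * g else 0 := by
  have h1 : normalOrder n f * normalOrder n g - normalOrder n (f * g) ∈
      ncFiltration (FreeAlgebra ℂ (Fin n)) 1 := by
    rw [mem_ncFiltration_iff B]
    intro l hl
    rw [MultiIndex.eq_zero_of_ord (Nat.lt_one_iff.1 hl), ← lift_X_eq_normalForm B, map_sub,
      map_mul, lift_X_normalOrder B, lift_X_normalOrder B, lift_X_normalOrder B, sub_self]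
  have h2 := (mem_ncFiltration_iff B _ _).1 (mul_mem_ncFiltration h1
    (term_mem_ncFiltration B 1 k)) v (by omega)
  have h3 : (normalOrder n f * normalOrder n g - normalOrder n (f * g)) *
      (normalOrder n 1 * orderedMonomial B k) =
      normalOrder n f * orderedMonomial B 0 * (normalOrder n g * orderedMonomial B k) -
      normalOrder n (f * g) * orderedMonomial B k := by
    simp [normalOrder_one, orderedMonomial, sub_mul, mul_assoc]
  rw [h3, map_sub, Finsupp.sub_apply, sub_eq_zero, normalForm_term, ← prodForm_apply] at h2
  rw [h2, Finsupp.single_apply]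
  simp only [eq_comm]

theorem structMap_zero_top {k v : MultiIndex m} (h : k.ord = v.ord)
    (f g : RatFun n) [Decidable (v = k)] :
    structMap B 0 k v f g = if v = k then f * g else 0 := by
  have h1 : structMap B 0 k v = if v = k then LinearMap.mul ℂ (RatFun n) else 0 := by
    refine structMap_ext B (fun f => ?_) (fun g => ?_) fun f g => ?_
    · split_ifs
      · exact mulLeft_mem_diffOps f
      · exact zero_mem _
    · split_ifs
      · convert mulLeft_mem_diffOps g using 1
        refine LinearMap.ext fun x => ?_
        simp
      · exact zero_mem _
    · rw [prodForm_zero_top h]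
      split_ifs <;> simp
  rw [h1]
  split_ifs <;> rfl

/-- Terms of `s` with `l ≠ 0` raise the order beyond `d`. The remaining factor acts on the lowest
order terms of `e` by multiplication of functions. -/
theorem coeff_mul_top {d : ℕ} (s : RatSeries B) {e : RatSeries B} (he : e ∈ filtration B d)
    {v : MultiIndex m} (hv : v.ord ≤ d) : coeff v (s * e) = coeff 0 s * coeff v e := by
  classical
  rw [coeff_mul', Finset.sum_eq_single_of_mem 0 (mem_ordLE.2 (by simp [MultiIndex.ord_zero])),
    Finset.sum_eq_single_of_mem v (mem_ordLE.2 le_rfl), structMap_zero_top rfl, if_pos rfl]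
  · intro k hk hkv
    rcases lt_or_ge k.ord d with h | h
    · rw [he k h, map_zero]
    · rw [structMap_zero_top (by have := mem_ordLE.1 hk; omega), if_neg hkv.symm]
  · intro l _ hl
    have hl0 : l.ord ≠ 0 := fun h => hl (MultiIndex.eq_zero_of_ord h)
    refine Finset.sum_eq_zero fun k hk => ?_
    rcases lt_or_ge k.ord d with h | h
    · rw [he k h, map_zero]
    · rw [structMap_eq_zero B (by omega)]
      rfl

/-! ### Series with regular coefficients -/

theorem coe_evalRegular (U : Opens (AffSpace n)) (l k v : MultiIndex m)
    (f g : regularFunctions U) :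
    ((normalOp B l k v).evalRegular U f g : RatFun n) = structMap B l k v f g := by
  rw [structMap, ← BiDiffOp.eval_eq_bilin]
  exact BiDiffOp.eval_map _ _ ratDeriv _ (regularFunctions U).val (fun i a => rfl)
    (fun p => rfl) _ f g

theorem algebraMap_mem_regularFunctions (U : Opens (AffSpace n)) (f : MvPolynomial (Fin n) ℂ) :
    algebraMap _ (RatFun n) f ∈ regularFunctions U := (polyToRegular U f).2

variable (B) in
/-- The algebra of formal series with coefficients regular in `U`. -/
def regularSeries (U : Opens (AffSpace n)) : Subalgebra ℂ (RatSeries B) where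
  carrier := {s | ∀ l, coeff l s ∈ regularFunctions U}
  add_mem' {s t} hs ht l := by
    rw [map_add]
    exact add_mem (hs l) (ht l)
  mul_mem' {s t} hs ht v := by
    rw [coeff_mul']
    refine sum_mem fun l _ => sum_mem fun k _ => ?_
    rw [← coe_evalRegular U l k v ⟨_, hs l⟩ ⟨_, ht k⟩]
    exact Subtype.coe_prop _
  algebraMap_mem' c l := by
    rw [← (ofFree B).commutes, coeff_ofFree]
    exact algebraMap_mem_regularFunctions U _

theorem ofFree_mem_regularSeries (U : Opens (AffSpace n)) (r : FreeAlgebra ℂ (Fin n)) :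
    ofFree B r ∈ regularSeries B U := fun _ => algebraMap_mem_regularFunctions U _

variable (B) in
/-- A formal sum with regular coefficients, as a formal series with rational coefficients. -/
def ofNormalSeries (U : Opens (AffSpace n)) : NormalSeries m U →ₗ[ℂ] RatSeries B where
  toFun s := (fun l => (s l : RatFun n) : MultiIndex m → RatFun n)
  map_add' _ _ := rfl
  map_smul' _ _ := rfl

theorem coeff_ofNormalSeries {U : Opens (AffSpace n)} (s : NormalSeries m U) (l : MultiIndex m) :
    coeff l (ofNormalSeries B U s) = s l := rfl

theorem ofNormalSeries_mem {U : Opens (AffSpace n)} (s : NormalSeries m U) :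
    ofNormalSeries B U s ∈ regularSeries B U := fun l => (s l).2

theorem ofNormalSeries_term {U : Opens (AffSpace n)} (f : regularFunctions U) (l : MultiIndex m) :
    ofNormalSeries B U (NormalSeries.term f l) = single B l f := by
  ext k
  rw [coeff_ofNormalSeries, NormalSeries.term]
  rcases eq_or_ne k l with rfl | h
  · rw [Pi.single_eq_same, coeff_single_same]
  · rw [Pi.single_eq_of_ne h, coeff_single_ne h]
    rfl

variable (B) in
theorem finite_normalOp_ne_zero (v : MultiIndex m) :
    {lk : MultiIndex m × MultiIndex m | normalOp B lk.1 lk.2 v ≠ 0}.Finite := by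
  refine (ordLE m v.ord ×ˢ ordLE m v.ord).finite_toSet.subset fun lk h => ?_
  have := ord_add_ord_le_of_normalOp_ne_zero B h
  rw [Finset.mem_coe, Finset.mem_product, mem_ordLE, mem_ordLE]
  omega

theorem ofNormalSeries_mul {U : Opens (AffSpace n)} (s t : NormalSeries m U) :
    ofNormalSeries B U (NormalSeries.mul (normalOp B) s t) =
      ofNormalSeries B U s * ofNormalSeries B U t := by
  ext v
  rw [coeff_ofNormalSeries, NormalSeries.mul, coeff_mul', ← Finset.sum_product',
    finsum_eq_sum_of_support_subset (s := ordLE m v.ord ×ˢ ordLE m v.ord)]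
  · rw [AddSubmonoidClass.coe_finsetSum]
    exact Finset.sum_congr rfl fun lk _ => coe_evalRegular U _ _ _ _ _
  · intro lk h
    rw [Function.mem_support] at h
    have h1 : normalOp B lk.1 lk.2 v ≠ 0 := fun h0 => h (by
      rw [h0]
      simp [BiDiffOp.evalRegular, BiDiffOp.eval])
    have := ord_add_ord_le_of_normalOp_ne_zero B h1
    rw [Finset.mem_coe, Finset.mem_product, mem_ordLE, mem_ordLE]
    omega

/-! ### Invertible series -/

/-- Successive approximation: the error of order `d` is divided by the coefficient of `s` at zero
and subtracted. Regularity in `U` is preserved, as no other division occurs. -/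
theorem exists_right_inverse {U : Opens (AffSpace n)} {s : RatSeries B}
    (hs : s ∈ regularSeries B U) (h0 : coeff 0 s ≠ 0) (hU : (coeff 0 s)⁻¹ ∈ regularFunctions U)
    (d : ℕ) : ∃ t ∈ regularSeries B U, s * t - 1 ∈ filtration B d := by
  classical
  induction d with
  | zero => exact ⟨0, zero_mem _, fun l hl => absurd hl (Nat.not_lt_zero _)⟩
  | succ d ih =>
    obtain ⟨t, ht, h⟩ := ih
    set e := s * t - 1 with he
    have heU : e ∈ regularSeries B U := sub_mem (mul_mem hs ht) (one_mem _)
    let δ : RatSeries B := fun l => if l.ord = d then -((coeff 0 s)⁻¹ * coeff l e) else 0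
    have hδ : ∀ l, coeff l δ = if l.ord = d then -((coeff 0 s)⁻¹ * coeff l e) else 0 :=
      fun l => rfl
    have hδd : δ ∈ filtration B d := fun l hl => by rw [hδ, if_neg hl.ne]
    refine ⟨t + δ, add_mem ht fun l => ?_, fun l hl => ?_⟩
    · rw [hδ]
      split_ifs
      · exact neg_mem (mul_mem hU (heU l))
      · exact zero_mem _
    · have h1 : s * (t + δ) - 1 = e + s * δ := by rw [he, mul_add, add_sub_right_comm]
      rw [h1, map_add, coeff_mul_top s hδd (Nat.lt_succ_iff.1 hl), hδ]
      split_ifs with hl'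
      · rw [mul_neg, mul_inv_cancel_left₀ h0, add_neg_cancel]
      · rw [mul_zero, add_zero]
        exact h l (by omega)

theorem coeff_zero_mul (s t : RatSeries B) : coeff 0 (s * t) = coeff 0 s * coeff 0 t :=
  coeff_mul_top (d := 0) s (fun l hl => absurd hl (Nat.not_lt_zero _))
    (by rw [MultiIndex.ord_zero])

theorem isUnit_mk {s : RatSeries B} (h0 : coeff 0 s ≠ 0) (d : ℕ) :
    IsUnit (Ideal.Quotient.mk (filtration B (d + 1)) s) := by
  have key : ∀ s : RatSeries B, coeff 0 s ≠ 0 → ∃ t : RatSeries B, coeff 0 t ≠ 0 ∧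
      Ideal.Quotient.mk (filtration B (d + 1)) s * Ideal.Quotient.mk _ t = 1 := fun s h0 => by
    -- On the empty open set regularity is no condition. The right inverse again has a nonzero
    -- coefficient at zero, so it has a right inverse itself and is two-sided.
    obtain ⟨t, -, ht⟩ := exists_right_inverse (U := ⊥) (s := s) (fun l p hp => hp.elim) h0
      (fun p hp => hp.elim) (d + 1)
    refine ⟨t, fun h => ?_, ?_⟩
    · have := ht 0 (by rw [MultiIndex.ord_zero]; omega)
      rw [map_sub, coeff_zero_mul, h, mul_zero, zero_sub, one_def, coeff_single_same] at this
      simp at this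
    · rw [← map_mul, ← map_one (Ideal.Quotient.mk _), Ideal.Quotient.eq]
      exact ht
  obtain ⟨t, ht, h1⟩ := key s h0
  obtain ⟨u, -, h2⟩ := key t ht
  refine ⟨⟨_, _, h1, ?_⟩, rfl⟩
  rw [left_inv_eq_right_inv h1 h2, h2]

end RatSeries

open TopologicalSpace (Opens)

/-! ## The stalks in terms of formal series -/

theorem FracRing.of_mul_frac {R : Type*} [Ring R] (S : Submonoid R) [OreLocalization.OreSet S]
    (a : R) (t : S) : FracRing.of S t * FracRing.frac a t = FracRing.of S a := by
  rw [FracRing.of_apply, FracRing.of_apply,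
    FracRing.frac_mul_frac (t : R) a 1 t 1 1 (by simp)]
  simp

theorem FracRing.exists_frac {R : Type*} [Ring R] (S : Submonoid R) [OreLocalization.OreSet S]
    (x : FracRing S) : ∃ a t, x = FracRing.frac a t := by
  induction x using OreLocalization.ind with | _ a t
  exact ⟨a, t, rfl⟩

namespace RatSeries

variable {n : ℕ} {m : ℕ → ℕ} (B : ∀ d, Module.Basis (Fin (m d)) ℂ (lieDegree n (d + 2)))

/-- Formal series modulo terms of order greater than `d`. -/
abbrev Truncated (d : ℕ) : Type := RatSeries B ⧸ filtration B (d + 1)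

variable {B} in
theorem mk_eq_mk_iff {d : ℕ} {s t : RatSeries B} :
    (Ideal.Quotient.mk _ s : Truncated B d) = Ideal.Quotient.mk _ t ↔
      ∀ l : MultiIndex m, l.ord ≤ d → coeff l s = coeff l t := by
  rw [Ideal.Quotient.eq, mem_filtration]
  simp only [map_sub, sub_eq_zero, Nat.lt_succ_iff]

/-- The homomorphism from the truncated free algebra to truncated formal series. -/
def ofTrunc (d : ℕ) : Trunc (FreeNC n) d →+* Truncated B d :=
  (freeToTrunc n d).toRingHom.liftOfSurjective (freeToTrunc_surjective B d)
    ⟨(Ideal.Quotient.mk _).comp (ofFree B).toRingHom, fun _ hr =>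
      Ideal.Quotient.eq_zero_iff_mem.2
        (ofFree_mem_filtration.2 (mem_ncFiltration_of_freeToTrunc_eq_zero hr))⟩

theorem ofTrunc_freeToTrunc (d : ℕ) (r : FreeAlgebra ℂ (Fin n)) :
    ofTrunc B d (freeToTrunc n d r) = Ideal.Quotient.mk _ (ofFree B r) :=
  RingHom.liftOfSurjective_comp_apply _ (freeToTrunc_surjective B d) _ r

theorem ofTrunc_injective (d : ℕ) : Function.Injective (ofTrunc B d) := by
  rw [injective_iff_map_eq_zero]
  intro x hx
  obtain ⟨r, rfl⟩ := freeToTrunc_surjective B d x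
  rw [ofTrunc_freeToTrunc, Ideal.Quotient.eq_zero_iff_mem, ofFree_mem_filtration] at hx
  exact Ideal.Quotient.eq_zero_iff_mem.2 (ncFiltration_map (toFreeNC n) hx)

theorem truncMap_freeToTrunc (d : ℕ) (r : FreeAlgebra ℂ (Fin n)) :
    truncMap (abMap n) d (freeToTrunc n d r) = normalForm B r 0 :=
  lift_X_eq_normalForm B r

theorem freeToTrunc_mem_denoms {d : ℕ} {p : AffSpace n} {r : FreeAlgebra ℂ (Fin n)} :
    freeToTrunc n d r ∈ denoms (abMap n) d p ↔ normalForm B r 0 ∉ p.asIdeal := by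
  rw [mem_denoms_iff, truncMap_freeToTrunc B]

variable {B} in
theorem coeff_zero_ofFree_ne_zero {p : AffSpace n} {r : FreeAlgebra ℂ (Fin n)}
    (h : normalForm B r 0 ∉ p.asIdeal) : coeff 0 (ofFree B r) ≠ 0 := by
  rw [coeff_ofFree, map_ne_zero_iff _
    (IsFractionRing.injective (MvPolynomial (Fin n) ℂ) (RatFun n))]
  rintro h0
  exact h (h0 ▸ p.asIdeal.zero_mem)

theorem isUnit_ofTrunc {d : ℕ} {p : AffSpace n} (t : denoms (abMap n) d p) :
    IsUnit (ofTrunc B d t) := by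
  obtain ⟨t, ht⟩ := t
  obtain ⟨r, rfl⟩ := freeToTrunc_surjective B d t
  rw [ofTrunc_freeToTrunc]
  exact isUnit_mk (coeff_zero_ofFree_ne_zero ((freeToTrunc_mem_denoms B).1 ht)) d

/-- The homomorphism from the stalks of the truncated structure sheaf to truncated formal series. -/
def ofStalk (d : ℕ) (p : AffSpace n) : Stalk (abMap n) d p →+* Truncated B d :=
  OreLocalization.universalHom (ofTrunc B d)
    (IsUnit.liftRight ((ofTrunc B d).toMonoidHom.comp (denoms (abMap n) d p).subtype)
      (isUnit_ofTrunc B)) fun _ => rfl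

theorem ofStalk_of (d : ℕ) (p : AffSpace n) (x : Trunc (FreeNC n) d) :
    ofStalk B d p (FracRing.of _ x) = ofTrunc B d x :=
  OreLocalization.universalHom_commutes _ _ _

theorem ofStalk_algebraMap (d : ℕ) (p : AffSpace n) (c : ℂ) :
    ofStalk B d p (algebraMap ℂ _ c) = Ideal.Quotient.mk _ (algebraMap ℂ _ c) := by
  have h := ofTrunc_freeToTrunc B d (algebraMap ℂ _ c)
  rw [AlgHom.commutes, AlgHom.commutes] at h
  rw [← h]
  exact ofStalk_of B d p _

theorem ofTrunc_mul_ofStalk_frac (d : ℕ) (p : AffSpace n) (a : Trunc (FreeNC n) d)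
    (t : denoms (abMap n) d p) :
    ofTrunc B d t * ofStalk B d p (FracRing.frac a t) = ofTrunc B d a := by
  rw [← ofStalk_of B d p, ← ofStalk_of B d p a, ← map_mul, FracRing.of_mul_frac]

theorem ofStalk_frac_eq_iff {d : ℕ} {p : AffSpace n} {a : Trunc (FreeNC n) d}
    {t : denoms (abMap n) d p} {q : Truncated B d} :
    ofStalk B d p (FracRing.frac a t) = q ↔ ofTrunc B d t * q = ofTrunc B d a := by
  rw [← ofTrunc_mul_ofStalk_frac B d p a t]
  exact ⟨fun h => by rw [h], fun h => ((isUnit_ofTrunc B t).mul_left_cancel h).symm⟩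

/-- Denominators become units and the truncated algebra already embeds. Identities between germs can
thus be checked on series. -/
theorem ofStalk_injective (d : ℕ) (p : AffSpace n) : Function.Injective (ofStalk B d p) := by
  rw [injective_iff_map_eq_zero]
  intro x hx
  obtain ⟨a, t, rfl⟩ := FracRing.exists_frac _ x
  rw [ofStalk_frac_eq_iff, mul_zero, eq_comm, map_eq_zero_iff _ (ofTrunc_injective B d)] at hx
  rw [hx]
  exact OreLocalization.zero_oreDiv t

variable {B} in
theorem filtration_succ_le (d : ℕ) : filtration B (d + 1) ≤ filtration B d :=
  fun _ hs l hl => hs l (hl.trans (Nat.lt_succ_self d))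

variable {B} in
/-- The transition homomorphism between truncated formal series. -/
def truncatedProj (d : ℕ) : Truncated B (d + 1) →+* Truncated B d :=
  Ideal.Quotient.factor (filtration_succ_le (d + 1))

variable {B} in
theorem truncatedProj_mk (d : ℕ) (s : RatSeries B) :
    truncatedProj d (Ideal.Quotient.mk _ s) = Ideal.Quotient.mk _ s := rfl

theorem truncatedProj_ofTrunc (d : ℕ) (x : Trunc (FreeNC n) (d + 1)) :
    truncatedProj d (ofTrunc B (d + 1) x) = ofTrunc B d (Trunc.proj _ d x) := by
  obtain ⟨r, rfl⟩ := freeToTrunc_surjective B (d + 1) x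
  rw [ofTrunc_freeToTrunc, truncatedProj_mk, ← ofTrunc_freeToTrunc]
  rfl

theorem truncatedProj_ofStalk (d : ℕ) (p : AffSpace n) (x : Stalk (abMap n) (d + 1) p) :
    truncatedProj d (ofStalk B (d + 1) p x) = ofStalk B d p (stalkProj (abMap n) d p x) := by
  obtain ⟨a, t, rfl⟩ := FracRing.exists_frac _ x
  refine (isUnit_ofTrunc B ⟨_, proj_mem_denoms _ d p t t.2⟩).mul_left_cancel ?_
  have h1 := congrArg (truncatedProj d) (ofTrunc_mul_ofStalk_frac B (d + 1) p a t)
  have h2 := congrArg (fun y => ofStalk B d p (stalkProj (abMap n) d p y))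
    (FracRing.of_mul_frac _ a t)
  have h3 : ∀ y, stalkProj (abMap n) d p (FracRing.of _ y) = FracRing.of _ (Trunc.proj _ d y) :=
    fun y => FracRing.map_of _ _ _ _ _
  simp only [map_mul, h3, ofStalk_of] at h2
  rw [map_mul, truncatedProj_ofTrunc, truncatedProj_ofTrunc, ← h2] at h1
  exact h1

/-! ### Fractions representing regular series -/

variable {B}

theorem exists_common_denominator {U : Opens (AffSpace n)} {p : AffSpace n} (hp : p ∈ U)
    {s : RatSeries B} (hs : s ∈ regularSeries B U) (T : Finset (MultiIndex m)) :
    ∃ q : MvPolynomial (Fin n) ℂ, q ∉ p.asIdeal ∧ ∃ a : MultiIndex m → MvPolynomial (Fin n) ℂ,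
      ∀ l ∈ T, algebraMap _ _ q * coeff l s = algebraMap _ _ (a l) := by
  choose a t ht h using fun l => hs l p hp
  classical
  refine ⟨∏ l ∈ T, t l, fun hq => ?_, fun l => (∏ j ∈ T.erase l, t j) * a l, fun l hl => ?_⟩
  · obtain ⟨l, -, hl⟩ := (p.isPrime.prod_mem_iff).1 hq
    exact ht l hl
  · rw [← Finset.prod_erase_mul _ _ hl, map_mul, map_mul, ← h]
    ring

/-- Multiplying by `⟦q⟧` turns the lowest order part of the error into polynomials, by
`coeff_mul_top`; these are moved into the numerator, and the order of the error increases. -/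
theorem exists_fraction {U : Opens (AffSpace n)} {p : AffSpace n} (hp : p ∈ U)
    {s : RatSeries B} (hs : s ∈ regularSeries B U) (d : ℕ) :
    ∃ r t : FreeAlgebra ℂ (Fin n), normalForm B t 0 ∉ p.asIdeal ∧
      ofFree B t * s - ofFree B r ∈ filtration B d := by
  induction d with
  | zero =>
    refine ⟨0, 1, fun h => p.isPrime.ne_top ((Ideal.eq_top_iff_one _).2 ?_),
      fun l hl => absurd hl (Nat.not_lt_zero _)⟩
    rwa [← lift_X_eq_normalForm B, map_one] at h
  | succ d ih =>
    obtain ⟨r, t, ht, h⟩ := ih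
    set e := ofFree B t * s - ofFree B r with he
    have heU : e ∈ regularSeries B U := sub_mem (mul_mem (ofFree_mem_regularSeries U t) hs)
      (ofFree_mem_regularSeries U r)
    obtain ⟨q, hq, a, ha⟩ := exists_common_denominator hp heU (ordLE m d)
    refine ⟨normalOrder n q * r + ∑ l ∈ ordLE m d, normalOrder n (a l) * orderedMonomial B l,
      normalOrder n q * t, ?_, fun v hv => ?_⟩
    · rw [← lift_X_eq_normalForm B, map_mul, lift_X_normalOrder B]
      rw [← lift_X_eq_normalForm B] at ht
      exact fun hmem => (p.isPrime.mem_or_mem hmem).elim hq ht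
    · have h1 : ofFree B (normalOrder n q * t) * s - ofFree B (normalOrder n q * r +
          ∑ l ∈ ordLE m d, normalOrder n (a l) * orderedMonomial B l) =
          ofFree B (normalOrder n q) * e - ∑ l ∈ ordLE m d, single B l (algebraMap _ _ (a l)) := by
        rw [he]
        simp only [map_mul, map_add, map_sum, ← ofFree_term]
        noncomm_ring
      have hv' : v ∈ ordLE m d := mem_ordLE.2 (Nat.lt_succ_iff.1 hv)
      rw [h1, map_sub, map_sum, coeff_mul_top _ h (Nat.lt_succ_iff.1 hv),
        Finset.sum_eq_single_of_mem v hv' (fun l _ hl => coeff_single_ne hl.symm _),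
        coeff_single_same, coeff_ofFree, ← lift_X_eq_normalForm B,
        lift_X_normalOrder B, ha v hv', sub_self]

end RatSeries

open TopologicalSpace (Opens)

/-! ## Sections in terms of formal series -/

namespace RatSeries

variable {n : ℕ} {m : ℕ → ℕ} (B : ∀ d, Module.Basis (Fin (m d)) ℂ (lieDegree n (d + 2)))

theorem section_ext {U : Opens (AffSpace n)} {x y : ncAffineSections n U}
    (h : ∀ (d : ℕ) (p : U), ofStalk B d p.1 (x.1 d p) = ofStalk B d p.1 (y.1 d p)) : x = y :=
  Subtype.ext (funext fun d => funext fun p => ofStalk_injective B d p.1 (h d p))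

theorem exists_trunc_fraction {U : Opens (AffSpace n)} {s : RatSeries B}
    (hs : s ∈ regularSeries B U) (d : ℕ) (p : U) : ∃ a t : Trunc (FreeNC n) d,
      t ∈ denoms (abMap n) d p.1 ∧ ofTrunc B d t * Ideal.Quotient.mk _ s = ofTrunc B d a := by
  obtain ⟨r, t, ht, h⟩ := exists_fraction p.2 hs (d + 1)
  refine ⟨freeToTrunc n d r, freeToTrunc n d t, (freeToTrunc_mem_denoms B).2 ht, ?_⟩
  rw [ofTrunc_freeToTrunc, ofTrunc_freeToTrunc, ← map_mul, Ideal.Quotient.eq]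
  exact h

theorem exists_germ {U : Opens (AffSpace n)} (s : NormalSeries m U) (d : ℕ) (p : U) :
    ∃ x, ofStalk B d p.1 x = Ideal.Quotient.mk _ (ofNormalSeries B U s) := by
  obtain ⟨a, t, ht, h⟩ := exists_trunc_fraction B (ofNormalSeries_mem s) d p
  exact ⟨FracRing.frac a ⟨t, ht⟩, (ofStalk_frac_eq_iff B).2 h⟩

/-- The germ at `p` of the section given by a formal sum. -/
def germ {U : Opens (AffSpace n)} (s : NormalSeries m U) (d : ℕ) (p : U) :
    Stalk (abMap n) d p.1 := (exists_germ B s d p).choose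

theorem ofStalk_germ {U : Opens (AffSpace n)} (s : NormalSeries m U) (d : ℕ) (p : U) :
    ofStalk B d p.1 (germ B s d p) = Ideal.Quotient.mk _ (ofNormalSeries B U s) :=
  (exists_germ B s d p).choose_spec

/-- The fraction found at one point represents the series wherever its denominator is allowed, which
is a basic open set. -/
theorem isLocallyFraction_germ {U : Opens (AffSpace n)} (s : NormalSeries m U) (d : ℕ) :
    IsLocallyFraction (abMap n) d U (germ B s d) := by
  intro p
  obtain ⟨a, t, ht, h⟩ := exists_trunc_fraction B (ofNormalSeries_mem s) d p
  have key : ∀ (q : U) (hq : t ∈ denoms (abMap n) d q.1),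
      germ B s d q = FracRing.frac a ⟨t, hq⟩ := fun q hq => by
    apply ofStalk_injective B d q.1
    rw [ofStalk_germ, eq_comm]
    exact (ofStalk_frac_eq_iff B).2 h
  exact ⟨U ⊓ PrimeSpectrum.basicOpen (truncMap (abMap n) d t), ⟨p.2, ht⟩, inf_le_left, a, t,
    fun q hq => ⟨hq.2, key ⟨q, hq.1⟩ hq.2⟩⟩

/-- The section of the structure sheaf given by a formal sum. -/
def toSections (U : Opens (AffSpace n)) : NormalSeries m U →ₗ[ℂ] ncAffineSections n U where
  toFun s := ⟨germ B s, isLocallyFraction_germ B s, fun d p => ofStalk_injective B d p.1 (by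
    rw [← truncatedProj_ofStalk, ofStalk_germ, ofStalk_germ, truncatedProj_mk])⟩
  map_add' s t := section_ext B fun d p => by
    change ofStalk B d p.1 (germ B (s + t) d p) = ofStalk B d p.1 (germ B s d p + germ B t d p)
    rw [map_add, ofStalk_germ, ofStalk_germ, ofStalk_germ, map_add, map_add]
  map_smul' c s := section_ext B fun d p => by
    change ofStalk B d p.1 (germ B (c • s) d p) = ofStalk B d p.1 (c • germ B s d p)
    rw [Algebra.smul_def c (germ B s d p), map_mul, ofStalk_germ, ofStalk_germ,
      ofStalk_algebraMap, map_smul, Algebra.smul_def, map_mul]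

theorem ofStalk_toSections {U : Opens (AffSpace n)} (s : NormalSeries m U) (d : ℕ) (p : U) :
    ofStalk B d p.1 ((toSections B U s).1 d p) = Ideal.Quotient.mk _ (ofNormalSeries B U s) :=
  ofStalk_germ B s d p

theorem toSections_one (U : Opens (AffSpace n)) :
    toSections B U (NormalSeries.term 1 0) = 1 := section_ext B fun d p => by
  rw [ofStalk_toSections, ofNormalSeries_term]
  exact (map_one _).trans (map_one (ofStalk B d p.1)).symm

theorem toSections_mul {U : Opens (AffSpace n)} (s t : NormalSeries m U) :
    toSections B U (NormalSeries.mul (normalOp B) s t) = toSections B U s * toSections B U t :=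
  section_ext B fun d p => by
    rw [ofStalk_toSections, ofNormalSeries_mul, map_mul, ← ofStalk_toSections B s d p,
      ← ofStalk_toSections B t d p, ← map_mul]
    rfl

theorem toSections_restrict {U V : Opens (AffSpace n)} (h : V ≤ U) (s : NormalSeries m U) :
    toSections B V (NormalSeries.restrict h s) = spfRestrict _ h (toSections B U s) :=
  section_ext B fun d p => by
    rw [ofStalk_toSections]
    exact (ofStalk_toSections B s d ⟨p.1, h p.2⟩).symm

theorem toSections_term (U : Opens (AffSpace n)) (f : MvPolynomial (Fin n) ℂ)
    (l : MultiIndex m) : toSections B U (NormalSeries.term (polyToRegular U f) l) =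
      toSpfSections (abMap n) U (toFreeNC n (normalOrder n f * orderedMonomial B l)) :=
  section_ext B fun d p => by
    rw [ofStalk_toSections, ofNormalSeries_term]
    refine Eq.trans ?_ (ofStalk_of B d p.1 (freeToTrunc n d _)).symm
    rw [ofTrunc_freeToTrunc, ofFree_term]
    rfl

theorem toSections_eq_zero_iff {U : Opens (AffSpace n)} (hU : (U : Set (AffSpace n)).Nonempty)
    (s : NormalSeries m U) (d : ℕ) :
    (toSections B U s).1 d = 0 ↔ ∀ l : MultiIndex m, l.ord ≤ d → s l = 0 := by
  have h : (Ideal.Quotient.mk _ (ofNormalSeries B U s) : Truncated B d) = 0 ↔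
      ∀ l : MultiIndex m, l.ord ≤ d → s l = 0 := by
    rw [← map_zero (Ideal.Quotient.mk _), mk_eq_mk_iff]
    simp only [coeff_ofNormalSeries, map_zero, ZeroMemClass.coe_eq_zero]
  rw [← h]
  constructor
  · intro h0
    obtain ⟨p, hp⟩ := hU
    rw [← ofStalk_toSections B s d ⟨p, hp⟩, h0]
    exact map_zero _
  · refine fun h0 => funext fun p => ofStalk_injective B d p.1 ?_
    rw [ofStalk_toSections, h0]
    exact (map_zero _).symm

theorem toSections_injective {U : Opens (AffSpace n)} (hU : (U : Set (AffSpace n)).Nonempty) :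
    Function.Injective (toSections B U : NormalSeries m U → ncAffineSections n U) := by
  rw [injective_iff_map_eq_zero]
  intro s hs
  funext l
  exact (toSections_eq_zero_iff B hU s l.ord).1 (by rw [hs]; rfl) l le_rfl

/-- The generic point of affine space. -/
def genericPt (n : ℕ) : AffSpace n := ⟨⊥, Ideal.isPrime_bot⟩

theorem genericPt_mem {U : Opens (AffSpace n)} {p : AffSpace n} (hp : p ∈ U) : genericPt n ∈ U :=
  ((PrimeSpectrum.le_iff_specializes _ _).1 (bot_le : (⊥ : Ideal _) ≤ p.asIdeal)).mem_open U.2 hp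

variable {B} in
-- A fraction representing the section near `p` also represents it at the generic point, and its
-- series does not depend on the point.
theorem ofStalk_eq_generic {U : Opens (AffSpace n)} {d : ℕ} {σ : ∀ p : U, Stalk (abMap n) d p.1}
    (h : IsLocallyFraction (abMap n) d U σ) (p : U) :
    ofStalk B d p.1 (σ p) =
      ofStalk B d (genericPt n) (σ ⟨genericPt n, genericPt_mem p.2⟩) := by
  obtain ⟨V, hpV, hV, a, t, hs⟩ := h p
  obtain ⟨hp, h1⟩ := hs p hpV
  obtain ⟨hg, h2⟩ := hs (genericPt n) (genericPt_mem hpV)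
  rw [h1, ofStalk_frac_eq_iff, h2]
  exact ofTrunc_mul_ofStalk_frac B d (genericPt n) a ⟨t, hg⟩

variable {B} in
/-- The formal series of a section has regular coefficients. -/
theorem coeff_mem_regularFunctions {U : Opens (AffSpace n)} {d : ℕ}
    {σ : ∀ p : U, Stalk (abMap n) d p.1} (h : IsLocallyFraction (abMap n) d U σ)
    {s : RatSeries B} (hs : ∀ p : U, ofStalk B d p.1 (σ p) = Ideal.Quotient.mk _ s)
    {l : MultiIndex m} (hl : l.ord ≤ d) : coeff l s ∈ regularFunctions U := by
  intro p hp
  obtain ⟨V, hpV, hV, a, t, hat⟩ := h ⟨p, hp⟩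
  obtain ⟨a, rfl⟩ := freeToTrunc_surjective B d a
  obtain ⟨t, rfl⟩ := freeToTrunc_surjective B d t
  have htV : ∀ q ∈ V, normalForm B t 0 ∉ q.asIdeal := fun q hq =>
    (freeToTrunc_mem_denoms B).1 (hat q hq).1
  have ht0 := coeff_zero_ofFree_ne_zero (htV p hpV)
  -- The commutative image of the denominator vanishes nowhere in `V`, so its inverse series has
  -- coefficients regular in `V`.
  obtain ⟨u, huV, hu⟩ := exists_right_inverse (ofFree_mem_regularSeries V t) ht0
    (fun q hq => ⟨1, normalForm B t 0, htV q hq, by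
      rw [← coeff_ofFree, inv_mul_cancel₀ ht0, map_one]⟩) (d + 1)
  obtain ⟨ht, hσ⟩ := hat p hpV
  have h1 := hs ⟨p, hp⟩
  rw [hσ, ofStalk_frac_eq_iff, ofTrunc_freeToTrunc, ofTrunc_freeToTrunc] at h1
  have h2 : (Ideal.Quotient.mk _ s : Truncated B d) = Ideal.Quotient.mk _ (u * ofFree B a) := by
    refine (isUnit_mk ht0 d).mul_left_cancel ?_
    rw [← Ideal.Quotient.eq (I := filtration B (d + 1)), map_mul, map_one] at hu
    rw [h1, map_mul, ← mul_assoc, hu, one_mul]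
  rw [mk_eq_mk_iff.1 h2 l hl]
  exact mul_mem huV (ofFree_mem_regularSeries V a) l p hpV

theorem toSections_surjective {U : Opens (AffSpace n)} (hU : (U : Set (AffSpace n)).Nonempty) :
    Function.Surjective (toSections B U : NormalSeries m U → ncAffineSections n U) := by
  intro σ
  obtain ⟨p₀, hp₀⟩ := hU
  let g : U := ⟨genericPt n, genericPt_mem hp₀⟩
  choose y hy using fun d => Ideal.Quotient.mk_surjective (ofStalk B d g.1 (σ.1 d g))
  have hy' : ∀ (d : ℕ) (p : U), ofStalk B d p.1 (σ.1 d p) = Ideal.Quotient.mk _ (y d) := fun d p => by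
    rw [hy]
    exact ofStalk_eq_generic (σ.2.1 d) p
  have hsucc : ∀ (l : MultiIndex m) (d : ℕ), l.ord ≤ d → coeff l (y (d + 1)) = coeff l (y d) := by
    intro l d hl
    refine mk_eq_mk_iff.1 ?_ l hl
    rw [← truncatedProj_mk, hy, truncatedProj_ofStalk, σ.2.2, hy]
  have hle : ∀ (l : MultiIndex m) (d : ℕ), l.ord ≤ d → coeff l (y d) = coeff l (y l.ord) := by
    intro l d hl
    induction d, hl using Nat.le_induction with
    | base => rfl
    | succ d hd ih => rw [hsucc l d hd, ih]
  -- The coefficient at `l` is constant in `d` from `d = ord l` on, so it may be read off there.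
  refine ⟨fun l => ⟨coeff l (y l.ord),
    coeff_mem_regularFunctions (σ.2.1 l.ord) (hy' l.ord) le_rfl⟩, section_ext B fun d p => ?_⟩
  rw [ofStalk_toSections, hy', mk_eq_mk_iff]
  exact fun l hl => (hle l d hl).symm

end RatSeries

end NCGeom

end
theorem theorem3p5p3 (n : ℕ) (m : ℕ → ℕ)
    (B : ∀ d, Module.Basis (Fin (m d)) ℂ (NCGeom.lieDegree n (d + 2))) :
    -- the underlying space of the NC-affine space is the affine space
    (Function.Surjective (NCGeom.abMap n) ∧
      ∀ a, NCGeom.abMap n a = 0 ↔ a ∈ NCGeom.ncFiltration (NCGeom.FreeNC n) 1) ∧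
    -- the operators of the normal form exist and are unique
    ∃ C : NCGeom.MultiIndex m → NCGeom.MultiIndex m → NCGeom.MultiIndex m → NCGeom.BiDiffOp n,
      NCGeom.IsNormalFormOperators B C ∧
      (∀ C', NCGeom.IsNormalFormOperators B C' → C' = C) ∧
      -- the multiplication of formal sums is well defined
      (∀ v, {lk : NCGeom.MultiIndex m × NCGeom.MultiIndex m | C lk.1 lk.2 v ≠ 0}.Finite) ∧
      -- the identification of the formal sums with the sections
      ∃ Φ : ∀ U : TopologicalSpace.Opens (NCGeom.AffSpace n), (U : Set (NCGeom.AffSpace n)).Nonempty →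
          (NCGeom.NormalSeries m U ≃ₗ[ℂ] NCGeom.ncAffineSections n U),
        -- it is an isomorphism of algebras
        (∀ U hU, Φ U hU (NCGeom.NormalSeries.term 1 0) = 1) ∧
        (∀ U hU s t, Φ U hU (NCGeom.NormalSeries.mul C s t) = Φ U hU s * Φ U hU t) ∧
        -- it is compatible with restriction
        (∀ U hU V hV, ∀ (h : V ≤ U) s,
          Φ V hV (NCGeom.NormalSeries.restrict h s) = NCGeom.spfRestrict _ h (Φ U hU s)) ∧
        -- it is compatible with the normal form of noncommutative polynomials
        (∀ U hU f l, Φ U hU (NCGeom.NormalSeries.term (NCGeom.polyToRegular U f) l) =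
          NCGeom.toSpfSections (NCGeom.abMap n) U (NCGeom.toFreeNC n
            (NCGeom.normalOrder n f * NCGeom.orderedMonomial B l))) ∧
        -- it identifies the truncations, hence the topologies
        (∀ U hU s d, (Φ U hU s).1 d = 0 ↔ ∀ l, NCGeom.MultiIndex.ord l ≤ d → s l = 0) := by
  refine ⟨⟨NCGeom.abMap_surjective, NCGeom.abMap_eq_zero_iff B⟩, NCGeom.normalOp B,
    NCGeom.isNormalFormOperators_normalOp B, fun C' h => NCGeom.IsNormalFormOperators.unique B h,
    NCGeom.RatSeries.finite_normalOp_ne_zero B, fun U hU => LinearEquiv.ofBijective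
      (NCGeom.RatSeries.toSections B U)
      ⟨NCGeom.RatSeries.toSections_injective B hU, NCGeom.RatSeries.toSections_surjective B hU⟩,
    fun U _ => NCGeom.RatSeries.toSections_one B U,
    fun U _ => NCGeom.RatSeries.toSections_mul B,
    fun U _ V _ => NCGeom.RatSeries.toSections_restrict B,
    fun U _ => NCGeom.RatSeries.toSections_term B U,
    fun U hU => NCGeom.RatSeries.toSections_eq_zero_iff B hU⟩
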